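/- **Geometry.** Let $\Gamma=\mathbb R^2/\mathbb Z^2$ and let $\Omega\subset\mathbb R^3$ be a bounded domain whose boundary is $\partial\Omega=\varphi(\Gamma)$ for a $C^3$ embedding $\varphi:\Gamma\to\mathbb R^3$; let $\mathbf n(y)$ be the outer unit normal of $\Omega$ at $\varphi(y)$. Let $a<0<b$ be such that $(y,z)\mapsto\varphi(y)+z\,\mathbf n(y)$ is an injective immersion of $\Gamma\times(a,b)$, and let $N$ be its image (a tubular neighbourhood of $\partial\Omega$). For $\eta:\Gamma\to(a,b)$ put $\Phi_\eta(y)=\varphi(y)+\eta(y)\mathbf n(y)$ and $$\Omega^\eta=(\Omega\setminus N)\cup\{\varphi(y)+z\,\mathbf n(y): y\in\Gamma,\ a<z<\eta(y)\},$$ the region enclosed by $\Phi_\eta(\Gamma)$. **Displacement.** Let $T>0$ and $$w\in L^\infty(0,T;H^2(\Gamma))\cap W^{1,\infty}(0,T;L^2(\Gamma))\cap H^1(0,T;H^1(\Gamma))$$ (in particular $\partial_t\nabla w\in L^2((0,T)\times\Gamma)$), identified with its continuous representative on $[0,T]\times\Gamma$, with $a<w<b$ on $[0,T]\times\Gamma$.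 Write $\Omega^w(t)=\Omega^{w(t,\cdot)}$ and $w_0=w(0,\cdot)$. Let $B=\{|X|<2R\}$, $R>0$, with $\Omega^w(t)\subset B$ for all $t\in[0,T]$. **Fluid.** Let $\rho\in L^\infty(0,T;L^3(B))$, $\rho\ge0$ a.e., $\mathbf u\in L^2(0,T;H^1_0(B;\mathbb R^3))$, and $\rho_0\in L^1(B)$, $\rho_0\ge 0$ a.e. Assume that for every $\tau\in(0,T)$ the renormalized continuity equation holds on $(0,\tau)$ with initial density $\rho_0$: $$\int_0^\tau\!\!\int_B\rho \mathcal B(\rho)\big(\partial_t\psi+\mathbf u\cdot\nabla\psi\big)=\int_0^\tau\!\!\int_B b(\rho)(\nabla\cdot\mathbf u)\,\psi-\int_B\rho_0\mathcal B(\rho_0)\,\psi(0,\cdot)$$ for all $\psi\in C_c^\infty([0,\tau)\times B)$, all bounded $b\in C[0,\infty)$ with $b(0)=0$, and all functions $\mathcal B(\rho)=\mathcal B(1)+\int_1^\rho\frac{b(z)}{z^2}\,dz$ with $\mathcal B(1)\in\mathbb R$ (where $\rho \mathcal B(\rho):=0$ at $\rho=0$). Assume further the kinematic coupling condition $\mathbf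 u(t,\cdot)\circ\Phi_{w(t,\cdot)}=\partial_tw(t,\cdot)\,\mathbf n$ on $\Gamma$ for a.e. $t\in(0,T)$, in the sense of the Lagrangian trace (the continuous extension of $f\mapsto f\circ\Phi_{w(t,\cdot)}$ from $C_c^\infty(B)$ to $H^1_0(B)$, with values in $L^2(\Gamma)$). **Claim.** If $\rho_0=0$ a.e. on $B\setminus\Omega^{w_0}$, then for a.e. $t\in(0,T)$ $$\rho(t,\cdot)=0\quad\text{a.e. on }B\setminus\Omega^w(t).$$ Consequently, for every $\vartheta$ with $\vartheta>0$ a.e. on $(0,T)\times B$, one has $p_M(\rho,\vartheta)(t,\cdot)=0$ a.e. on $B\setminus\Omega^w(t)$ for a.e. $t\in(0,T)$. Here the molecular pressure $p_M$ is any function that is $C^1$ on $\{\rho>0,\vartheta>0\}$, is continuous on $\{\rho\ge0,\vartheta>0\}$, satisfies $\partial_\rho p_M>0$ for $\rho,\vartheta>0$, and for which there are $P\in C^1[0,\infty)$ with $P(0)=0$, $P'(0)>0$, and constants $0<\underline Z<\overline Z$ such that $p_M(\rho,\vartheta)=\vartheta^{5/2}P(\rho/\vartheta^{3/2})$ whenever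 $0<\rho\le\underline Z\vartheta^{3/2}$ or $\rho>\overline Z\vartheta^{3/2}$. -/

import Mathlib

open Set Filter Topology MeasureTheory
open scoped ContDiff ENNReal

/-- Physical space `ℝ³`. -/
abbrev Space3 : Type := EuclideanSpace ℝ (Fin 3)

/-- The universal cover `ℝ²` of the flat torus `Γ = ℝ²/ℤ²`. A function on `Γ` is a
`ℤ²`-periodic function on `ℝ²`. -/
abbrev Plane : Type := EuclideanSpace ℝ (Fin 2)

/-- The lattice vector of `ℝ²` with integer coordinates `k`. -/
noncomputable def latticeVec (k : Fin 2 → ℤ) : Plane := WithLp.toLp 2 (fun i => (k i : ℝ))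

/-- `f` is `ℤ²`-periodic, that is, a function on `Γ`. -/
def TorusPeriodic {F : Type*} (f : Plane → F) : Prop :=
  ∀ (k : Fin 2 → ℤ) (y : Plane), f (y + latticeVec k) = f y

/-- The Lebesgue measure of `Γ`, seen on the fundamental cell `[0,1)²`. -/
noncomputable def torusMeasure : Measure Plane :=
  volume.restrict {y : Plane | ∀ i, y i ∈ Ico (0 : ℝ) 1}

/-! ### The reference domain and its tubular neighbourhood -/

/-- `Ω ⊆ ℝ³` is a bounded domain whose boundary is the image of the torus under the `C³`
embedding `φ`, and `n y` is the outer unit normal of `Ω` at the boundary point `φ y`. -/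
structure IsReferenceDomain (Ω : Set Space3) (φ n : Plane → Space3) : Prop where
  isOpen : IsOpen Ω
  isConnected : IsConnected Ω
  isBounded : Bornology.IsBounded Ω
  contDiff : ContDiff ℝ 3 φ
  periodic : TorusPeriodic φ
  injective : ∀ y y' : Plane, φ y = φ y' → ∃ k : Fin 2 → ℤ, y' = y + latticeVec k
  immersion : ∀ y : Plane, Function.Injective (fderiv ℝ φ y)
  frontier_eq : frontier Ω = range φ
  normal_continuous : Continuous n
  normal_unit : ∀ y : Plane, ‖n y‖ = 1
  normal_orthogonal : ∀ y v : Plane, inner ℝ (n y) (fderiv ℝ φ y v) = 0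
  normal_inside : ∀ y : Plane, ∀ᶠ s in 𝓝[>] (0 : ℝ), φ y - s • n y ∈ Ω
  normal_outside : ∀ y : Plane, ∀ᶠ s in 𝓝[>] (0 : ℝ), φ y + s • n y ∉ closure Ω

/-- `(a,b)` is an interval of normal displacements for a tubular neighbourhood of `∂Ω`: the map
`(y,z) ↦ φ(y) + z n(y)` is an injective immersion of `Γ × (a,b)`. -/
structure IsTubularInterval (φ n : Plane → Space3) (a b : ℝ) : Prop where
  neg : a < 0
  pos : 0 < b
  injective : ∀ y y' : Plane, ∀ z ∈ Ioo a b, ∀ z' ∈ Ioo a b,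
    φ y + z • n y = φ y' + z' • n y' → z = z' ∧ ∃ k : Fin 2 → ℤ, y' = y + latticeVec k
  immersion : ∀ y : Plane, ∀ z ∈ Ioo a b,
    Function.Injective (fderiv ℝ (fun p : Plane × ℝ => φ p.1 + p.2 • n p.1) (y, z))

/-- The deformation `Φ_η(y) = φ(y) + η(y) n(y)` of the boundary for the displacement `η`. -/
def shellMap (φ n : Plane → Space3) (η : Plane → ℝ) (y : Plane) : Space3 := φ y + η y • n y

/-- The tubular neighbourhood `{φ(y) + z n(y) : y ∈ Γ, a < z < b}` of `∂Ω`. -/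
def tube (φ n : Plane → Space3) (a b : ℝ) : Set Space3 :=
  {X | ∃ y : Plane, ∃ z ∈ Ioo a b, X = φ y + z • n y}

/-- The region `Ω^η` enclosed by the deformed boundary `Γ^η = Φ_η(Γ)`, for `a < η < b`: the part
of `Ω` outside the tubular neighbourhood together with the points of the tubular neighbourhood
that lie below the graph of `η`. It is the image of `Ω` under any map that fixes the points
outside the tube and moves `φ(y) + z n(y)` to `φ(y) + m_y(z) n(y)`, with an increasing bijection
`m_y` of `(a,b)` and `m_y(0) = η(y)`. -/
def fluidDomain (Ω : Set Space3) (φ n : Plane → Space3) (a b : ℝ) (η : Plane → ℝ) : Set Space3 :=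
  (Ω \ tube φ n a b) ∪ {X | ∃ y : Plane, ∃ z ∈ Ioo a b, z < η y ∧ X = φ y + z • n y}

/-! ### Function spaces -/

/-- `f ∈ L^∞(0,T;L^p(μ))`. -/
def MemLinftyLp {X F : Type*} [MeasurableSpace X] [NormedAddCommGroup F]
    (T : ℝ) (p : ℝ≥0∞) (μ : Measure X) (f : ℝ → X → F) : Prop :=
  AEStronglyMeasurable (Function.uncurry f) ((volume.restrict (Ioo 0 T)).prod μ) ∧
  ∃ C : ℝ, ∀ᵐ t ∂(volume.restrict (Ioo 0 T)), eLpNorm (f t) p μ ≤ ENNReal.ofReal C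

/-- `f ∈ L²(0,T;L²(μ))`. -/
def MemL2L2 {X F : Type*} [MeasurableSpace X] [NormedAddCommGroup F]
    (T : ℝ) (μ : Measure X) (f : ℝ → X → F) : Prop :=
  MemLp (Function.uncurry f) 2 ((volume.restrict (Ioo 0 T)).prod μ)

/-- `f'` is the weak (distributional) derivative of `f` on the plane. For periodic `f` and `f'`
this is the weak derivative on the torus. -/
def HasWeakFDeriv {F : Type*} [NormedAddCommGroup F] [NormedSpace ℝ F]
    (f : Plane → F) (f' : Plane → Plane →L[ℝ] F) : Prop :=
  LocallyIntegrable f volume ∧ LocallyIntegrable f' volume ∧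
  ∀ ψ : Plane → ℝ, ContDiff ℝ ∞ ψ → HasCompactSupport ψ → ∀ v : Plane,
    ∫ y, fderiv ℝ ψ y v • f y = - ∫ y, ψ y • f' y v

/-- `ft` is the weak time derivative of `f` on `(0,T) × Γ`. -/
def HasWeakTimeDeriv (T : ℝ) (f ft : ℝ → Plane → ℝ) : Prop :=
  ∀ ψ : ℝ × Plane → ℝ, ContDiff ℝ ∞ ψ → HasCompactSupport ψ →
    tsupport ψ ⊆ Ioo 0 T ×ˢ univ →
    ∫ p : ℝ × Plane, fderiv ℝ ψ p (1, 0) * f p.1 p.2 = - ∫ p : ℝ × Plane, ψ p * ft p.1 p.2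

/-- The displacement satisfies
`w ∈ L^∞(0,T;H²(Γ)) ∩ W^{1,∞}(0,T;L²(Γ)) ∩ H¹(0,T;H¹(Γ))`, with `∂ₜ w = wt`; the displacement is
identified with its representative that is continuous on `[0,T] × Γ`. -/
structure IsShellDisplacement (T : ℝ) (w wt : ℝ → Plane → ℝ) : Prop where
  periodic : ∀ t, TorusPeriodic (w t)
  periodic_wt : ∀ t, TorusPeriodic (wt t)
  continuousOn : ContinuousOn (Function.uncurry w) (Icc 0 T ×ˢ univ)
  memLinftyH2 : MemLinftyLp T 2 torusMeasure w ∧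
    ∃ (dw : ℝ → Plane → Plane →L[ℝ] ℝ) (ddw : ℝ → Plane → Plane →L[ℝ] Plane →L[ℝ] ℝ),
      (∀ t, TorusPeriodic (dw t)) ∧ (∀ t, TorusPeriodic (ddw t)) ∧
      MemLinftyLp T 2 torusMeasure dw ∧ MemLinftyLp T 2 torusMeasure ddw ∧
      ∀ᵐ t ∂(volume.restrict (Ioo 0 T)),
        HasWeakFDeriv (w t) (dw t) ∧ HasWeakFDeriv (dw t) (ddw t)
  timeDeriv : HasWeakTimeDeriv T w wt
  memLinftyL2_wt : MemLinftyLp T 2 torusMeasure wt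
  memL2H1_wt : ∃ dwt : ℝ → Plane → Plane →L[ℝ] ℝ,
      (∀ t, TorusPeriodic (dwt t)) ∧ MemL2L2 T torusMeasure dwt ∧
      ∀ᵐ t ∂(volume.restrict (Ioo 0 T)), HasWeakFDeriv (wt t) (dwt t)

/-- The fields `v k ∈ C_c^∞(B;ℝ³)` converge to `f` in `H¹(B;ℝ³)`, where `Df` is the gradient
of `f`. -/
def TestFieldsTendsto (B : Set Space3) (v : ℕ → Space3 → Space3)
    (f : Space3 → Space3) (Df : Space3 → Space3 →L[ℝ] Space3) : Prop :=
  (∀ k, ContDiff ℝ ∞ (v k) ∧ HasCompactSupport (v k) ∧ tsupport (v k) ⊆ B) ∧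
  Tendsto (fun k => eLpNorm (fun x => v k x - f x) 2 (volume.restrict B)) atTop (𝓝 0) ∧
  Tendsto (fun k => eLpNorm (fun x => fderiv ℝ (v k) x - Df x) 2 (volume.restrict B))
    atTop (𝓝 0)

/-- `u ∈ L²(0,T;H₀¹(B;ℝ³))` with weak gradient `Du`, where `H₀¹(B)` is the closure of
`C_c^∞(B)` in `H¹(B)`. -/
structure MemL2H10 (T : ℝ) (B : Set Space3) (u : ℝ → Space3 → Space3)
    (Du : ℝ → Space3 → Space3 →L[ℝ] Space3) : Prop where
  memL2 : MemL2L2 T (volume.restrict B) u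
  memL2_grad : MemL2L2 T (volume.restrict B) Du
  memH10 : ∀ᵐ t ∂(volume.restrict (Ioo 0 T)),
    ∃ v : ℕ → Space3 → Space3, TestFieldsTendsto B v (u t) (Du t)

/-- `g` is the Lagrangian trace on `Γ` of `f ∈ H₀¹(B;ℝ³)` (with gradient `Df`) along `Φ : Γ → ℝ³`:
the operator `f ↦ f ∘ Φ`, extended by continuity from smooth fields. -/
def IsLagrangianTrace (B : Set Space3) (Φ : Plane → Space3)
    (f : Space3 → Space3) (Df : Space3 → Space3 →L[ℝ] Space3) (g : Plane → Space3) : Prop :=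
  ∃ v : ℕ → Space3 → Space3, TestFieldsTendsto B v f Df ∧
    Tendsto (fun k => eLpNorm (fun y => v k (Φ y) - g y) 2 torusMeasure) atTop (𝓝 0)

/-! ### The renormalized continuity equation -/

/-- `B(r) = B(1) + ∫₁^r b(z)/z² dz`, with `B1 = B(1)`. -/
noncomputable def renormB (b : ℝ → ℝ) (B1 r : ℝ) : ℝ := B1 + ∫ z in (1 : ℝ)..r, b z / z ^ 2

/-- The divergence of a field with gradient `A`. -/
noncomputable def divOf (A : Space3 →L[ℝ] Space3) : ℝ :=
  ∑ i : Fin 3, (A (EuclideanSpace.single i 1)) i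

/-- The weak form on `(0,τ) × B`, with initial density `ρ₀`, of the renormalized continuity equation
`∂ₜ(ρ B(ρ)) + div(ρ B(ρ) u) + b(ρ) div u = 0`. The test functions of `C_c^∞([0,τ) × B)` are the
restrictions to `t ≥ 0` of smooth functions with compact support in `(-∞,τ) × B`. -/
def RenormalizedContinuityEq (τ : ℝ) (B : Set Space3) (ρ₀ : Space3 → ℝ)
    (ρ : ℝ → Space3 → ℝ) (u : ℝ → Space3 → Space3)
    (Du : ℝ → Space3 → Space3 →L[ℝ] Space3) : Prop :=
  ∀ (b : ℝ → ℝ) (B1 : ℝ), ContinuousOn b (Ici 0) → (∃ M : ℝ, ∀ z ∈ Ici (0 : ℝ), |b z| ≤ M) →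
    b 0 = 0 →
  ∀ ψ : ℝ × Space3 → ℝ, ContDiff ℝ ∞ ψ → HasCompactSupport ψ → tsupport ψ ⊆ Iio τ ×ˢ B →
    ∫ p in Ioo 0 τ ×ˢ B, ρ p.1 p.2 * renormB b B1 (ρ p.1 p.2) *
        (fderiv ℝ ψ p (1, 0) + fderiv ℝ ψ p (0, u p.1 p.2))
      = (∫ p in Ioo 0 τ ×ˢ B, b (ρ p.1 p.2) * divOf (Du p.1 p.2) * ψ p)
        - ∫ x in B, ρ₀ x * renormB b B1 (ρ₀ x) * ψ (0, x)

/-! ### The molecular pressure -/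

/-- The constitutive hypotheses on the molecular pressure `p_M(ρ,ϑ)`; its values at `ρ = 0` are the
limits from `ρ > 0`. -/
structure IsMolecularPressure (pM : ℝ → ℝ → ℝ) : Prop where
  contDiffOn : ContDiffOn ℝ 1 (Function.uncurry pM) (Ioi 0 ×ˢ Ioi 0)
  continuousOn : ContinuousOn (Function.uncurry pM) (Ici 0 ×ˢ Ioi 0)
  deriv_pos : ∀ r > 0, ∀ θ > 0, 0 < deriv (fun s => pM s θ) r
  state : ∃ (P : ℝ → ℝ) (Z₁ Z₂ : ℝ),
    ContDiffOn ℝ 1 P (Ici 0) ∧ P 0 = 0 ∧ 0 < derivWithin P (Ici 0) 0 ∧ 0 < Z₁ ∧ Z₁ < Z₂ ∧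
    ∀ r > 0, ∀ θ > 0, (r ≤ Z₁ * θ ^ (3 / 2 : ℝ) ∨ Z₂ * θ ^ (3 / 2 : ℝ) < r) →
      pM r θ = θ ^ (5 / 2 : ℝ) * P (r / θ ^ (3 / 2 : ℝ))

open scoped Convolution in
/-- A `C¹` function with compact support is `C¹`-approximated by smooth ones. -/
lemma exists_smooth_approx {E : Type*} [NormedAddCommGroup E] [NormedSpace ℝ E]
    [FiniteDimensional ℝ E] [MeasurableSpace E] [BorelSpace E] (μ : Measure E) [μ.IsAddHaarMeasure]
    {ψ : E → ℝ} (h : ContDiff ℝ 1 ψ) (hc : HasCompactSupport ψ) {O : Set E} (hO : IsOpen O)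
    (hs : tsupport ψ ⊆ O) {δ : ℝ} (hδ : 0 < δ) :
    ∃ ψ' : E → ℝ, ContDiff ℝ ∞ ψ' ∧ HasCompactSupport ψ' ∧ tsupport ψ' ⊆ O ∧
      ∀ x, dist (ψ' x) (ψ x) ≤ δ ∧ dist (fderiv ℝ ψ' x) (fderiv ℝ ψ x) ≤ δ := by
  have hf : Continuous (fderiv ℝ ψ) := h.continuous_fderiv (by norm_num)
  obtain ⟨r₁, hr₁, h₁⟩ := Metric.uniformContinuous_iff.1
    (hc.uniformContinuous_of_continuous h.continuous) δ hδ
  obtain ⟨r₂, hr₂, h₂⟩ := Metric.uniformContinuous_iff.1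
    ((hc.fderiv ℝ).uniformContinuous_of_continuous hf) δ hδ
  obtain ⟨r₃, hr₃, h₃⟩ := IsCompact.exists_cthickening_subset_open hc hO hs
  set r := min r₁ (min r₂ r₃) with hr
  have hr0 : 0 < r := by positivity
  let φ : ContDiffBump (0 : E) := ⟨r / 2, r, by positivity, by linarith⟩
  have hφ : φ.rOut = r := rfl
  have hcs : HasCompactSupport (φ.normed μ ⋆[ContinuousLinearMap.lsmul ℝ ℝ, μ] ψ) :=
    HasCompactSupport.convolution _ φ.hasCompactSupport_normed hc
  refine ⟨φ.normed μ ⋆[ContinuousLinearMap.lsmul ℝ ℝ, μ] ψ, ?_, hcs, ?_, fun x => ⟨?_, ?_⟩⟩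
  · exact φ.hasCompactSupport_normed.contDiff_convolution_left _ φ.contDiff_normed
      h.continuous.locallyIntegrable
  · refine (closure_minimal ?_ Metric.isClosed_cthickening).trans h₃
    refine (support_convolution_subset _).trans ?_
    rintro _ ⟨u, hu, v, hv, rfl⟩
    rw [φ.support_normed_eq, hφ, mem_ball_zero_iff] at hu
    refine Metric.mem_cthickening_of_dist_le _ v _ _ (subset_tsupport _ hv) ?_
    rw [dist_eq_norm, add_sub_cancel_right]
    exact hu.le.trans ((min_le_right _ _).trans (min_le_right _ _))
  · refine ContDiffBump.dist_normed_convolution_le h.continuous.aestronglyMeasurable ?_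
    intro y hy
    exact (h₁ ((Metric.mem_ball.1 hy).trans_le (min_le_left _ _))).le
  · have hd := hc.hasFDerivAt_convolution_right (ContinuousLinearMap.lsmul ℝ ℝ)
      (μ := μ) (f := φ.normed μ) (φ.continuous_normed.locallyIntegrable) h x
    have : ((φ.normed μ ⋆[(ContinuousLinearMap.lsmul ℝ ℝ).precompR E, μ] fderiv ℝ ψ) x)
        = ((φ.normed μ ⋆[ContinuousLinearMap.lsmul ℝ ℝ, μ] fderiv ℝ ψ) x) := by
      simp only [convolution]
      congr 1
    rw [hd.fderiv, this]
    refine ContDiffBump.dist_normed_convolution_le hf.aestronglyMeasurable ?_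
    intro y hy
    exact (h₂ ((Metric.mem_ball.1 hy).trans_le
      ((min_le_right _ _).trans (min_le_left _ _)))).le

/-- The weak transport equation `∂ₜβ + div(β u) + g = 0` on `(0,τ) × B` with initial value `β₀`,
tested with `ψ`. -/
def TransportEq (τ : ℝ) (B : Set Space3) (β : ℝ × Space3 → ℝ) (u : ℝ × Space3 → Space3)
    (g : ℝ × Space3 → ℝ) (β₀ : Space3 → ℝ) (ψ : ℝ × Space3 → ℝ) : Prop :=
  ∫ p in Ioo 0 τ ×ˢ B, β p * (fderiv ℝ ψ p (1, 0) + fderiv ℝ ψ p (0, u p))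
    = (∫ p in Ioo 0 τ ×ˢ B, g p * ψ p) - ∫ x in B, β₀ x * ψ (0, x)

/-- Passage to the limit in the test function of the weak transport equation. -/
lemma TransportEq.of_tendsto {τ : ℝ} {B : Set Space3} {β : ℝ × Space3 → ℝ}
    {u : ℝ × Space3 → Space3} {g : ℝ × Space3 → ℝ} {β₀ : Space3 → ℝ} 
    (hB : volume B ≠ ⊤)
    (hβm : AEStronglyMeasurable β (volume.restrict (Ioo 0 τ ×ˢ B))) {M : ℝ}
    (hβ : ∀ᵐ p ∂(volume.restrict (Ioo 0 τ ×ˢ B)), |β p| ≤ M)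
    (hu : IntegrableOn u (Ioo 0 τ ×ˢ B)) (hg : IntegrableOn g (Ioo 0 τ ×ˢ B))
    (hβ₀ : IntegrableOn β₀ B) {ψ : ℝ × Space3 → ℝ} {ψk : ℕ → ℝ × Space3 → ℝ} {C : ℝ}
    (hk : ∀ k, ContDiff ℝ 1 (ψk k)) (hkC : ∀ k p, |ψk k p| ≤ C)
    (hkD : ∀ k p, ‖fderiv ℝ (ψk k) p‖ ≤ C)
    (hlim : ∀ p, Tendsto (fun k => ψk k p) atTop (𝓝 (ψ p)))
    (hlimD : ∀ p, Tendsto (fun k => fderiv ℝ (ψk k) p) atTop (𝓝 (fderiv ℝ ψ p)))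
    (heq : ∀ k, TransportEq τ B β u g β₀ (ψk k)) : TransportEq τ B β u g β₀ ψ := by
  have hC : 0 ≤ C := (abs_nonneg _).trans (hkC 0 0)
  have hfin : volume (Ioo (0:ℝ) τ ×ˢ B) ≠ ⊤ := by
    rw [Measure.volume_eq_prod, Measure.prod_prod]
    exact ENNReal.mul_ne_top (by simp) hB
  have hDm : ∀ k, Continuous (fderiv ℝ (ψk k)) := fun k => (hk k).continuous_fderiv (by norm_num)
  have h1 : Tendsto (fun k => ∫ p in Ioo 0 τ ×ˢ B,
      β p * (fderiv ℝ (ψk k) p (1, 0) + fderiv ℝ (ψk k) p (0, u p))) atTop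
      (𝓝 (∫ p in Ioo 0 τ ×ˢ B, β p * (fderiv ℝ ψ p (1, 0) + fderiv ℝ ψ p (0, u p)))) := by
    refine tendsto_integral_of_dominated_convergence (fun p => M * (C + C * ‖u p‖)) ?_ ?_ ?_ ?_
    · intro k
      refine hβm.mul (AEStronglyMeasurable.add ?_ ?_)
      · exact ((hDm k).clm_apply continuous_const).aestronglyMeasurable
      · have h2 : AEStronglyMeasurable (fun p => ((0 : ℝ), u p))
            (volume.restrict (Ioo 0 τ ×ˢ B)) := 
          aestronglyMeasurable_const.prodMk hu.aestronglyMeasurable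
        exact (ContinuousLinearMap.apply ℝ ℝ).aestronglyMeasurable_comp₂ h2
          (hDm k).aestronglyMeasurable
    · refine Integrable.const_mul (Integrable.add ?_ (hu.norm.const_mul C)) M
      exact integrableOn_const hfin
    · intro k
      filter_upwards [hβ] with p hp
      rw [norm_mul]
      refine mul_le_mul hp ?_ (norm_nonneg _) ((abs_nonneg _).trans hp)
      refine (norm_add_le _ _).trans (add_le_add ?_ ?_)
      · refine ((fderiv ℝ (ψk k) p).le_opNorm _).trans ?_
        have : ‖((1 : ℝ), (0 : Space3))‖ = 1 := by simp [Prod.norm_def]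
        rw [this, mul_one]; exact hkD k p
      · refine ((fderiv ℝ (ψk k) p).le_opNorm _).trans ?_
        have : ‖((0 : ℝ), u p)‖ = ‖u p‖ := by simp [Prod.norm_def]
        rw [this]; exact mul_le_mul_of_nonneg_right (hkD k p) (norm_nonneg _)
    · refine Eventually.of_forall fun p => ?_
      have e : ∀ v : ℝ × Space3, Tendsto (fun k => fderiv ℝ (ψk k) p v) atTop
          (𝓝 (fderiv ℝ ψ p v)) := fun v =>
        ((ContinuousLinearMap.apply ℝ ℝ v).continuous.tendsto _).comp (hlimD p)
      exact ((e _).add (e _)).const_mul _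
  have h2 : Tendsto (fun k => ∫ p in Ioo 0 τ ×ˢ B, g p * ψk k p) atTop
      (𝓝 (∫ p in Ioo 0 τ ×ˢ B, g p * ψ p)) := by
    refine tendsto_integral_of_dominated_convergence (fun p => ‖g p‖ * C) ?_
      (hg.norm.mul_const C) ?_ ?_
    · exact fun k => hg.aestronglyMeasurable.mul (hk k).continuous.aestronglyMeasurable
    · exact fun k => Eventually.of_forall fun p => by
        rw [norm_mul]; exact mul_le_mul_of_nonneg_left (hkC k p) (norm_nonneg _)
    · exact Eventually.of_forall fun p => (hlim p).const_mul _
  have h3 : Tendsto (fun k => ∫ x in B, β₀ x * ψk k (0, x)) atTop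
      (𝓝 (∫ x in B, β₀ x * ψ (0, x))) := by
    refine tendsto_integral_of_dominated_convergence (fun p => ‖β₀ p‖ * C) ?_
      (hβ₀.norm.mul_const C) ?_ ?_
    · exact fun k => hβ₀.aestronglyMeasurable.mul
        ((hk k).continuous.comp (by fun_prop)).aestronglyMeasurable
    · exact fun k => Eventually.of_forall fun p => by
        rw [norm_mul]; exact mul_le_mul_of_nonneg_left (hkC k _) (norm_nonneg _)
    · exact Eventually.of_forall fun p => (hlim _).const_mul _
  refine tendsto_nhds_unique h1 ?_
  simp_rw [fun k => show _ = _ from heq k]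
  exact h2.sub h3

/-- The weak transport equation holds for `C¹` test functions with compact support. -/
lemma TransportEq.of_contDiff_one {τ : ℝ} {B : Set Space3} {β : ℝ × Space3 → ℝ}
    {u : ℝ × Space3 → Space3} {g : ℝ × Space3 → ℝ} {β₀ : Space3 → ℝ} 
    (hBo : IsOpen B) (hB : volume B ≠ ⊤)
    (hβm : AEStronglyMeasurable β (volume.restrict (Ioo 0 τ ×ˢ B))) {M : ℝ}
    (hβ : ∀ᵐ p ∂(volume.restrict (Ioo 0 τ ×ˢ B)), |β p| ≤ M)
    (hu : IntegrableOn u (Ioo 0 τ ×ˢ B)) (hg : IntegrableOn g (Ioo 0 τ ×ˢ B))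
    (hβ₀ : IntegrableOn β₀ B)
    (heq : ∀ ψ : ℝ × Space3 → ℝ, ContDiff ℝ ∞ ψ → HasCompactSupport ψ →
      tsupport ψ ⊆ Iio τ ×ˢ B → TransportEq τ B β u g β₀ ψ)
    {ψ : ℝ × Space3 → ℝ} (h : ContDiff ℝ 1 ψ) (hc : HasCompactSupport ψ)
    (hs : tsupport ψ ⊆ Iio τ ×ˢ B) : TransportEq τ B β u g β₀ ψ := by
  choose ψk hk1 hk2 hk3 hk4 using fun k : ℕ => exists_smooth_approx
    ((volume : Measure ℝ).prod (volume : Measure Space3)) h hc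
    (isOpen_Iio.prod hBo) hs (δ := 1 / ((k : ℝ) + 1)) (by positivity)
  have hf : Continuous (fderiv ℝ ψ) := h.continuous_fderiv (by norm_num)
  obtain ⟨C₁, hC₁⟩ := h.continuous.bounded_above_of_compact_support hc
  obtain ⟨C₂, hC₂⟩ := hf.bounded_above_of_compact_support (hc.fderiv ℝ)
  have hle : ∀ k : ℕ, 1 / ((k : ℝ) + 1) ≤ 1 := fun k => by
    rw [div_le_one (by positivity)]; linarith [(Nat.cast_nonneg k : (0:ℝ) ≤ k)]
  refine TransportEq.of_tendsto hB hβm hβ hu hg hβ₀ (ψk := ψk) (C := max C₁ C₂ + 1)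
    (fun k => (hk1 k).of_le (by norm_num)) ?_ ?_ ?_ ?_ (fun k => heq _ (hk1 k) (hk2 k) (hk3 k))
  · intro k p
    have := (hk4 k p).1.trans (hle k)
    rw [dist_eq_norm] at this
    have h2 := norm_sub_norm_le (ψk k p) (ψ p)
    have := hC₁ p
    have := le_max_left C₁ C₂
    rw [← Real.norm_eq_abs]; linarith
  · intro k p
    have := (hk4 k p).2.trans (hle k)
    rw [dist_eq_norm] at this
    have h2 := norm_sub_norm_le (fderiv ℝ (ψk k) p) (fderiv ℝ ψ p)
    have := hC₂ p
    have := le_max_right C₁ C₂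
    linarith
  · intro p
    exact tendsto_iff_dist_tendsto_zero.2 (squeeze_zero (fun _ => dist_nonneg)
      (fun k => (hk4 k p).1) tendsto_one_div_add_atTop_nhds_zero_nat)
  · intro p
    exact tendsto_iff_dist_tendsto_zero.2 (squeeze_zero (fun _ => dist_nonneg)
      (fun k => (hk4 k p).2) tendsto_one_div_add_atTop_nhds_zero_nat)

/-! ### The smooth transition function -/

lemma deriv_smoothTransition_of_one_le {x : ℝ} (h : 1 ≤ x) : deriv Real.smoothTransition x = 0 := by
  refine IsLocalMax.deriv_eq_zero (Eventually.of_forall fun y => ?_)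
  rw [Real.smoothTransition.one_of_one_le h]
  exact Real.smoothTransition.le_one y

lemma deriv_smoothTransition_of_nonpos {x : ℝ} (h : x ≤ 0) : deriv Real.smoothTransition x = 0 := by
  refine IsLocalMin.deriv_eq_zero (Eventually.of_forall fun y => ?_)
  rw [Real.smoothTransition.zero_of_nonpos h]
  exact Real.smoothTransition.nonneg y

lemma contDiff_smoothTransition : ContDiff ℝ 1 Real.smoothTransition :=
  Real.smoothTransition.contDiff

lemma exists_deriv_smoothTransition_le : ∃ c : ℝ, 0 < c ∧ ∀ x,
    |deriv Real.smoothTransition x| ≤ c := by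
  have hcont : Continuous (deriv Real.smoothTransition) :=
    contDiff_smoothTransition.continuous_deriv le_rfl
  have hc : HasCompactSupport (deriv Real.smoothTransition) := by
    refine HasCompactSupport.intro (isCompact_Icc (a := (0 : ℝ)) (b := 1)) fun x hx => ?_
    rcases lt_or_ge x 0 with h | h
    · exact deriv_smoothTransition_of_nonpos h.le
    · refine deriv_smoothTransition_of_one_le (le_of_lt ?_)
      by_contra h'
      exact hx ⟨h, not_lt.1 h'⟩
  obtain ⟨C, hC⟩ := hcont.bounded_above_of_compact_support hc
  refine ⟨max C 1, by positivity, fun x => (hC x).trans (le_max_left _ _)⟩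

/-! ### One-dimensional estimate and estimate in a boundary layer -/

lemma enorm_sub_le_lintegral_deriv {F : Type*} [NormedAddCommGroup F] [NormedSpace ℝ F]
    [CompleteSpace F] {f f' : ℝ → F} {a b : ℝ} (hab : a ≤ b) (hf : ∀ s, HasDerivAt f (f' s) s)
    (hf' : Continuous f') : ‖f b - f a‖ₑ ≤ ∫⁻ s in Icc a b, ‖f' s‖ₑ := by
  rw [← intervalIntegral.integral_eq_sub_of_hasDerivAt (fun s _ => hf s)
    (hf'.intervalIntegrable a b), intervalIntegral.integral_of_le hab,
    ← integral_Icc_eq_integral_Ioc]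
  exact enorm_integral_le_lintegral_enorm _

lemma enorm_le_add_enorm_sub {F : Type*} [NormedAddCommGroup F] (a b : F) :
    ‖a‖ₑ ≤ ‖b‖ₑ + ‖a - b‖ₑ := by
  calc ‖a‖ₑ = ‖b + (a - b)‖ₑ := by congr 1; abel
    _ ≤ _ := enorm_add_le _ _

/-- The set of points with norm at least `r`. -/
def outerLayer (r : ℝ) : Set Space3 := {x | r ≤ ‖x‖}

lemma measurableSet_outerLayer (r : ℝ) : MeasurableSet (outerLayer r) :=
  measurableSet_le measurable_const measurable_norm

lemma lintegral_comp_smul_outerLayer_le {f : Space3 → ℝ≥0∞} (hf : Continuous f) {s r : ℝ}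
    (hs : 1 ≤ s) :
    ∫⁻ x in outerLayer r, f (s • x) ≤ ∫⁻ x in outerLayer r, f x := by
  have hs0 : s ≠ 0 := by positivity
  have hmap := Measure.map_addHaar_smul (volume : Measure Space3) hs0
  have h1 : ∫⁻ x in outerLayer r, f (s • x) ≤
      ∫⁻ x, (outerLayer r).indicator f (s • x) := by
    rw [← lintegral_indicator (measurableSet_outerLayer r)]
    refine lintegral_mono fun x => ?_
    by_cases hx : x ∈ outerLayer r
    · have : s • x ∈ outerLayer r := by
        simp only [outerLayer, mem_ofPred_eq, norm_smul, Real.norm_eq_abs] at hx ⊢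
        rw [abs_of_nonneg (by linarith)]
        nlinarith [norm_nonneg x]
      simp [hx, this]
    · simp [hx]
  have hm : Measurable ((outerLayer r).indicator f) :=
    hf.measurable.indicator (measurableSet_outerLayer r)
  rw [← lintegral_map hm (measurable_const_smul s), hmap, lintegral_smul_measure,
    lintegral_indicator (measurableSet_outerLayer r)] at h1
  refine h1.trans ?_
  rw [smul_eq_mul]
  refine mul_le_of_le_one_left (zero_le) ?_
  rw [ENNReal.ofReal_le_one, abs_of_nonneg (by positivity)]
  exact inv_le_one_of_one_le₀ (one_le_pow₀ hs)

lemma lintegral_outerLayer_le {v : Space3 → Space3} (hv : ContDiff ℝ 1 v) {r : ℝ} (hr : 0 < r)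
    (hs : ∀ x, r ≤ ‖x‖ → v x = 0) {l : ℝ} (hl : 1 < l) :
    ∫⁻ x in outerLayer (r / l), ‖v x‖ₑ ≤
      ENNReal.ofReal (r * (l - 1)) * ∫⁻ x in outerLayer (r / l), ‖fderiv ℝ v x‖ₑ := by
  have hD : Continuous (fderiv ℝ v) := hv.continuous_fderiv (by norm_num)
  have hpt : ∀ x ∈ outerLayer (r / l),
      ‖v x‖ₑ ≤ ∫⁻ s in Icc 1 l, ENNReal.ofReal r * ‖fderiv ℝ v (s • x)‖ₑ := by
    intro x hx
    rcases le_or_gt r ‖x‖ with h | h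
    · simp [hs x h]
    have h0 : v (l • x) = 0 := by
      refine hs _ ?_
      rw [norm_smul, Real.norm_eq_abs, abs_of_pos (by linarith)]
      have : r / l ≤ ‖x‖ := hx
      rw [div_le_iff₀ (by linarith)] at this
      linarith
    have h1 := enorm_sub_le_lintegral_deriv (f := fun s : ℝ => v (s • x))
      (f' := fun s => fderiv ℝ v (s • x) x) hl.le (fun s => by
        have h2 : HasDerivAt (fun s : ℝ => s • x) x s := by
          simpa using (hasDerivAt_id s).smul_const x
        exact ((hv.differentiable (by norm_num) _).hasFDerivAt).comp_hasDerivAt s h2)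
      ((hD.comp (by fun_prop)).clm_apply continuous_const)
    simp only [h0, one_smul, zero_sub, enorm_neg] at h1
    refine h1.trans (lintegral_mono fun s => ?_)
    refine (ContinuousLinearMap.le_opENorm _ _).trans ?_
    rw [mul_comm]
    gcongr
    rw [← ofReal_norm]
    exact ENNReal.ofReal_le_ofReal h.le
  have hm : Measurable (Function.uncurry fun (x : Space3) (s : ℝ) =>
      ENNReal.ofReal r * ‖fderiv ℝ v (s • x)‖ₑ) := by
    refine Measurable.const_mul ?_ _
    exact (hD.comp (by fun_prop : Continuous fun p : Space3 × ℝ => p.2 • p.1)).enorm.measurable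
  calc ∫⁻ x in outerLayer (r / l), ‖v x‖ₑ
      ≤ ∫⁻ x in outerLayer (r / l), ∫⁻ s in Icc 1 l, ENNReal.ofReal r * ‖fderiv ℝ v (s • x)‖ₑ :=
        setLIntegral_mono' (measurableSet_outerLayer _) hpt
    _ = ∫⁻ s in Icc 1 l, ∫⁻ x in outerLayer (r / l), ENNReal.ofReal r * ‖fderiv ℝ v (s • x)‖ₑ :=
        lintegral_lintegral_swap hm.aemeasurable
    _ ≤ ∫⁻ _ in Icc 1 l, ENNReal.ofReal r * ∫⁻ x in outerLayer (r / l), ‖fderiv ℝ v x‖ₑ := by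
        refine setLIntegral_mono' measurableSet_Icc fun s hs => ?_
        have hm' : Measurable fun x : Space3 => ‖fderiv ℝ v (s • x)‖ₑ :=
          (hD.comp (continuous_const_smul s)).enorm.measurable
        rw [lintegral_const_mul _ hm']
        exact mul_le_mul' le_rfl (lintegral_comp_smul_outerLayer_le hD.enorm hs.1)
    _ = _ := by
        rw [lintegral_const, Measure.restrict_apply_univ, Real.volume_Icc,
          ENNReal.ofReal_mul hr.le]
        ring

lemma tendsto_lintegral_enorm_of_eLpNorm_two {X F : Type*} [MeasurableSpace X]
    [NormedAddCommGroup F] {μ : Measure X} [IsFiniteMeasure μ] {f : ℕ → X → F}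
    (hm : ∀ k, AEStronglyMeasurable (f k) μ)
    (h : Tendsto (fun k => eLpNorm (f k) 2 μ) atTop (𝓝 0)) :
    Tendsto (fun k => ∫⁻ x, ‖f k x‖ₑ ∂μ) atTop (𝓝 0) := by
  set c := μ univ ^ (1 / (1 : ℝ≥0∞).toReal - 1 / (2 : ℝ≥0∞).toReal) with hc
  have hct : c ≠ ⊤ := by
    rw [hc]; exact ENNReal.rpow_ne_top_of_nonneg (by norm_num) (measure_ne_top μ univ)
  have h2 := ENNReal.Tendsto.mul_const h (Or.inr hct)
  rw [zero_mul] at h2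
  refine tendsto_of_tendsto_of_tendsto_of_le_of_le tendsto_const_nhds h2 (fun _ => zero_le)
    fun k => ?_
  have := eLpNorm_le_eLpNorm_mul_rpow_measure_univ (p := 1) (q := 2) (by norm_num) (hm k)
  rwa [eLpNorm_one_eq_lintegral_enorm] at this

lemma lintegral_outerLayer_le_of_testFields {r : ℝ} (hr : 0 < r) {v : ℕ → Space3 → Space3}
    {f : Space3 → Space3} {Df : Space3 → Space3 →L[ℝ] Space3}
    (hv : TestFieldsTendsto (Metric.ball 0 r) v f Df)
    (hf : AEStronglyMeasurable f (volume.restrict (Metric.ball 0 r)))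
    (hDf : AEStronglyMeasurable Df (volume.restrict (Metric.ball 0 r))) {l : ℝ} (hl : 1 < l) :
    ∫⁻ x in outerLayer (r / l), ‖f x‖ₑ ∂(volume.restrict (Metric.ball 0 r)) ≤
      ENNReal.ofReal (r * (l - 1)) *
        ∫⁻ x in outerLayer (r / l), ‖Df x‖ₑ ∂(volume.restrict (Metric.ball 0 r)) := by
  set μ := (volume : Measure Space3).restrict (Metric.ball 0 r) with hμ
  have : IsFiniteMeasure μ := ⟨by
    rw [hμ, Measure.restrict_apply_univ]; exact measure_ball_lt_top⟩
  obtain ⟨hv1, hv2, hv3⟩ := hv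
  have hvD : ∀ k, Continuous (fderiv ℝ (v k)) := fun k =>
    (hv1 k).1.continuous_fderiv (by norm_num)
  have h2 := tendsto_lintegral_enorm_of_eLpNorm_two
    (fun k => ((hv1 k).1.continuous.aestronglyMeasurable.sub hf)) hv2
  have h3 := tendsto_lintegral_enorm_of_eLpNorm_two
    (fun k => ((hvD k).aestronglyMeasurable.sub hDf)) hv3
  set S := outerLayer (r / l)
  set c := ENNReal.ofReal (r * (l - 1))
  have hsm : ∀ k, ∫⁻ x in S, ‖v k x‖ₑ ∂μ ≤ c * ∫⁻ x in S, ‖fderiv ℝ (v k) x‖ₑ ∂μ := by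
    intro k
    have hz : ∀ x, r ≤ ‖x‖ → x ∉ tsupport (v k) := fun x hx h' => by
      have := (hv1 k).2.2 h'
      rw [mem_ball_zero_iff] at this
      linarith
    have h4 := lintegral_outerLayer_le ((hv1 k).1.of_le (by norm_num)) hr
      (fun x hx => image_eq_zero_of_notMem_tsupport (hz x hx)) hl
    have e : ∫⁻ x in S, ‖fderiv ℝ (v k) x‖ₑ = ∫⁻ x in S, ‖fderiv ℝ (v k) x‖ₑ ∂μ := by
      have e' : μ.restrict S = (volume.restrict S).restrict (Metric.ball 0 r) := by
        rw [hμ, Measure.restrict_comm measurableSet_ball]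
      rw [e']
      symm
      refine setLIntegral_eq_of_support_subset ?_
      intro x hx
      rw [mem_ball_zero_iff]
      by_contra h'
      have : fderiv ℝ (v k) x = 0 := image_eq_zero_of_notMem_tsupport fun h5 =>
        hz x (not_lt.1 h') (tsupport_fderiv_subset ℝ h5)
      exact hx (by simp only [this]; exact enorm_zero (E := Space3 →L[ℝ] Space3))
    rw [← e]
    refine le_trans ?_ h4
    exact lintegral_mono' (Measure.restrict_mono le_rfl Measure.restrict_le_self) le_rfl
  have key : ∀ k, ∫⁻ x in S, ‖f x‖ₑ ∂μ ≤ (∫⁻ x, ‖v k x - f x‖ₑ ∂μ) +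
      c * (∫⁻ x in S, ‖Df x‖ₑ ∂μ + ∫⁻ x, ‖fderiv ℝ (v k) x - Df x‖ₑ ∂μ) := by
    intro k
    calc ∫⁻ x in S, ‖f x‖ₑ ∂μ ≤ ∫⁻ x in S, (‖v k x‖ₑ + ‖v k x - f x‖ₑ) ∂μ := by
          refine lintegral_mono fun x => ?_
          calc ‖f x‖ₑ = ‖v k x - (v k x - f x)‖ₑ := by congr 1; abel
            _ ≤ _ := enorm_sub_le
      _ = ∫⁻ x in S, ‖v k x‖ₑ ∂μ + ∫⁻ x in S, ‖v k x - f x‖ₑ ∂μ :=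
          lintegral_add_left (hv1 k).1.continuous.enorm.measurable _
      _ ≤ c * ∫⁻ x in S, ‖fderiv ℝ (v k) x‖ₑ ∂μ + ∫⁻ x, ‖v k x - f x‖ₑ ∂μ :=
          add_le_add (hsm k) (setLIntegral_le_lintegral _ _)
      _ ≤ c * (∫⁻ x in S, ‖Df x‖ₑ ∂μ + ∫⁻ x, ‖fderiv ℝ (v k) x - Df x‖ₑ ∂μ)
            + ∫⁻ x, ‖v k x - f x‖ₑ ∂μ := by
          gcongr
          calc ∫⁻ x in S, ‖fderiv ℝ (v k) x‖ₑ ∂μ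
              ≤ ∫⁻ x in S, (‖Df x‖ₑ + ‖fderiv ℝ (v k) x - Df x‖ₑ) ∂μ := by
                exact lintegral_mono fun x => enorm_le_add_enorm_sub _ _
            _ = ∫⁻ x in S, ‖Df x‖ₑ ∂μ + ∫⁻ x in S, ‖fderiv ℝ (v k) x - Df x‖ₑ ∂μ :=
                lintegral_add_left' hDf.enorm.restrict _
            _ ≤ _ := by gcongr; exact Measure.restrict_le_self
      _ = _ := add_comm _ _
  have hlim := h2.add (ENNReal.Tendsto.const_mul
    ((tendsto_const_nhds (x := ∫⁻ x in S, ‖Df x‖ₑ ∂μ)).add h3)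
    (Or.inr (ENNReal.ofReal_ne_top (r := r * (l - 1)))))
  rw [zero_add, add_zero] at hlim
  exact ge_of_tendsto' hlim key

lemma tendsto_measure_outerLayer_inter_ball {r : ℝ} (hr : 0 < r) :
    Tendsto (fun k : ℕ => volume (outerLayer (r / (1 + 1 / ((k : ℝ) + 1))) ∩ Metric.ball 0 r))
      atTop (𝓝 0) := by
  have hanti : Antitone fun k : ℕ =>
      outerLayer (r / (1 + 1 / ((k : ℝ) + 1))) ∩ Metric.ball (0 : Space3) r := by
    intro i j hij x hx
    have h1 : _ ≤ ‖x‖ := hx.1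
    refine ⟨show _ ≤ ‖x‖ from le_trans ?_ h1, hx.2⟩
    have : (i : ℝ) ≤ j := by exact_mod_cast hij
    gcongr
  have hempty : (⋂ k : ℕ, outerLayer (r / (1 + 1 / ((k : ℝ) + 1))) ∩ Metric.ball (0 : Space3) r)
      = ∅ := by
    refine eq_empty_of_forall_notMem fun x hx => ?_
    rw [mem_iInter] at hx
    have h1 : Tendsto (fun k : ℕ => r / (1 + 1 / ((k : ℝ) + 1))) atTop (𝓝 (r / (1 + 0))) :=
      tendsto_const_nhds.div (tendsto_const_nhds.add tendsto_one_div_add_atTop_nhds_zero_nat)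
        (by norm_num)
    have h2 : r / (1 + 0) ≤ ‖x‖ := le_of_tendsto' h1 fun k => (hx k).1
    have h3 := (hx 0).2
    rw [mem_ball_zero_iff] at h3
    simp at h2
    linarith
  have := tendsto_measure_iInter_atTop (μ := (volume : Measure Space3))
    (s := fun k : ℕ => outerLayer (r / (1 + 1 / ((k : ℝ) + 1))) ∩ Metric.ball (0 : Space3) r)
    (fun k => ((measurableSet_outerLayer _).inter measurableSet_ball).nullMeasurableSet) hanti
    ⟨0, (measure_mono inter_subset_right).trans_lt measure_ball_lt_top |>.ne⟩
  rwa [hempty, measure_empty] at this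

/-- A `C¹` cutoff function of the ball of radius `r`, with gradient living in the layer
`{r / l ≤ ‖x‖}`. -/
noncomputable def ballCutoff (r l : ℝ) (x : Space3) : ℝ :=
  Real.smoothTransition (2 * (r ^ 2 - ‖x‖ ^ 2) / (r ^ 2 * (1 - (l ^ 2)⁻¹)) - 1)

section ballCutoff

variable {r l : ℝ}

lemma contDiff_ballCutoff : ContDiff ℝ 1 (ballCutoff r l) := by
  refine contDiff_smoothTransition.comp ?_
  refine ContDiff.sub (ContDiff.div_const (contDiff_const.mul (contDiff_const.sub ?_)) _)
    contDiff_const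
  exact contDiff_norm_sq ℝ

lemma ballCutoff_nonneg (x : Space3) : 0 ≤ ballCutoff r l x := Real.smoothTransition.nonneg _

lemma ballCutoff_le_one (x : Space3) : ballCutoff r l x ≤ 1 := Real.smoothTransition.le_one _

lemma layer_width_pos (hr : 0 < r) (hl : 1 < l) : 0 < r ^ 2 * (1 - (l ^ 2)⁻¹) := by
  have : (l ^ 2)⁻¹ < 1 := inv_lt_one_of_one_lt₀ (one_lt_pow₀ hl (by norm_num))
  have : 0 < r ^ 2 := by positivity
  nlinarith

lemma ballCutoff_eq_zero (hr : 0 < r) (hl : 1 < l) {x : Space3}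
    (hx : 2 * (r ^ 2 - ‖x‖ ^ 2) ≤ r ^ 2 * (1 - (l ^ 2)⁻¹)) : ballCutoff r l x = 0 := by
  refine Real.smoothTransition.zero_of_nonpos ?_
  rw [sub_nonpos, div_le_one (layer_width_pos hr hl)]
  exact hx

lemma one_le_of_notMem_outerLayer (hr : 0 < r) (hl : 1 < l) {x : Space3}
    (hx : x ∉ outerLayer (r / l)) :
    1 ≤ 2 * (r ^ 2 - ‖x‖ ^ 2) / (r ^ 2 * (1 - (l ^ 2)⁻¹)) - 1 := by
  have h1 : ‖x‖ < r / l := not_le.1 hx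
  have h2 : ‖x‖ ^ 2 < (r / l) ^ 2 := by gcongr
  have h3 : (r / l) ^ 2 = r ^ 2 * (l ^ 2)⁻¹ := by rw [div_pow, div_eq_mul_inv]
  rw [le_sub_iff_add_le, le_div_iff₀ (layer_width_pos hr hl)]
  nlinarith

lemma ballCutoff_eq_one (hr : 0 < r) (hl : 1 < l) {x : Space3}
    (hx : x ∉ outerLayer (r / l)) : ballCutoff r l x = 1 :=
  Real.smoothTransition.one_of_one_le (one_le_of_notMem_outerLayer hr hl hx)

lemma fderiv_ballCutoff_eq_zero (hr : 0 < r) (hl : 1 < l) {x : Space3}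
    (hx : x ∉ outerLayer (r / l)) : fderiv ℝ (ballCutoff r l) x = 0 := by
  refine IsLocalMax.fderiv_eq_zero (Eventually.of_forall fun y => ?_)
  rw [ballCutoff_eq_one hr hl hx]
  exact ballCutoff_le_one y

lemma norm_fderiv_ballCutoff_le (hr : 0 < r) (hl : 1 < l) {c : ℝ}
    (hc : ∀ x, |deriv Real.smoothTransition x| ≤ c) {x : Space3} (hx : ‖x‖ ≤ r) :
    ‖fderiv ℝ (ballCutoff r l) x‖ ≤ c * (4 * r / (r ^ 2 * (1 - (l ^ 2)⁻¹))) := by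
  set h := r ^ 2 * (1 - (l ^ 2)⁻¹) with hh
  have hpos : 0 < h := layer_width_pos hr hl
  have h1 : HasFDerivAt (fun x : Space3 => 2 * (r ^ 2 - ‖x‖ ^ 2) / h - 1)
      ((-(4 / h)) • innerSL ℝ x) x := by
    have h2 := (hasStrictFDerivAt_norm_sq x).hasFDerivAt
    have h3 := (((h2.const_sub (r ^ 2)).const_mul 2).mul_const h⁻¹).sub_const 1
    refine (h3.congr_fderiv ?_).congr_of_eventuallyEq
      (Eventually.of_forall fun y => by simp only [div_eq_mul_inv])
    ext v
    simp
    ring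
  have h2 : HasDerivAt Real.smoothTransition
      (deriv Real.smoothTransition (2 * (r ^ 2 - ‖x‖ ^ 2) / h - 1))
      (2 * (r ^ 2 - ‖x‖ ^ 2) / h - 1) :=
    (contDiff_smoothTransition.differentiable (by norm_num) _).hasDerivAt
  have h3 : HasFDerivAt (ballCutoff r l) _ x := h2.comp_hasFDerivAt x h1
  have hc0 : 0 ≤ c := (abs_nonneg _).trans (hc 0)
  rw [h3.fderiv, norm_smul, norm_smul, innerSL_apply_norm, norm_neg, Real.norm_eq_abs,
    Real.norm_eq_abs, abs_of_pos (by positivity : 0 < 4 / h)]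
  refine mul_le_mul (hc _) ?_ (by positivity) hc0
  rw [mul_div_right_comm]
  gcongr

end ballCutoff

lemma layer_ratio_le {r l : ℝ} (hr : 0 < r) (hl : 1 < l) (hl2 : l ≤ 2) :
    4 * r / (r ^ 2 * (1 - (l ^ 2)⁻¹)) * (r * (l - 1)) ≤ 8 := by
  have hp := layer_width_pos hr hl
  rw [div_mul_eq_mul_div, div_le_iff₀ hp]
  have h1 : (1 - (l ^ 2)⁻¹) = (l - 1) * (l + 1) * (l ^ 2)⁻¹ := by
    field_simp
    ring
  rw [h1]
  have h2 : 1 ≤ 2 * ((l + 1) * (l ^ 2)⁻¹) := by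
    rw [← div_eq_mul_inv, ← mul_div_assoc, le_div_iff₀ (by positivity)]
    nlinarith
  have h3 : 0 ≤ r ^ 2 * (l - 1) := by have : 0 < l - 1 := by linarith
                                      positivity
  nlinarith [mul_le_mul_of_nonneg_left h2 h3]

/-- If the velocity is small near the boundary of the ball, in the sense of functions of `H₀¹`, the
weak transport equation holds for compactly supported `C¹` test functions which need not vanish
near the boundary of the ball. -/
lemma TransportEq.of_boundary_layer {τ r : ℝ} (hr : 0 < r) {β : ℝ × Space3 → ℝ}
    {u : ℝ × Space3 → Space3} {g : ℝ × Space3 → ℝ} {β₀ : Space3 → ℝ}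
    (hβm : AEStronglyMeasurable β (volume.restrict (Ioo 0 τ ×ˢ Metric.ball 0 r))) {M : ℝ}
    (hβ : ∀ᵐ p ∂(volume.restrict (Ioo 0 τ ×ˢ Metric.ball 0 r)), |β p| ≤ M)
    (hu : IntegrableOn u (Ioo 0 τ ×ˢ Metric.ball 0 r))
    (hg : IntegrableOn g (Ioo 0 τ ×ˢ Metric.ball 0 r))
    (hβ₀ : IntegrableOn β₀ (Metric.ball 0 r))
    (heq : ∀ ψ : ℝ × Space3 → ℝ, ContDiff ℝ 1 ψ → HasCompactSupport ψ →
      tsupport ψ ⊆ Iio τ ×ˢ Metric.ball 0 r → TransportEq τ (Metric.ball 0 r) β u g β₀ ψ)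
    {D : ℝ × Space3 → ℝ≥0∞} (hD : ∫⁻ p in Ioo 0 τ ×ˢ Metric.ball 0 r, D p ≠ ⊤)
    (hlayer : ∀ l : ℝ, 1 < l →
      ∫⁻ p in Ioo 0 τ ×ˢ (outerLayer (r / l) ∩ Metric.ball 0 r), ‖u p‖ₑ ≤
        ENNReal.ofReal (r * (l - 1)) *
          ∫⁻ p in Ioo 0 τ ×ˢ (outerLayer (r / l) ∩ Metric.ball 0 r), D p)
    {ψ : ℝ × Space3 → ℝ} (h : ContDiff ℝ 1 ψ) (hc : HasCompactSupport ψ)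
    (hs : tsupport ψ ⊆ Iio τ ×ˢ univ) : TransportEq τ (Metric.ball 0 r) β u g β₀ ψ := by
  set B := Metric.ball (0 : Space3) r with hBdef
  set μ := (volume : Measure (ℝ × Space3)).restrict (Ioo 0 τ ×ˢ B) with hμ
  set l : ℕ → ℝ := fun k => 1 + 1 / ((k : ℝ) + 1) with hldef
  have hl1 : ∀ k, 1 < l k := fun k => by
    have : 0 < 1 / ((k : ℝ) + 1) := by positivity
    simp only [hldef]; linarith
  have hl2 : ∀ k, l k ≤ 2 := fun k => by
    have : 1 / ((k : ℝ) + 1) ≤ 1 := by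
      rw [div_le_one (by positivity)]; linarith [(Nat.cast_nonneg k : (0:ℝ) ≤ k)]
    simp only [hldef]; linarith
  have hf : Continuous (fderiv ℝ ψ) := h.continuous_fderiv (by norm_num)
  obtain ⟨C₁, hC₁⟩ := h.continuous.bounded_above_of_compact_support hc
  obtain ⟨C₂, hC₂⟩ := hf.bounded_above_of_compact_support (hc.fderiv ℝ)
  obtain ⟨c, hc0, hcS⟩ := exists_deriv_smoothTransition_le
  have hC₁0 : 0 ≤ C₁ := (norm_nonneg _).trans (hC₁ 0)
  have hC₂0 : 0 ≤ C₂ := (norm_nonneg _).trans (hC₂ 0)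
  set χ : ℕ → Space3 → ℝ := fun k => ballCutoff r (l k) with hχ
  have hχ1 : ∀ k, ContDiff ℝ 1 (χ k) := fun k => contDiff_ballCutoff
  have hχlim : ∀ x ∈ B, Tendsto (fun k => χ k x) atTop (𝓝 1) := by
    intro x hx
    have hx' : ‖x‖ < r := mem_ball_zero_iff.1 hx
    have h1 : Tendsto (fun k : ℕ => r / (1 + 1 / ((k : ℝ) + 1))) atTop (𝓝 (r / (1 + 0))) :=
      tendsto_const_nhds.div (tendsto_const_nhds.add tendsto_one_div_add_atTop_nhds_zero_nat)
        (by norm_num)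
    rw [add_zero, div_one] at h1
    refine tendsto_const_nhds.congr' ?_
    filter_upwards [h1.eventually (lt_mem_nhds hx')] with k hk
    exact (ballCutoff_eq_one hr (hl1 k) (not_le.2 hk)).symm
  -- the equation for the truncated test functions
  have hcut : ∀ k, TransportEq τ B β u g β₀ (fun p => χ k p.2 * ψ p) := by
    intro k
    have hsm : ContDiff ℝ 1 (fun p : ℝ × Space3 => χ k p.2 * ψ p) :=
      ((hχ1 k).comp contDiff_snd).mul h
    have hcs : HasCompactSupport (fun p : ℝ × Space3 => χ k p.2 * ψ p) := hc.mul_left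
    refine heq _ hsm hcs ?_
    intro p hp
    have hp1 : p ∈ tsupport ψ := closure_mono (fun q hq => right_ne_zero_of_mul hq) hp
    refine ⟨(hs hp1).1, ?_⟩
    have hcl : IsClosed {p : ℝ × Space3 |
        r ^ 2 * (1 - (l k ^ 2)⁻¹) ≤ 2 * (r ^ 2 - ‖p.2‖ ^ 2)} :=
      isClosed_le continuous_const (by fun_prop)
    have hp2 : p ∈ {p : ℝ × Space3 | r ^ 2 * (1 - (l k ^ 2)⁻¹) ≤ 2 * (r ^ 2 - ‖p.2‖ ^ 2)} := by
      refine closure_minimal (fun q hq => ?_) hcl hp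
      have hq' := left_ne_zero_of_mul hq
      by_contra hcon
      exact hq' (ballCutoff_eq_zero hr (hl1 k) (not_le.1 hcon).le)
    have hp3 : r ^ 2 * (1 - (l k ^ 2)⁻¹) ≤ 2 * (r ^ 2 - ‖p.2‖ ^ 2) := hp2
    have := layer_width_pos hr (hl1 k)
    rw [hBdef, mem_ball_zero_iff]
    exact lt_of_pow_lt_pow_left₀ 2 hr.le (by linarith)
  set A : ℝ × Space3 → ℝ := fun p => β p * (fderiv ℝ ψ p (1, 0) + fderiv ℝ ψ p (0, u p)) with hA
  have hum : AEStronglyMeasurable (fun p => ((0 : ℝ), u p)) μ :=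
    aestronglyMeasurable_const.prodMk hu.aestronglyMeasurable
  have hfin : volume (Ioo (0:ℝ) τ ×ˢ B) ≠ ⊤ := by
    rw [Measure.volume_eq_prod, Measure.prod_prod]
    exact ENNReal.mul_ne_top (by simp) measure_ball_lt_top.ne
  have hAi : Integrable A μ := by
    refine Integrable.mono' (g := fun p => M * (C₂ + C₂ * ‖u p‖)) ?_ ?_ ?_
    · exact Integrable.const_mul (Integrable.add (integrableOn_const hfin)
        (hu.norm.const_mul C₂)) M
    · refine hβm.mul (AEStronglyMeasurable.add ?_ ?_)
      · exact (hf.clm_apply continuous_const).aestronglyMeasurable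
      · exact (ContinuousLinearMap.apply ℝ ℝ).aestronglyMeasurable_comp₂ hum
          hf.aestronglyMeasurable
    · filter_upwards [hβ] with p hp
      rw [norm_mul]
      refine mul_le_mul hp ?_ (norm_nonneg _) ((abs_nonneg _).trans hp)
      refine (norm_add_le _ _).trans (add_le_add ?_ ?_)
      · refine ((fderiv ℝ ψ p).le_opNorm _).trans ?_
        have : ‖((1 : ℝ), (0 : Space3))‖ = 1 := by simp [Prod.norm_def]
        rw [this, mul_one]; exact hC₂ p
      · refine ((fderiv ℝ ψ p).le_opNorm _).trans ?_
        have : ‖((0 : ℝ), u p)‖ = ‖u p‖ := by simp [Prod.norm_def]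
        rw [this]; exact mul_le_mul_of_nonneg_right (hC₂ p) (norm_nonneg _)
  set E : ℕ → ℝ × Space3 → ℝ := fun k p => β p * (ψ p * fderiv ℝ (χ k) p.2 (u p)) with hE
  have hder : ∀ k p, β p * (fderiv ℝ (fun p => χ k p.2 * ψ p) p (1, 0)
      + fderiv ℝ (fun p => χ k p.2 * ψ p) p (0, u p)) = χ k p.2 * A p + E k p := by
    intro k p
    have h1 : HasFDerivAt (fun p : ℝ × Space3 => χ k p.2)
        ((fderiv ℝ (χ k) p.2).comp (ContinuousLinearMap.snd ℝ ℝ Space3)) p :=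
      (((hχ1 k).differentiable (by norm_num) p.2).hasFDerivAt).comp p hasFDerivAt_snd
    have h2 : fderiv ℝ (fun p => χ k p.2 * ψ p) p = _ :=
      (h1.mul (h.differentiable (by norm_num) p).hasFDerivAt).fderiv
    rw [h2]
    simp [hA, hE]
    ring
  have hEm : ∀ k, AEStronglyMeasurable (E k) μ := by
    intro k
    refine hβm.mul (h.continuous.aestronglyMeasurable.mul ?_)
    have : Continuous fun p : ℝ × Space3 => fderiv ℝ (χ k) p.2 :=
      ((hχ1 k).continuous_fderiv (by norm_num)).comp continuous_snd
    exact (ContinuousLinearMap.apply ℝ ℝ).aestronglyMeasurable_comp₂ hu.aestronglyMeasurable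
      this.aestronglyMeasurable
  have hEle : ∀ k, ∫⁻ p, ‖E k p‖ₑ ∂μ ≤ ENNReal.ofReal (M * (C₁ * (c * 8))) *
      ∫⁻ p in Ioo 0 τ ×ˢ (outerLayer (r / l k) ∩ B), D p := by
    intro k
    set a := 4 * r / (r ^ 2 * (1 - (l k ^ 2)⁻¹)) with ha
    have ha0 : 0 < a := by have := layer_width_pos hr (hl1 k); positivity
    have hM0 : 0 ≤ M ∨ μ = 0 := by
      by_cases hμ0 : μ = 0
      · exact Or.inr hμ0
      · have : NeZero μ := ⟨hμ0⟩
        obtain ⟨p, hp⟩ := hβ.exists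
        exact Or.inl ((abs_nonneg _).trans hp)
    rcases hM0 with hM0 | hμ0
    swap
    · rw [hμ0, lintegral_zero_measure]; exact zero_le
    set L : Set (ℝ × Space3) := Ioo 0 τ ×ˢ (outerLayer (r / l k) ∩ B) with hL
    have hLm : MeasurableSet L := measurableSet_Ioo.prod
      ((measurableSet_outerLayer _).inter measurableSet_ball)
    calc ∫⁻ p, ‖E k p‖ₑ ∂μ
        ≤ ∫⁻ p, L.indicator (fun p => ENNReal.ofReal (M * (C₁ * (c * a))) * ‖u p‖ₑ) p ∂μ := by
          refine lintegral_mono_ae ?_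
          filter_upwards [hβ, ae_restrict_mem (measurableSet_Ioo.prod measurableSet_ball)]
            with p hp hpm
          by_cases hpL : p.2 ∈ outerLayer (r / l k)
          · have : p ∈ L := ⟨hpm.1, hpL, hpm.2⟩
            rw [indicator_of_mem this]
            rw [← ofReal_norm (u p), ← ofReal_norm (E k p),
              ← ENNReal.ofReal_mul (by positivity)]
            refine ENNReal.ofReal_le_ofReal ?_
            have h1 := (fderiv ℝ (χ k) p.2).le_opNorm (u p)
            have h2 := norm_fderiv_ballCutoff_le hr (hl1 k) hcS (x := p.2)
              (mem_ball_zero_iff.1 hpm.2).le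
            simp only [hE, norm_mul, Real.norm_eq_abs]
            calc |β p| * (|ψ p| * |fderiv ℝ (χ k) p.2 (u p)|)
                ≤ M * (C₁ * ((c * a) * ‖u p‖)) := by
                  gcongr
                  · exact hC₁ p
                  · exact h1.trans (mul_le_mul_of_nonneg_right h2 (norm_nonneg _))
              _ = _ := by ring
          · have : E k p = 0 := by
              simp [hE, hχ, fderiv_ballCutoff_eq_zero hr (hl1 k) hpL]
            rw [this]; simp
      _ ≤ ∫⁻ p in L, ENNReal.ofReal (M * (C₁ * (c * a))) * ‖u p‖ₑ := by
          rw [lintegral_indicator hLm, hμ]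
          exact lintegral_mono' (Measure.restrict_mono le_rfl Measure.restrict_le_self) le_rfl
      _ = ENNReal.ofReal (M * (C₁ * (c * a))) * ∫⁻ p in L, ‖u p‖ₑ :=
          lintegral_const_mul' _ _ ENNReal.ofReal_ne_top
      _ ≤ ENNReal.ofReal (M * (C₁ * (c * a))) * (ENNReal.ofReal (r * (l k - 1)) *
            ∫⁻ p in L, D p) := mul_le_mul' le_rfl (hlayer _ (hl1 k))
      _ = ENNReal.ofReal (M * (C₁ * (c * (a * (r * (l k - 1)))))) * ∫⁻ p in L, D p := by
          rw [← mul_assoc, ← ENNReal.ofReal_mul (by positivity)]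
          congr 2; ring
      _ ≤ _ := by
          refine mul_le_mul' (ENNReal.ofReal_le_ofReal ?_) le_rfl
          have := layer_ratio_le hr (hl1 k) (hl2 k)
          gcongr
  have hElim0 : Tendsto (fun k => ∫⁻ p, ‖E k p‖ₑ ∂μ) atTop (𝓝 0) := by
    have h1 : Tendsto (fun k => ∫⁻ p in Ioo 0 τ ×ˢ (outerLayer (r / l k) ∩ B), D p) atTop
        (𝓝 0) := by
      have h2 : Tendsto (μ ∘ fun k => Ioo (0:ℝ) τ ×ˢ (outerLayer (r / l k) ∩ B)) atTop (𝓝 0) := by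
        have h3 : ∀ k, μ (Ioo (0:ℝ) τ ×ˢ (outerLayer (r / l k) ∩ B)) ≤
            volume (Ioo (0:ℝ) τ) * volume (outerLayer (r / l k) ∩ B) := fun k => by
          refine (Measure.restrict_apply_le _ _).trans ?_
          rw [Measure.volume_eq_prod, Measure.prod_prod]
        have h4 := ENNReal.Tendsto.const_mul (a := volume (Ioo (0:ℝ) τ))
          (tendsto_measure_outerLayer_inter_ball hr) (Or.inr (by simp))
        rw [mul_zero] at h4
        exact tendsto_of_tendsto_of_tendsto_of_le_of_le tendsto_const_nhds h4
          (fun _ => zero_le) h3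
      have h5 := tendsto_setLIntegral_zero hD h2
      refine h5.congr fun k => ?_
      rw [Measure.restrict_restrict (measurableSet_Ioo.prod
        ((measurableSet_outerLayer _).inter measurableSet_ball)), inter_eq_left.2]
      exact prod_mono le_rfl inter_subset_right
    have h2 := ENNReal.Tendsto.const_mul (a := ENNReal.ofReal (M * (C₁ * (c * 8)))) h1
      (Or.inr ENNReal.ofReal_ne_top)
    rw [mul_zero] at h2
    exact tendsto_of_tendsto_of_tendsto_of_le_of_le tendsto_const_nhds h2
      (fun _ => zero_le) hEle
  have hEi : ∀ k, Integrable (E k) μ := fun k => by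
    refine ⟨hEm k, ?_⟩
    refine (hEle k).trans_lt (ENNReal.mul_lt_top ENNReal.ofReal_lt_top ?_)
    refine lt_of_le_of_lt ?_ hD.lt_top
    exact lintegral_mono_set (prod_mono le_rfl inter_subset_right)
  have hElim : Tendsto (fun k => ∫ p, E k p ∂μ) atTop (𝓝 0) := by
    have := tendsto_integral_of_L1 (f := fun _ => (0 : ℝ)) (μ := μ) (F := E)
      aestronglyMeasurable_const (Eventually.of_forall hEi) (by simpa using hElim0)
    simpa using this
  have hχm : ∀ k, Continuous fun p : ℝ × Space3 => χ k p.2 := fun k =>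
    (hχ1 k).continuous.comp continuous_snd
  have hmem : ∀ᵐ p ∂μ, p.2 ∈ B := by
    filter_upwards [ae_restrict_mem (measurableSet_Ioo.prod measurableSet_ball)] with p hp
    exact hp.2
  have hχA : ∀ k, Integrable (fun p => χ k p.2 * A p) μ := fun k =>
    hAi.bdd_mul (c := 1) (hχm k).aestronglyMeasurable (Eventually.of_forall fun p => by
      rw [Real.norm_eq_abs, abs_of_nonneg (ballCutoff_nonneg _)]; exact ballCutoff_le_one _)
  have hL : ∀ (ν : Measure (ℝ × Space3)) (G : ℝ × Space3 → ℝ), Integrable G ν →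
      (∀ᵐ p ∂ν, p.2 ∈ B) → Tendsto (fun k => ∫ p, χ k p.2 * G p ∂ν) atTop (𝓝 (∫ p, G p ∂ν)) := by
    intro ν G hG hν
    refine tendsto_integral_of_dominated_convergence (fun p => ‖G p‖) ?_ hG.norm ?_ ?_
    · exact fun k => (hχm k).aestronglyMeasurable.mul hG.aestronglyMeasurable
    · refine fun k => Eventually.of_forall fun p => ?_
      rw [norm_mul]
      refine mul_le_of_le_one_left (norm_nonneg _) ?_
      rw [Real.norm_eq_abs, abs_of_nonneg (ballCutoff_nonneg _)]; exact ballCutoff_le_one _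
    · filter_upwards [hν] with p hp
      simpa using (hχlim _ hp).mul_const (G p)
  have h1 : Tendsto (fun k => ∫ p, β p * (fderiv ℝ (fun p => χ k p.2 * ψ p) p (1, 0)
      + fderiv ℝ (fun p => χ k p.2 * ψ p) p (0, u p)) ∂μ) atTop (𝓝 (∫ p, A p ∂μ)) := by
    have : ∀ k, ∫ p, β p * (fderiv ℝ (fun p => χ k p.2 * ψ p) p (1, 0)
      + fderiv ℝ (fun p => χ k p.2 * ψ p) p (0, u p)) ∂μ =
      (∫ p, χ k p.2 * A p ∂μ) + ∫ p, E k p ∂μ := fun k => by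
        rw [← integral_add (hχA k) (hEi k)]
        exact integral_congr_ae (Eventually.of_forall fun p => hder k p)
    simp_rw [this]
    simpa using (hL μ A hAi hmem).add hElim
  have h2 : Tendsto (fun k => ∫ p, g p * (χ k p.2 * ψ p) ∂μ) atTop (𝓝 (∫ p, g p * ψ p ∂μ)) := by
    have hgi : Integrable (fun p => g p * ψ p) μ :=
      hg.mul_bdd (c := C₁) h.continuous.aestronglyMeasurable (Eventually.of_forall hC₁)
    refine (hL μ _ hgi hmem).congr fun k => ?_
    exact integral_congr_ae (Eventually.of_forall fun p => by simp only; ring)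
  have h3 : Tendsto (fun k => ∫ x in B, β₀ x * (χ k x * ψ (0, x))) atTop
      (𝓝 (∫ x in B, β₀ x * ψ (0, x))) := by
    refine tendsto_integral_of_dominated_convergence (fun p => ‖β₀ p‖ * C₁) ?_
      (hβ₀.norm.mul_const C₁) ?_ ?_
    · exact fun k => hβ₀.aestronglyMeasurable.mul ((hχ1 k).continuous.mul
        (h.continuous.comp (by fun_prop))).aestronglyMeasurable
    · refine fun k => Eventually.of_forall fun x => ?_
      rw [norm_mul, norm_mul]
      refine mul_le_mul_of_nonneg_left ?_ (norm_nonneg _)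
      refine (mul_le_of_le_one_left (norm_nonneg _) ?_).trans (hC₁ _)
      rw [Real.norm_eq_abs, abs_of_nonneg (ballCutoff_nonneg _)]; exact ballCutoff_le_one _
    · filter_upwards [ae_restrict_mem measurableSet_ball] with x hx
      simpa using ((hχlim _ hx).mul_const (ψ (0, x))).const_mul (β₀ x)
  refine tendsto_nhds_unique h1 ?_
  have h4 := h2.sub h3
  refine h4.congr fun k => ?_
  exact (show _ = _ from hcut k).symm

/-- The weak transport equation holds for all `C¹` test functions that vanish for large times. -/
lemma TransportEq.of_compactlySupported {τ τ' r : ℝ} (hτ : τ' < τ) {β : ℝ × Space3 → ℝ}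
    {u : ℝ × Space3 → Space3} {g : ℝ × Space3 → ℝ} {β₀ : Space3 → ℝ}
    (heq : ∀ ψ : ℝ × Space3 → ℝ, ContDiff ℝ 1 ψ → HasCompactSupport ψ →
      tsupport ψ ⊆ Iio τ ×ˢ univ → TransportEq τ (Metric.ball 0 r) β u g β₀ ψ)
    {ψ : ℝ × Space3 → ℝ} (h : ContDiff ℝ 1 ψ) (hs : ∀ p : ℝ × Space3, τ' ≤ p.1 → ψ p = 0) :
    TransportEq τ (Metric.ball 0 r) β u g β₀ ψ := by
  have hbd : Bornology.IsBounded ((Icc 0 τ ∪ {0}) ×ˢ Metric.ball (0 : Space3) r) :=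
    ((Metric.isBounded_Icc _ _).union Bornology.isBounded_singleton).prod Metric.isBounded_ball
  obtain ⟨R, hR0, hR⟩ := hbd.subset_ball_lt 0 (0 : ℝ × Space3)
  have hR1 : ∀ p ∈ Ioo 0 τ ×ˢ Metric.ball (0 : Space3) r, p ∈ Metric.ball (0 : ℝ × Space3) R :=
    fun p hp => hR ⟨Or.inl (Ioo_subset_Icc_self hp.1), hp.2⟩
  have hR2 : ∀ x ∈ Metric.ball (0 : Space3) r, ((0 : ℝ), x) ∈ Metric.ball (0 : ℝ × Space3) R :=
    fun x hx => hR ⟨Or.inr (mem_singleton _), hx⟩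
  let f : ContDiffBump (0 : ℝ × Space3) := ⟨R, R + 1, hR0, by linarith⟩
  have hf1 : ∀ p ∈ Metric.ball (0 : ℝ × Space3) R, f p = 1 := fun p hp =>
    f.one_of_mem_closedBall (Metric.ball_subset_closedBall hp)
  have key : TransportEq τ (Metric.ball 0 r) β u g β₀ (fun p => f p * ψ p) := by
    refine heq (fun p => f p * ψ p) (f.contDiff.mul h) f.hasCompactSupport.mul_right ?_
    have hcl : IsClosed {p : ℝ × Space3 | p.1 ≤ τ'} := isClosed_le continuous_fst continuous_const
    refine fun p hp => ⟨lt_of_le_of_lt (closure_minimal (fun q hq => ?_) hcl hp) hτ, trivial⟩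
    by_contra hcon
    exact right_ne_zero_of_mul hq (hs q (not_le.1 hcon).le)
  have e1 : ∀ p ∈ Ioo 0 τ ×ˢ Metric.ball (0 : Space3) r, f p * ψ p = ψ p := fun p hp => by
    rw [hf1 p (hR1 p hp), one_mul]
  have e2 : ∀ p ∈ Ioo 0 τ ×ˢ Metric.ball (0 : Space3) r,
      fderiv ℝ (fun p => f p * ψ p) p = fderiv ℝ ψ p := fun p hp => by
    refine Filter.EventuallyEq.fderiv_eq ?_
    filter_upwards [Metric.isOpen_ball.mem_nhds (hR1 p hp)]
      with q hq
    rw [hf1 q hq, one_mul]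
  have e3 : ∀ x ∈ Metric.ball (0 : Space3) r, f (0, x) * ψ (0, x) = ψ (0, x) := fun x hx => by
    rw [hf1 _ (hR2 x hx), one_mul]
  have hm : MeasurableSet (Ioo 0 τ ×ˢ Metric.ball (0 : Space3) r) :=
    measurableSet_Ioo.prod measurableSet_ball
  have i1 : ∫ p in Ioo 0 τ ×ˢ Metric.ball 0 r, β p * (fderiv ℝ (fun p => f p * ψ p) p (1, 0)
      + fderiv ℝ (fun p => f p * ψ p) p (0, u p)) =
      ∫ p in Ioo 0 τ ×ˢ Metric.ball 0 r, β p * (fderiv ℝ ψ p (1, 0) + fderiv ℝ ψ p (0, u p)) :=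
    setIntegral_congr_fun hm fun p hp => by beta_reduce; rw [e2 p hp]
  have i2 : ∫ p in Ioo 0 τ ×ˢ Metric.ball 0 r, g p * (f p * ψ p) =
      ∫ p in Ioo 0 τ ×ˢ Metric.ball 0 r, g p * ψ p :=
    setIntegral_congr_fun hm fun p hp => by beta_reduce; rw [e1 p hp]
  have i3 : ∫ x in Metric.ball 0 r, β₀ x * (f (0, x) * ψ (0, x)) =
      ∫ x in Metric.ball 0 r, β₀ x * ψ (0, x) :=
    setIntegral_congr_fun measurableSet_ball fun x hx => by beta_reduce; rw [e3 x hx]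
  unfold TransportEq at key ⊢
  rw [← i1, ← i2, ← i3]
  exact key

/-! ### The unit normal field -/

lemma cross_identity {p q n : Space3} (hp : inner ℝ n p = 0) (hq : inner ℝ n q = 0)
    {N : Space3} (hN : N = WithLp.toLp 2 (crossProduct p.ofLp q.ofLp)) :
    (‖N‖ ^ 2) • n = (inner ℝ n N : ℝ) • N := by
  rw [← real_inner_self_eq_norm_sq]
  rw [PiLp.inner_apply, Fin.sum_univ_three] at hp hq
  simp only [RCLike.inner_apply, conj_trivial] at hp hq
  subst hN
  ext i
  simp only [PiLp.inner_apply, Fin.sum_univ_three, RCLike.inner_apply, conj_trivial,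
    cross_apply, PiLp.smul_apply, smul_eq_mul, Matrix.cons_val_zero, Matrix.cons_val_one,
    Matrix.cons_val]
  set p0 := p 0
  set p1 := p 1
  set p2 := p 2
  set q0 := q 0
  set q1 := q 1
  set q2 := q 2
  set n0 := n 0
  set n1 := n 1
  set n2 := n 2
  fin_cases i
  · simp only [Fin.zero_eta, Matrix.cons_val_zero, Fin.isValue]
    linear_combination (-((p2*q0-p0*q2)*q2 - (p0*q1-p1*q0)*q1)) * hp +
      ((p2*q0-p0*q2)*p2 - (p0*q1-p1*q0)*p1) * hq
  · simp only [Fin.mk_one, Matrix.cons_val_one, Matrix.cons_val_zero, Fin.isValue]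
    linear_combination (-((p0*q1-p1*q0)*q0 - (p1*q2-p2*q1)*q2)) * hp +
      ((p0*q1-p1*q0)*p0 - (p1*q2-p2*q1)*p2) * hq
  · simp only [Fin.reduceFinMk, Matrix.cons_val, Fin.isValue]
    linear_combination (-((p1*q2-p2*q1)*q1 - (p2*q0-p0*q2)*q0)) * hp +
      ((p1*q2-p2*q1)*p1 - (p2*q0-p0*q2)*p0) * hq

/-- The cross product of the two partial derivatives of a surface parametrization. -/
noncomputable def surfaceCross (φ : Plane → Space3) (y : Plane) : Space3 :=
  WithLp.toLp 2 (crossProduct (fderiv ℝ φ y (EuclideanSpace.single 0 1)).ofLp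
    (fderiv ℝ φ y (EuclideanSpace.single 1 1)).ofLp)

section Normal

variable {Ω : Set Space3} {φ n : Plane → Space3}

lemma surfaceCross_ne_zero {y : Plane} (h : Function.Injective (fderiv ℝ φ y)) :
    surfaceCross φ y ≠ 0 := by
  intro h0
  have h1 : crossProduct (fderiv ℝ φ y (EuclideanSpace.single 0 1)).ofLp
    (fderiv ℝ φ y (EuclideanSpace.single 1 1)).ofLp = 0 := by
    exact congrArg WithLp.ofLp h0
  refine (crossProduct_ne_zero_iff_linearIndependent.2 ?_) h1
  have h2 : LinearIndependent ℝ ![(EuclideanSpace.single 0 1 : Plane), EuclideanSpace.single 1 1] := by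
    rw [LinearIndependent.pair_iff]
    intro s t hst
    have e0 := congrArg (fun v : Plane => v 0) hst
    have e1 := congrArg (fun v : Plane => v 1) hst
    simp at e0 e1
    exact ⟨e0, e1⟩
  have h3 := h2.map' (((WithLp.linearEquiv 2 ℝ (Fin 3 → ℝ)).toLinearMap).comp
    (fderiv ℝ φ y).toLinearMap) (LinearMap.ker_eq_bot.2
      ((WithLp.linearEquiv 2 ℝ (Fin 3 → ℝ)).injective.comp h))
  have h4 : (((WithLp.linearEquiv 2 ℝ (Fin 3 → ℝ)).toLinearMap).comp
      (fderiv ℝ φ y).toLinearMap) ∘ ![(EuclideanSpace.single 0 1 : Plane),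
        EuclideanSpace.single 1 1] = ![(fderiv ℝ φ y (EuclideanSpace.single 0 1)).ofLp,
          (fderiv ℝ φ y (EuclideanSpace.single 1 1)).ofLp] := by
    ext i
    fin_cases i <;> rfl
  rw [h4] at h3
  exact h3

lemma contDiff_surfaceCross (h : ContDiff ℝ 3 φ) : ContDiff ℝ 1 (surfaceCross φ) := by
  have hD : ContDiff ℝ 1 (fderiv ℝ φ) := h.fderiv_right (by norm_num)
  have hc : ∀ (v : Plane) (i : Fin 3), ContDiff ℝ 1 fun y => (fderiv ℝ φ y v) i := fun v i =>
    contDiff_euclidean.1 (hD.clm_apply contDiff_const) i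
  rw [contDiff_euclidean]
  intro i
  have := fun v => hc v 0
  have := fun v => hc v 1
  have := fun v => hc v 2
  fin_cases i
  · simp only [surfaceCross, cross_apply, Fin.zero_eta, Matrix.cons_val_zero]
    exact ((hc _ _).mul (hc _ _)).sub ((hc _ _).mul (hc _ _))
  · simp only [surfaceCross, cross_apply, Fin.mk_one, Matrix.cons_val_one, Matrix.cons_val_zero]
    exact ((hc _ _).mul (hc _ _)).sub ((hc _ _).mul (hc _ _))
  · simp only [surfaceCross, cross_apply, Fin.reduceFinMk, Matrix.cons_val]
    exact ((hc _ _).mul (hc _ _)).sub ((hc _ _).mul (hc _ _))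

lemma TorusPeriodic.fderiv {F : Type*} [NormedAddCommGroup F] [NormedSpace ℝ F] {f : Plane → F}
    (h : TorusPeriodic f) : TorusPeriodic (fderiv ℝ f) := by
  intro k y
  rw [← fderiv_comp_add_right]
  congr 1
  ext x
  exact h k x

/-- The unit normal is the normalized cross product, up to a global sign. -/
lemma IsReferenceDomain.normal_eq (h : IsReferenceDomain Ω φ n) :
    ∃ s : ℝ, ∀ y, n y = (s * ‖surfaceCross φ y‖⁻¹) • surfaceCross φ y := by
  have hne : ∀ y, surfaceCross φ y ≠ 0 := fun y => surfaceCross_ne_zero (h.immersion y)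
  have hN := (contDiff_surfaceCross h.contDiff).continuous
  have hid : ∀ y, (‖surfaceCross φ y‖ ^ 2) • n y
      = (inner ℝ (n y) (surfaceCross φ y) : ℝ) • surfaceCross φ y := fun y =>
    cross_identity (h.normal_orthogonal y _) (h.normal_orthogonal y _) rfl
  have hn : ∀ y, n y = ((inner ℝ (n y) (surfaceCross φ y) : ℝ) * (‖surfaceCross φ y‖ ^ 2)⁻¹) •
      surfaceCross φ y := fun y => by
    have h0 : ‖surfaceCross φ y‖ ^ 2 ≠ 0 := pow_ne_zero _ (norm_ne_zero_iff.2 (hne y))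
    rw [mul_comm, mul_smul, ← hid y, inv_smul_smul₀ h0]
  have hsq : ∀ y, (inner ℝ (n y) (surfaceCross φ y) : ℝ) ^ 2 = ‖surfaceCross φ y‖ ^ 2 := by
    intro y
    have h0 : ‖surfaceCross φ y‖ ≠ 0 := norm_ne_zero_iff.2 (hne y)
    have h1 := congrArg norm (hid y)
    rw [norm_smul, norm_smul, h.normal_unit, mul_one, Real.norm_eq_abs, Real.norm_eq_abs,
      abs_of_nonneg (by positivity), sq, mul_left_inj' h0] at h1
    rw [h1, sq_abs]
  have hci : Continuous fun y => (inner ℝ (n y) (surfaceCross φ y) : ℝ) :=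
    h.normal_continuous.inner hN
  rcases (isPreconnected_univ (α := Plane)).eq_or_eq_neg_of_sq_eq hci.continuousOn
    hN.norm.continuousOn (fun y _ => by simpa using hsq y)
    (fun _ => norm_ne_zero_iff.2 (hne _)) with h1 | h1
  · refine ⟨1, fun y => ?_⟩
    have h0 : ‖surfaceCross φ y‖ ≠ 0 := norm_ne_zero_iff.2 (hne y)
    have h2 : (inner ℝ (n y) (surfaceCross φ y) : ℝ) = ‖surfaceCross φ y‖ := h1 (mem_univ y)
    conv_lhs => rw [hn y, h2]
    congr 1
    field_simp
  · refine ⟨-1, fun y => ?_⟩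
    have h0 : ‖surfaceCross φ y‖ ≠ 0 := norm_ne_zero_iff.2 (hne y)
    have h2 : (inner ℝ (n y) (surfaceCross φ y) : ℝ) = - ‖surfaceCross φ y‖ := h1 (mem_univ y)
    conv_lhs => rw [hn y, h2]
    congr 1
    field_simp

lemma IsReferenceDomain.contDiff_normal (h : IsReferenceDomain Ω φ n) : ContDiff ℝ 1 n := by
  obtain ⟨s, hs⟩ := h.normal_eq
  have hne : ∀ y, surfaceCross φ y ≠ 0 := fun y => surfaceCross_ne_zero (h.immersion y)
  have hN := contDiff_surfaceCross h.contDiff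
  rw [funext hs]
  exact (contDiff_const.mul ((hN.norm ℝ hne).inv fun y => norm_ne_zero_iff.2 (hne y))).smul hN

lemma IsReferenceDomain.periodic_normal (h : IsReferenceDomain Ω φ n) : TorusPeriodic n := by
  obtain ⟨s, hs⟩ := h.normal_eq
  intro k y
  rw [hs, hs, surfaceCross, h.periodic.fderiv k y]
  rfl

end Normal

/-! ### Normal coordinates -/

/-- The map `(y,z) ↦ φ(y) + z n(y)`. -/
def tubeMap (φ n : Plane → Space3) (p : Plane × ℝ) : Space3 := φ p.1 + p.2 • n p.1

section Tube

variable {Ω : Set Space3} {φ n : Plane → Space3} {a b : ℝ}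

lemma IsReferenceDomain.contDiff_tubeMap (h : IsReferenceDomain Ω φ n) :
    ContDiff ℝ 1 (tubeMap φ n) :=
  ((h.contDiff.of_le (by norm_num)).comp contDiff_fst).add
    (contDiff_snd.smul (h.contDiff_normal.comp contDiff_fst))

lemma IsReferenceDomain.tubeMap_add (h : IsReferenceDomain Ω φ n) (k : Fin 2 → ℤ) (y : Plane)
    (z : ℝ) : tubeMap φ n (y + latticeVec k, z) = tubeMap φ n (y, z) := by
  simp only [tubeMap]
  rw [h.periodic, h.periodic_normal]

lemma IsReferenceDomain.fderiv_tubeMap_normal (h : IsReferenceDomain Ω φ n) (p : Plane × ℝ) :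
    fderiv ℝ (tubeMap φ n) p (0, 1) = n p.1 := by
  have h1 := (h.contDiff_tubeMap.differentiable (by norm_num) p).hasFDerivAt
  have h2 : HasDerivAt (fun s : ℝ => (p.1, s)) ((0 : Plane), (1 : ℝ)) p.2 :=
    (hasDerivAt_const _ _).prodMk (hasDerivAt_id _)
  have h3 := HasFDerivAt.comp_hasDerivAt (f := fun s : ℝ => (p.1, s)) p.2 h1 h2
  have h4 : HasDerivAt (fun s : ℝ => tubeMap φ n (p.1, s)) (n p.1) p.2 := by
    have h5 := ((hasDerivAt_id p.2).smul_const (n p.1)).const_add (φ p.1)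
    rw [one_smul] at h5
    exact h5
  exact h3.unique h4

lemma IsTubularInterval.injective_fderiv (hab : IsTubularInterval φ n a b) {p : Plane × ℝ}
    (hp : p.2 ∈ Ioo a b) : Function.Injective (fderiv ℝ (tubeMap φ n) p) :=
  hab.immersion p.1 p.2 hp

lemma IsTubularInterval.exists_equiv (h : IsReferenceDomain Ω φ n)
    (hab : IsTubularInterval φ n a b) {p : Plane × ℝ} (hp : p.2 ∈ Ioo a b) :
    ∃ e : (Plane × ℝ) ≃L[ℝ] Space3, (e : Plane × ℝ →L[ℝ] Space3) = fderiv ℝ (tubeMap φ n) p ∧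
      HasStrictFDerivAt (tubeMap φ n) (e : Plane × ℝ →L[ℝ] Space3) p := by
  have hrank : Module.finrank ℝ (Plane × ℝ) = Module.finrank ℝ Space3 := by simp
  let e := (LinearEquiv.ofInjectiveOfFinrankEq (fderiv ℝ (tubeMap φ n) p).toLinearMap
    (hab.injective_fderiv hp) hrank).toContinuousLinearEquiv
  have he : (e : Plane × ℝ →L[ℝ] Space3) = fderiv ℝ (tubeMap φ n) p := by
    ext v <;> rfl
  refine ⟨e, he, ?_⟩
  rw [he]
  exact h.contDiff_tubeMap.contDiffAt.hasStrictFDerivAt (by norm_num)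

lemma tube_eq_image : tube φ n a b = tubeMap φ n '' (univ ×ˢ Ioo a b) := by
  ext x
  constructor
  · rintro ⟨y, z, hz, rfl⟩
    exact ⟨(y, z), ⟨trivial, hz⟩, rfl⟩
  · rintro ⟨p, hp, rfl⟩
    exact ⟨p.1, p.2, hp.2, rfl⟩

lemma tubeMap_mem_tube {p : Plane × ℝ} (hp : p.2 ∈ Ioo a b) : tubeMap φ n p ∈ tube φ n a b :=
  ⟨p.1, p.2, hp, rfl⟩

/-- A function that is `C¹` in normal coordinates is `C¹`. -/
lemma IsTubularInterval.contDiffAt_of_comp (h : IsReferenceDomain Ω φ n)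
    (hab : IsTubularInterval φ n a b) {G : ℝ × Space3 → ℝ} {H : ℝ × (Plane × ℝ) → ℝ}
    (hH : ContDiff ℝ 1 H)
    (hG : ∀ (t : ℝ) (p : Plane × ℝ), p.2 ∈ Ioo a b → G (t, tubeMap φ n p) = H (t, p))
    (t : ℝ) {p : Plane × ℝ} (hp : p.2 ∈ Ioo a b) : ContDiffAt ℝ 1 G (t, tubeMap φ n p) := by
  obtain ⟨e, hee, he⟩ := hab.exists_equiv h hp
  have hf : HasFDerivAt (tubeMap φ n) (e : Plane × ℝ →L[ℝ] Space3) p := he.hasFDerivAt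
  set inv := h.contDiff_tubeMap.contDiffAt.localInverse hf (by norm_num) with hinv
  have hinvC : ContDiffAt ℝ 1 inv (tubeMap φ n p) :=
    h.contDiff_tubeMap.contDiffAt.to_localInverse hf (by norm_num)
  have hinvp : inv (tubeMap φ n p) = p :=
    h.contDiff_tubeMap.contDiffAt.localInverse_apply_image hf (by norm_num)
  have hright : ∀ᶠ x in 𝓝 (tubeMap φ n p), tubeMap φ n (inv x) = x :=
    he.eventually_right_inverse
  have hz : ∀ᶠ x in 𝓝 (tubeMap φ n p), (inv x).2 ∈ Ioo a b := by
    have : Tendsto (fun x => (inv x).2) (𝓝 (tubeMap φ n p)) (𝓝 (inv (tubeMap φ n p)).2) :=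
      (hinvC.continuousAt.snd)
    rw [hinvp] at this
    exact this.eventually (isOpen_Ioo.mem_nhds hp)
  have hev : G =ᶠ[𝓝 (t, tubeMap φ n p)] fun q => H (q.1, inv q.2) := by
    have h1 : Tendsto (Prod.snd : ℝ × Space3 → Space3) (𝓝 (t, tubeMap φ n p))
      (𝓝 (tubeMap φ n p)) := continuous_snd.tendsto _
    filter_upwards [h1.eventually hright, h1.eventually hz] with q hq1 hq2
    rw [← hG _ _ hq2, hq1]
  refine ContDiffAt.congr_of_eventuallyEq ?_ hev
  have hq : ContDiffAt ℝ 1 (fun q : ℝ × Space3 => inv q.2) (t, tubeMap φ n p) :=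
    ContDiffAt.comp (g := inv) (t, tubeMap φ n p) hinvC contDiffAt_snd
  exact hH.contDiffAt.comp _ (contDiffAt_fst.prodMk hq)

end Tube

section TubeTopology

variable {Ω : Set Space3} {φ n : Plane → Space3} {a b : ℝ}

lemma tubeMap_zero (y : Plane) : tubeMap φ n (y, 0) = φ y := by simp [tubeMap]

lemma IsTubularInterval.notMem_frontier (h : IsReferenceDomain Ω φ n)
    (hab : IsTubularInterval φ n a b) {p : Plane × ℝ} (hp : p.2 ∈ Ioo a b) (h0 : p.2 ≠ 0) :
    tubeMap φ n p ∉ frontier Ω := by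
  rw [h.frontier_eq]
  rintro ⟨y, hy⟩
  have h1 : φ p.1 + p.2 • n p.1 = φ y + (0 : ℝ) • n y := by
    rw [hy.symm.symm]; simp [tubeMap]
  exact h0 (hab.injective p.1 y p.2 hp 0 ⟨hab.neg, hab.pos⟩ h1).1

lemma IsTubularInterval.mem_or_notMem_closure (h : IsReferenceDomain Ω φ n)
    (hab : IsTubularInterval φ n a b) {p : Plane × ℝ} (hp : p.2 ∈ Ioo a b) (h0 : p.2 ≠ 0) :
    tubeMap φ n p ∈ Ω ∪ (closure Ω)ᶜ := by
  by_contra hcon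
  rw [mem_union, not_or, mem_compl_iff, not_not] at hcon
  refine hab.notMem_frontier h hp h0 ?_
  rw [h.isOpen.frontier_eq]
  exact ⟨hcon.2, hcon.1⟩

lemma IsReferenceDomain.continuous_tubeMap (h : IsReferenceDomain Ω φ n) :
    Continuous (tubeMap φ n) := h.contDiff_tubeMap.continuous

lemma IsTubularInterval.mem_of_neg (h : IsReferenceDomain Ω φ n)
    (hab : IsTubularInterval φ n a b) {p : Plane × ℝ} (hp : p.2 ∈ Ioo a 0) :
    tubeMap φ n p ∈ Ω := by
  obtain ⟨y, z⟩ := p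
  set S := (fun s : ℝ => tubeMap φ n (y, s)) '' Ioo a 0 with hS
  have hpre : IsPreconnected S := isPreconnected_Ioo.image _
    (h.continuous_tubeMap.comp (by fun_prop)).continuousOn
  have hsub : S ⊆ Ω ∪ (closure Ω)ᶜ := by
    rintro _ ⟨s, hs, rfl⟩
    exact hab.mem_or_notMem_closure h (p := (y, s)) ⟨hs.1, hs.2.trans hab.pos⟩ hs.2.ne
  have hne : (S ∩ Ω).Nonempty := by
    have h1 : ∀ᶠ s in 𝓝[>] (0 : ℝ), s < -a :=
      nhdsWithin_le_nhds (gt_mem_nhds (by linarith [hab.neg]))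
    obtain ⟨s, hs1, hs2, hs3⟩ :=
      ((h.normal_inside y).and (h1.and self_mem_nhdsWithin)).exists
    have hs3' : 0 < s := hs3
    refine ⟨_, ⟨-s, ⟨by linarith, by linarith⟩, rfl⟩, ?_⟩
    simpa [tubeMap, sub_eq_add_neg] using hs1
  exact hpre.subset_left_of_subset_union h.isOpen isClosed_closure.isOpen_compl
    (disjoint_compl_right.mono_left subset_closure) hsub hne ⟨z, hp, rfl⟩

lemma IsTubularInterval.notMem_closure_of_pos (h : IsReferenceDomain Ω φ n)
    (hab : IsTubularInterval φ n a b) {p : Plane × ℝ} (hp : p.2 ∈ Ioo 0 b) :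
    tubeMap φ n p ∉ closure Ω := by
  obtain ⟨y, z⟩ := p
  set S := (fun s : ℝ => tubeMap φ n (y, s)) '' Ioo 0 b with hS
  have hpre : IsPreconnected S := isPreconnected_Ioo.image _
    (h.continuous_tubeMap.comp (by fun_prop)).continuousOn
  have hsub : S ⊆ Ω ∪ (closure Ω)ᶜ := by
    rintro _ ⟨s, hs, rfl⟩
    exact hab.mem_or_notMem_closure h (p := (y, s)) ⟨hab.neg.trans hs.1, hs.2⟩ hs.1.ne'
  have hne : (S ∩ (closure Ω)ᶜ).Nonempty := by
    have h1 : ∀ᶠ s in 𝓝[>] (0 : ℝ), s < b := nhdsWithin_le_nhds (gt_mem_nhds hab.pos)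
    obtain ⟨s, hs1, hs2, hs3⟩ :=
      ((h.normal_outside y).and (h1.and self_mem_nhdsWithin)).exists
    have hs3' : 0 < s := hs3
    exact ⟨_, ⟨s, ⟨hs3', hs2⟩, rfl⟩, hs1⟩
  exact hpre.subset_right_of_subset_union h.isOpen isClosed_closure.isOpen_compl
    (disjoint_compl_right.mono_left subset_closure) hsub hne ⟨z, hp, rfl⟩

/-- The closed fundamental cell of the lattice. -/
def closedCell : Set Plane := {y | ∀ i, y i ∈ Icc (0 : ℝ) 1}

/-- The half-open fundamental cell of the lattice. -/
def halfOpenCell : Set Plane := {y | ∀ i, y i ∈ Ico (0 : ℝ) 1}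

lemma halfOpenCell_subset : halfOpenCell ⊆ closedCell := fun _ hy i => Ico_subset_Icc_self (hy i)

lemma isCompact_closedCell : IsCompact closedCell := by
  have h1 : IsCompact (univ.pi fun _ : Fin 2 => Icc (0 : ℝ) 1) :=
    isCompact_univ_pi fun _ => isCompact_Icc
  have h2 := h1.image (PiLp.continuous_toLp 2 (fun _ : Fin 2 => ℝ))
  convert h2 using 1
  ext y
  constructor
  · exact fun hy => ⟨y.ofLp, fun i _ => hy i, rfl⟩
  · rintro ⟨v, hv, rfl⟩ i
    exact hv i trivial

lemma measurableSet_halfOpenCell : MeasurableSet halfOpenCell := by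
  have : halfOpenCell = ⋂ i : Fin 2, (fun y : Plane => y i) ⁻¹' Ico (0 : ℝ) 1 := by
    ext y; simp [halfOpenCell]
  rw [this]
  exact MeasurableSet.iInter fun i =>
    (EuclideanSpace.proj (𝕜 := ℝ) i).continuous.measurable measurableSet_Ico

lemma exists_mem_halfOpenCell (y : Plane) :
    ∃ k : Fin 2 → ℤ, ∃ y₀ ∈ halfOpenCell, y = y₀ + latticeVec k := by
  refine ⟨fun i => ⌊y i⌋, y - latticeVec (fun i => ⌊y i⌋), fun i => ?_, by abel⟩
  simp only [latticeVec, PiLp.sub_apply]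
  exact ⟨Int.fract_nonneg _, Int.fract_lt_one _⟩

lemma eq_of_mem_halfOpenCell {y y' : Plane} (hy : y ∈ halfOpenCell) (hy' : y' ∈ halfOpenCell)
    {k : Fin 2 → ℤ} (h : y' = y + latticeVec k) : y' = y := by
  have hk : k = 0 := by
    ext i
    have h1 : y' i = y i + k i := by rw [h]; rfl
    have h2 := hy i
    have h3 := hy' i
    have h4 : (k i : ℝ) < 1 := by linarith [h2.1, h3.2]
    have h5 : (-1 : ℝ) < k i := by linarith [h2.2, h3.1]
    have h6 : k i < 1 := by exact_mod_cast h4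
    have h7 : -1 < k i := by exact_mod_cast h5
    simp only [Pi.zero_apply]
    omega
  rw [h, hk]
  ext i
  simp [latticeVec]

lemma tubeMap_image_cell (h : IsReferenceDomain Ω φ n) (I : Set ℝ) :
    tubeMap φ n '' (univ ×ˢ I) = tubeMap φ n '' (halfOpenCell ×ˢ I) := by
  refine Subset.antisymm ?_ (image_mono (prod_mono (subset_univ _) le_rfl))
  rintro _ ⟨⟨y, z⟩, hp, rfl⟩
  obtain ⟨k, y₀, hy₀, rfl⟩ := exists_mem_halfOpenCell y
  exact ⟨(y₀, z), ⟨hy₀, hp.2⟩, (h.tubeMap_add k y₀ z).symm⟩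

lemma isCompact_tubeMap_image (h : IsReferenceDomain Ω φ n) (c d : ℝ) :
    IsCompact (tubeMap φ n '' (univ ×ˢ Icc c d)) := by
  have h1 : tubeMap φ n '' (univ ×ˢ Icc c d) = tubeMap φ n '' (closedCell ×ˢ Icc c d) := by
    refine Subset.antisymm ?_ (image_mono (prod_mono (subset_univ _) le_rfl))
    rw [tubeMap_image_cell h]
    exact image_mono (prod_mono halfOpenCell_subset le_rfl)
  rw [h1]
  exact (isCompact_closedCell.prod isCompact_Icc).image h.continuous_tubeMap

lemma IsTubularInterval.injOn (hab : IsTubularInterval φ n a b) :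
    InjOn (tubeMap φ n) (halfOpenCell ×ˢ Ioo a b) := by
  rintro ⟨y, z⟩ hp ⟨y', z'⟩ hp' heq
  obtain ⟨h1, k, h2⟩ := hab.injective y y' z hp.2 z' hp'.2 heq
  have h3 : y' = y := eq_of_mem_halfOpenCell hp.1 hp'.1 h2
  rw [h1, h3]

open Classical in
/-- A `C¹` function `H` of time and normal coordinates that equals `0` near the inner and `1` near
the outer boundary of the tube extends to a `C¹` function on the whole space. -/
lemma IsTubularInterval.exists_contDiff_extension (h : IsReferenceDomain Ω φ n)
    (hab : IsTubularInterval φ n a b) {a' b' : ℝ} (ha : a < a')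
    (hb' : b' < b) {H : ℝ × (Plane × ℝ) → ℝ} (hH : ContDiff ℝ 1 H)
    (hper : ∀ t k y z, H (t, (y + latticeVec k, z)) = H (t, (y, z)))
    (h0 : ∀ t y z, z ≤ a' → H (t, (y, z)) = 0) (h1 : ∀ t y z, b' ≤ z → H (t, (y, z)) = 1) :
    ∃ G : ℝ × Space3 → ℝ, ContDiff ℝ 1 G ∧
      (∀ (t : ℝ) (p : Plane × ℝ), p.2 ∈ Ioo a b → G (t, tubeMap φ n p) = H (t, p)) ∧
      (∀ (t : ℝ) (x : Space3), x ∉ tube φ n a b → G (t, x) = if x ∈ Ω then 0 else 1) := by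
  set G : ℝ × Space3 → ℝ := fun q =>
    if hx : ∃ p : Plane × ℝ, p.2 ∈ Ioo a b ∧ tubeMap φ n p = q.2 then H (q.1, hx.choose)
    else if q.2 ∈ Ω then 0 else 1 with hG
  have hG1 : ∀ (t : ℝ) (p : Plane × ℝ), p.2 ∈ Ioo a b → G (t, tubeMap φ n p) = H (t, p) := by
    intro t p hp
    have hx : ∃ p' : Plane × ℝ, p'.2 ∈ Ioo a b ∧ tubeMap φ n p' = tubeMap φ n p := ⟨p, hp, rfl⟩
    have hGx : G (t, tubeMap φ n p) = H (t, hx.choose) := dif_pos hx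
    rw [hGx]
    obtain ⟨hc1, hc2⟩ := hx.choose_spec
    set p' := hx.choose
    obtain ⟨e1, k, e2⟩ := hab.injective p.1 p'.1 p.2 hp p'.2 hc1 hc2.symm
    have : p' = (p.1 + latticeVec k, p.2) := Prod.ext e2 e1.symm
    rw [this, hper]
  have hG2 : ∀ (t : ℝ) (x : Space3), x ∉ tube φ n a b → G (t, x) = if x ∈ Ω then 0 else 1 := by
    intro t x hx
    refine dif_neg ?_
    rintro ⟨p, hp, hpx⟩
    have hpx' : tubeMap φ n p = x := hpx
    exact hx (hpx' ▸ tubeMap_mem_tube hp)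
  refine ⟨G, ?_, hG1, hG2⟩
  have htube : ∀ x, x ∈ tube φ n a b → ∃ p : Plane × ℝ, p.2 ∈ Ioo a b ∧ tubeMap φ n p = x := by
    rintro x ⟨y, z, hz, rfl⟩
    exact ⟨(y, z), hz, rfl⟩
  rw [contDiff_iff_contDiffAt]
  rintro ⟨t, x⟩
  by_cases hx : x ∈ tube φ n a b
  · obtain ⟨p, hp, rfl⟩ := htube x hx
    exact hab.contDiffAt_of_comp h hH hG1 t hp
  have hloc : ∀ (U : Set Space3) (c : ℝ), IsOpen U → x ∈ U → (∀ s, ∀ x' ∈ U, G (s, x') = c) →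
      ContDiffAt ℝ 1 G (t, x) := by
    intro U c hU hxU hc
    refine ContDiffAt.congr_of_eventuallyEq (f := fun _ => c) contDiffAt_const ?_
    filter_upwards [(hU.preimage continuous_snd).mem_nhds (show (t, x).2 ∈ U from hxU)] with q hq
    exact hc _ _ hq
  by_cases hxΩ : x ∈ Ω
  · refine hloc (Ω \ tubeMap φ n '' (univ ×ˢ Icc a' 0)) 0
      (h.isOpen.sdiff (isCompact_tubeMap_image h a' 0).isClosed) ⟨hxΩ, ?_⟩ ?_
    · rintro ⟨p, hp, rfl⟩
      exact hx (tubeMap_mem_tube ⟨ha.trans_le hp.2.1, lt_of_le_of_lt hp.2.2 hab.pos⟩)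
    · rintro s x' ⟨hx'1, hx'2⟩
      by_cases hx't : x' ∈ tube φ n a b
      · obtain ⟨p, hp, rfl⟩ := htube x' hx't
        rw [hG1 _ _ hp]
        refine h0 _ _ _ ?_
        by_contra hcon
        rcases lt_or_ge 0 p.2 with h3 | h3
        · exact hab.notMem_closure_of_pos h ⟨h3, hp.2⟩ (subset_closure hx'1)
        · exact hx'2 ⟨p, ⟨trivial, (not_le.1 hcon).le, h3⟩, rfl⟩
      · rw [hG2 _ _ hx't, if_pos hx'1]
  · have hxc : x ∉ closure Ω := by
      intro hcl
      have : x ∈ frontier Ω := by rw [h.isOpen.frontier_eq]; exact ⟨hcl, hxΩ⟩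
      rw [h.frontier_eq] at this
      obtain ⟨y, rfl⟩ := this
      rw [← tubeMap_zero (φ := φ) (n := n)] at hx
      exact hx (tubeMap_mem_tube (p := (y, 0)) ⟨hab.neg, hab.pos⟩)
    refine hloc ((closure Ω)ᶜ \ tubeMap φ n '' (univ ×ˢ Icc 0 b')) 1
      (isClosed_closure.isOpen_compl.sdiff (isCompact_tubeMap_image h 0 b').isClosed)
      ⟨hxc, ?_⟩ ?_
    · rintro ⟨p, hp, rfl⟩
      exact hx (tubeMap_mem_tube ⟨hab.neg.trans_le hp.2.1, lt_of_le_of_lt hp.2.2 hb'⟩)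
    · rintro s x' ⟨hx'1, hx'2⟩
      by_cases hx't : x' ∈ tube φ n a b
      · obtain ⟨p, hp, rfl⟩ := htube x' hx't
        rw [hG1 _ _ hp]
        refine h1 _ _ _ ?_
        by_contra hcon
        rcases lt_or_ge p.2 0 with h3 | h3
        · exact hx'1 (subset_closure (hab.mem_of_neg h ⟨hp.1, h3⟩))
        · exact hx'2 ⟨p, ⟨trivial, h3, (not_le.1 hcon).le⟩, rfl⟩
      · rw [hG2 _ _ hx't, if_neg fun hΩ => hx'1 (subset_closure hΩ)]

/-- Uniform invertibility of the derivative of the normal coordinates. -/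
lemma IsTubularInterval.exists_lower_bound (h : IsReferenceDomain Ω φ n)
    (hab : IsTubularInterval φ n a b) {a' b' : ℝ} (ha : a < a') (hb' : b' < b) :
    ∃ c > 0, ∀ p ∈ closedCell ×ˢ Icc a' b', ∀ ξ, c * ‖ξ‖ ≤ ‖fderiv ℝ (tubeMap φ n) p ξ‖ := by
  have hK : IsCompact ((closedCell ×ˢ Icc a' b') ×ˢ Metric.sphere (0 : Plane × ℝ) 1) :=
    (isCompact_closedCell.prod isCompact_Icc).prod (isCompact_sphere _ _)
  have hcont : Continuous fun q : (Plane × ℝ) × (Plane × ℝ) =>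
      ‖fderiv ℝ (tubeMap φ n) q.1 q.2‖ :=
    (((h.contDiff_tubeMap.continuous_fderiv (by norm_num)).comp continuous_fst).clm_apply
      continuous_snd).norm
  have hpos : ∀ q ∈ (closedCell ×ˢ Icc a' b') ×ˢ Metric.sphere (0 : Plane × ℝ) 1,
      0 < ‖fderiv ℝ (tubeMap φ n) q.1 q.2‖ := by
    rintro ⟨p, ξ⟩ ⟨hp, hξ⟩
    rw [norm_pos_iff]
    intro h0
    have := hab.injective_fderiv (p := p) ⟨ha.trans_le hp.2.1, hp.2.2.trans_lt hb'⟩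
      (h0.trans (map_zero _).symm)
    rw [this] at hξ
    simp at hξ
  obtain ⟨c, hc0, hc⟩ : ∃ c > 0, ∀ q ∈ (closedCell ×ˢ Icc a' b') ×ˢ
      Metric.sphere (0 : Plane × ℝ) 1, c ≤ ‖fderiv ℝ (tubeMap φ n) q.1 q.2‖ := by
    rcases eq_empty_or_nonempty ((closedCell ×ˢ Icc a' b') ×ˢ Metric.sphere (0 : Plane × ℝ) 1)
      with he | hne
    · exact ⟨1, one_pos, fun q hq => by rw [he] at hq; exact hq.elim⟩
    · obtain ⟨q, hq, hmin⟩ := hK.exists_isMinOn hne hcont.continuousOn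
      exact ⟨_, hpos q hq, fun q' hq' => hmin hq'⟩
  refine ⟨c, hc0, fun p hp ξ => ?_⟩
  rcases eq_or_ne ξ 0 with rfl | hξ
  · simp
  have hξ' : ‖ξ‖ ≠ 0 := norm_ne_zero_iff.2 hξ
  have h1 := hc (p, ‖ξ‖⁻¹ • ξ) ⟨hp, by simp [norm_smul, hξ']⟩
  simp only [map_smul, norm_smul, norm_inv, norm_norm] at h1
  rwa [← div_eq_inv_mul, le_div_iff₀ (norm_pos_iff.2 hξ)] at h1

end TubeTopology

section TubeMeasure

variable {Ω : Set Space3} {φ n : Plane → Space3} {a b : ℝ}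

/-- Lebesgue measure on the product of the fundamental cell and an interval of normal
displacements. -/
noncomputable def slabMeasure (a' b' : ℝ) : Measure (Plane × ℝ) :=
  volume.restrict (halfOpenCell ×ˢ Icc a' b')

/-- Normal coordinates distort volumes by bounded factors. -/
lemma IsTubularInterval.measure_comparison (h : IsReferenceDomain Ω φ n)
    (hab : IsTubularInterval φ n a b) {a' b' : ℝ} (ha : a < a') (hb' : b' < b) :
    ∃ C : ℝ≥0∞, C ≠ ⊤ ∧
      Measure.map (tubeMap φ n) (slabMeasure a' b') ≤ C • (volume : Measure Space3) ∧
      (volume : Measure Space3).restrict (tubeMap φ n '' (univ ×ˢ Icc a' b')) ≤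
        C • Measure.map (tubeMap φ n) (slabMeasure a' b') := by
  have : (volume : Measure (Plane × ℝ)).IsAddHaarMeasure :=
    inferInstanceAs ((volume : Measure Plane).prod (volume : Measure ℝ)).IsAddHaarMeasure
  have hrank : Module.finrank ℝ Space3 = Module.finrank ℝ (Plane × ℝ) := by simp
  let e : Space3 ≃L[ℝ] (Plane × ℝ) := ContinuousLinearEquiv.ofFinrankEq hrank
  have hmap : (Measure.map e.symm (volume : Measure (Plane × ℝ))).IsAddHaarMeasure :=
    e.symm.isAddHaarMeasure_map _
  set κ := (Measure.addHaarScalarFactor (Measure.map e.symm (volume : Measure (Plane × ℝ)))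
    (volume : Measure Space3)) with hκ
  have hκeq : Measure.map e.symm (volume : Measure (Plane × ℝ)) = κ • (volume : Measure Space3) :=
    Measure.isAddLeftInvariant_eq_smul _ _
  have hκ0 : κ ≠ 0 := (Measure.addHaarScalarFactor_pos_of_isAddHaarMeasure _ _).ne'
  set Q := halfOpenCell ×ˢ Icc a' b' with hQ
  have hQm : MeasurableSet Q := measurableSet_halfOpenCell.prod measurableSet_Icc
  have hΨ := h.contDiff_tubeMap
  have hΨm : Measurable (tubeMap φ n) := hΨ.continuous.measurable
  set J : Plane × ℝ → ℝ := fun p =>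
    |((e : Space3 →L[ℝ] Plane × ℝ).comp (fderiv ℝ (tubeMap φ n) p)).det| with hJ
  have hJc : Continuous J := (ContinuousLinearMap.continuous_det.comp
    (continuous_const.clm_comp (hΨ.continuous_fderiv (by norm_num)))).abs
  have hK : IsCompact (closedCell ×ˢ Icc a' b') := isCompact_closedCell.prod isCompact_Icc
  have hJ0 : ∀ p ∈ closedCell ×ˢ Icc a' b', 0 < J p := by
    intro p hp
    rw [hJ, abs_pos]
    obtain ⟨e', he', -⟩ := hab.exists_equiv h (p := p)
      ⟨ha.trans_le hp.2.1, hp.2.2.trans_lt hb'⟩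
    rw [← he']
    exact (e'.trans e).toLinearEquiv.isUnit_det'.ne_zero
  obtain ⟨m, M, hm0, hmM⟩ : ∃ m M : ℝ, 0 < m ∧ ∀ p ∈ Q, m ≤ J p ∧ J p ≤ M := by
    rcases eq_empty_or_nonempty (closedCell ×ˢ Icc a' b') with he | hne
    · refine ⟨1, 1, one_pos, fun p hp => ?_⟩
      have : p ∈ closedCell ×ˢ Icc a' b' := ⟨halfOpenCell_subset hp.1, hp.2⟩
      rw [he] at this
      exact this.elim
    · obtain ⟨q, hq, hmin⟩ := hK.exists_isMinOn hne hJc.continuousOn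
      obtain ⟨q', hq', hmax⟩ := hK.exists_isMaxOn hne hJc.continuousOn
      exact ⟨J q, J q', hJ0 q hq, fun p hp =>
        ⟨hmin ⟨halfOpenCell_subset hp.1, hp.2⟩, hmax ⟨halfOpenCell_subset hp.1, hp.2⟩⟩⟩
  have key : ∀ A : Set Space3, MeasurableSet A →
      ∫⁻ p in Q ∩ tubeMap φ n ⁻¹' A, ENNReal.ofReal (J p) =
        κ * volume (A ∩ tubeMap φ n '' (univ ×ˢ Icc a' b')) := by
    intro A hA
    have hinj : InjOn (fun p => e (tubeMap φ n p)) (Q ∩ tubeMap φ n ⁻¹' A) := by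
      refine e.injective.comp_injOn (hab.injOn.mono ?_)
      exact inter_subset_left.trans
        (prod_mono le_rfl fun z hz => ⟨ha.trans_le hz.1, hz.2.trans_lt hb'⟩)
    have h1 := lintegral_abs_det_fderiv_eq_addHaar_image (volume : Measure (Plane × ℝ))
      (hQm.inter (hΨm hA)) (f := fun p => e (tubeMap φ n p))
      (f' := fun p => (e : Space3 →L[ℝ] Plane × ℝ).comp (fderiv ℝ (tubeMap φ n) p))
      (fun p _ => (e.hasFDerivAt.comp p
        (hΨ.differentiable (by norm_num) p).hasFDerivAt).hasFDerivWithinAt) hinj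
    have himg : (fun p => e (tubeMap φ n p)) '' (Q ∩ tubeMap φ n ⁻¹' A) =
        e.symm ⁻¹' (A ∩ tubeMap φ n '' (univ ×ˢ Icc a' b')) := by
      rw [tubeMap_image_cell h, ← e.image_eq_preimage_symm, ← image_image e (tubeMap φ n),
        image_inter_preimage, inter_comm]
    rw [himg] at h1
    have h2 : volume (e.symm ⁻¹' (A ∩ tubeMap φ n '' (univ ×ˢ Icc a' b'))) =
        Measure.map e.symm volume (A ∩ tubeMap φ n '' (univ ×ˢ Icc a' b')) := by
      rw [Measure.map_apply e.symm.continuous.measurable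
        (hA.inter (isCompact_tubeMap_image h _ _).measurableSet)]
    rw [h2, hκeq] at h1
    rw [hJ]
    exact h1
  have hκt : (κ : ℝ≥0∞) ≠ ⊤ := ENNReal.coe_ne_top
  have hκ0' : (κ : ℝ≥0∞) ≠ 0 := by exact_mod_cast hκ0
  have hm0' : ENNReal.ofReal m ≠ 0 := by simpa using hm0
  have hν : ∀ A : Set Space3, MeasurableSet A →
      Measure.map (tubeMap φ n) (slabMeasure a' b') A = volume (Q ∩ tubeMap φ n ⁻¹' A) := by
    intro A hA
    rw [Measure.map_apply hΨm hA, slabMeasure, Measure.restrict_apply (hΨm hA), inter_comm]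
  refine ⟨(ENNReal.ofReal m)⁻¹ * κ + (κ : ℝ≥0∞)⁻¹ * ENNReal.ofReal M, ?_, ?_, ?_⟩
  · exact ENNReal.add_ne_top.2 ⟨ENNReal.mul_ne_top (ENNReal.inv_ne_top.2 hm0') hκt,
      ENNReal.mul_ne_top (ENNReal.inv_ne_top.2 hκ0') ENNReal.ofReal_ne_top⟩
  · refine Measure.le_iff.2 fun A hA => ?_
    rw [hν A hA, Measure.smul_apply, smul_eq_mul, add_mul]
    refine le_trans ?_ le_self_add
    have h1 : ENNReal.ofReal m * volume (Q ∩ tubeMap φ n ⁻¹' A) ≤ κ * volume A := by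
      calc ENNReal.ofReal m * volume (Q ∩ tubeMap φ n ⁻¹' A)
          = ∫⁻ _ in Q ∩ tubeMap φ n ⁻¹' A, ENNReal.ofReal m := by
            rw [lintegral_const, Measure.restrict_apply_univ]
        _ ≤ ∫⁻ p in Q ∩ tubeMap φ n ⁻¹' A, ENNReal.ofReal (J p) :=
            setLIntegral_mono' (hQm.inter (hΨm hA)) fun p hp =>
              ENNReal.ofReal_le_ofReal (hmM p hp.1).1
        _ ≤ _ := by rw [key A hA]; gcongr; exact inter_subset_left
    rw [mul_assoc]
    rwa [← ENNReal.div_eq_inv_mul, ENNReal.le_div_iff_mul_le (Or.inl hm0')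
      (Or.inl ENNReal.ofReal_ne_top), mul_comm]
  · refine Measure.le_iff.2 fun A hA => ?_
    rw [Measure.smul_apply, hν A hA, Measure.restrict_apply hA, smul_eq_mul, add_mul]
    refine le_trans ?_ le_add_self
    have h1 : κ * volume (A ∩ tubeMap φ n '' (univ ×ˢ Icc a' b')) ≤
        ENNReal.ofReal M * volume (Q ∩ tubeMap φ n ⁻¹' A) := by
      rw [← key A hA]
      calc ∫⁻ p in Q ∩ tubeMap φ n ⁻¹' A, ENNReal.ofReal (J p)
          ≤ ∫⁻ _ in Q ∩ tubeMap φ n ⁻¹' A, ENNReal.ofReal M :=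
            setLIntegral_mono' (hQm.inter (hΨm hA)) fun p hp =>
              ENNReal.ofReal_le_ofReal (hmM p hp.1).2
        _ = _ := by rw [lintegral_const, Measure.restrict_apply_univ]
    rw [mul_assoc]
    rwa [← ENNReal.div_eq_inv_mul, ENNReal.le_div_iff_mul_le (Or.inl hκ0') (Or.inl hκt),
      mul_comm]

end TubeMeasure

/-- Translations act continuously on integrable functions. -/
lemma exists_lintegral_translate_sub_le {E F : Type*} [NormedAddCommGroup E]
    [NormedSpace ℝ E] [FiniteDimensional ℝ E] [MeasurableSpace E] [BorelSpace E]
    [NormedAddCommGroup F] {μ : Measure E} [μ.IsAddHaarMeasure] {g : E → F}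
    (hg : Integrable g μ) {ε : ℝ≥0∞} (hε : 0 < ε) :
    ∃ r > 0, ∀ h : E, ‖h‖ < r → ∫⁻ x, ‖g (x + h) - g x‖ₑ ∂μ ≤ ε := by
  have hmem : MemLp g 1 μ := memLp_one_iff_integrable.2 hg
  have hadd : Continuous fun q : E × E => q.2 + q.1 := by fun_prop
  let τ : C(E, C(E, E)) := (ContinuousMap.mk (fun q : E × E => q.2 + q.1) hadd).curry
  have hmp : ∀ h, MeasurePreserving (τ h) μ μ := fun h => measurePreserving_add_right μ h
  have hcont : Continuous fun h => Lp.compMeasurePreserving (τ h) (hmp h) (hmem.toLp g) :=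
    continuous_const.compMeasurePreservingLp τ.continuous hmp ENNReal.one_ne_top
  have h0 : Lp.compMeasurePreserving (τ 0) (hmp 0) (hmem.toLp g) = hmem.toLp g := by
    rw [Lp.toLp_compMeasurePreserving]
    congr 1
    ext x
    exact congrArg g (add_zero x)
  have h1 := (EMetric.tendsto_nhds.1 (hcont.tendsto 0)) ε hε
  rw [h0] at h1
  obtain ⟨r, hr, hr'⟩ := Metric.eventually_nhds_iff.1 h1
  refine ⟨r, hr, fun h hh => ?_⟩
  have h2 := hr' (y := h) (by simpa using hh)
  rw [Lp.toLp_compMeasurePreserving, Lp.edist_toLp_toLp, eLpNorm_one_eq_lintegral_enorm] at h2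
  exact h2.le

/-! ### Periodic functions -/

/-- The translate of the fundamental cell by a lattice vector. -/
def cellTranslate (k : Fin 2 → ℤ) : Set Plane := (fun y => y - latticeVec k) ⁻¹' halfOpenCell

lemma measurePreserving_lattice (k : Fin 2 → ℤ) :
    MeasurePreserving (fun p : ℝ × Plane => (p.1, p.2 - latticeVec k)) volume volume :=
  (MeasurePreserving.id (volume : Measure ℝ)).prod (measurePreserving_sub_right volume (latticeVec k))

lemma measurableEmbedding_lattice (k : Fin 2 → ℤ) :
    MeasurableEmbedding (fun p : ℝ × Plane => (p.1, p.2 - latticeVec k)) :=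
  ((MeasurableEquiv.refl ℝ).prodCongr (MeasurableEquiv.subRight (latticeVec k))).measurableEmbedding

lemma TorusPeriodic.sub {F : Type*} {f : Plane → F} (h : TorusPeriodic f) (k : Fin 2 → ℤ)
    (y : Plane) : f (y - latticeVec k) = f y := by
  have := h k (y - latticeVec k)
  rw [sub_add_cancel] at this
  exact this.symm

section Periodic

variable {F : Type*} [NormedAddCommGroup F] {f : ℝ → Plane → F}

lemma aestronglyMeasurable_of_periodic (hf : ∀ t, TorusPeriodic (f t)) {I : Set ℝ}
    (hI : MeasurableSet I)
    (hm : AEStronglyMeasurable (Function.uncurry f) (volume.restrict (I ×ˢ halfOpenCell))) :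
    AEStronglyMeasurable (Function.uncurry f) (volume.restrict (I ×ˢ univ)) := by
  have hU : I ×ˢ (univ : Set Plane) = ⋃ k : Fin 2 → ℤ, I ×ˢ cellTranslate k := by
    rw [← prod_iUnion]
    congr 1
    refine (eq_univ_of_forall fun y => ?_).symm
    obtain ⟨k, y₀, hy₀, rfl⟩ := exists_mem_halfOpenCell y
    exact mem_iUnion.2 ⟨k, by simpa [cellTranslate] using hy₀⟩
  rw [hU, aestronglyMeasurable_iUnion_iff]
  intro k
  have h1 := (measurePreserving_lattice k).restrict_preimage (hI.prod measurableSet_halfOpenCell)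
  have h2 := hm.comp_measurePreserving h1
  have h3 : (Function.uncurry f) ∘ (fun p : ℝ × Plane => (p.1, p.2 - latticeVec k))
      = Function.uncurry f := by
    ext p
    exact (hf p.1).sub k p.2
  rw [h3] at h2
  exact h2

lemma setLIntegral_cellTranslate (hf : ∀ t, TorusPeriodic (f t)) {I : Set ℝ} (r : ℝ) 
    (k : Fin 2 → ℤ) :
    ∫⁻ p in I ×ˢ cellTranslate k, ‖f p.1 p.2‖ₑ ^ r = 
      ∫⁻ p in I ×ˢ halfOpenCell, ‖f p.1 p.2‖ₑ ^ r := by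
  have h1 := (measurePreserving_lattice k).setLIntegral_comp_preimage_emb
    (measurableEmbedding_lattice k) (fun p => ‖f p.1 p.2‖ₑ ^ r) (I ×ˢ halfOpenCell)
  rw [← h1]
  refine lintegral_congr fun p => ?_
  rw [(hf p.1).sub k p.2]

/-- A box containing all neighbours of the fundamental cell. -/
def bigBox : Set Plane := {y | ∀ i, y i ∈ Ico (-1 : ℝ) 2}

lemma measurableSet_bigBox : MeasurableSet bigBox := by
  have : bigBox = ⋂ i : Fin 2, (fun y : Plane => y i) ⁻¹' Ico (-1 : ℝ) 2 := by
    ext y; simp [bigBox]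
  rw [this]
  exact MeasurableSet.iInter fun i =>
    (EuclideanSpace.proj (𝕜 := ℝ) i).continuous.measurable measurableSet_Ico

lemma bigBox_subset : bigBox ⊆ ⋃ j : Fin 2 → Fin 3, cellTranslate (fun i => (j i : ℤ) - 1) := by
  intro y hy
  have hfl : ∀ i, ∃ m : Fin 3, ⌊y i⌋ = (m : ℤ) - 1 := by
    intro i
    have h1 : -1 ≤ ⌊y i⌋ := Int.le_floor.2 (by simpa using (hy i).1)
    have h2 : ⌊y i⌋ < 2 := Int.floor_lt.2 (by simpa using (hy i).2)
    exact ⟨⟨(⌊y i⌋ + 1).toNat, by omega⟩, by simp only; omega⟩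
  choose j hj using hfl
  refine mem_iUnion.2 ⟨j, fun i => ?_⟩
  simp only [latticeVec, PiLp.sub_apply, ← hj]
  exact ⟨Int.fract_nonneg _, Int.fract_lt_one _⟩

lemma setLIntegral_bigBox_le (hf : ∀ t, TorusPeriodic (f t)) {I : Set ℝ} (r : ℝ) :
    ∫⁻ p in I ×ˢ bigBox, ‖f p.1 p.2‖ₑ ^ r ≤
      9 * ∫⁻ p in I ×ˢ halfOpenCell, ‖f p.1 p.2‖ₑ ^ r := by
  calc ∫⁻ p in I ×ˢ bigBox, ‖f p.1 p.2‖ₑ ^ r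
      ≤ ∫⁻ p in ⋃ j : Fin 2 → Fin 3, I ×ˢ cellTranslate (fun i => (j i : ℤ) - 1),
          ‖f p.1 p.2‖ₑ ^ r := by
        refine lintegral_mono_set ?_
        rw [← prod_iUnion]
        exact prod_mono le_rfl bigBox_subset
    _ ≤ ∑' j : Fin 2 → Fin 3, ∫⁻ p in I ×ˢ cellTranslate (fun i => (j i : ℤ) - 1),
          ‖f p.1 p.2‖ₑ ^ r := lintegral_iUnion_le _ _
    _ = _ := by
        simp_rw [setLIntegral_cellTranslate hf]
        rw [tsum_fintype]
        simp

end Periodic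

lemma torusMeasure_eq : torusMeasure = volume.restrict halfOpenCell := rfl

lemma prod_torusMeasure (T : ℝ) : ((volume : Measure ℝ).restrict (Ioo 0 T)).prod torusMeasure =
    (volume : Measure (ℝ × Plane)).restrict (Ioo 0 T ×ˢ halfOpenCell) := by
  rw [torusMeasure_eq, Measure.prod_restrict]; rfl

lemma volume_halfOpenCell_lt_top : volume halfOpenCell < ⊤ :=
  (measure_mono halfOpenCell_subset).trans_lt isCompact_closedCell.measure_lt_top

instance : IsFiniteMeasure torusMeasure :=
  ⟨by rw [torusMeasure_eq, Measure.restrict_apply_univ]; exact volume_halfOpenCell_lt_top⟩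

lemma MemLinftyLp.lintegral_sq_lt_top {X F : Type*} [MeasurableSpace X] [NormedAddCommGroup F]
    {T : ℝ} {μ : Measure X} [SFinite μ] {f : ℝ → X → F} (h : MemLinftyLp T 2 μ f) :
    ∫⁻ p, ‖f p.1 p.2‖ₑ ^ (2 : ℝ) ∂((volume.restrict (Ioo 0 T)).prod μ) < ⊤ := by
  obtain ⟨hm, C, hC⟩ := h
  have hm' : AEMeasurable (fun p : ℝ × X => ‖f p.1 p.2‖ₑ ^ (2 : ℝ))
      ((volume.restrict (Ioo 0 T)).prod μ) := hm.enorm.pow_const _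
  rw [lintegral_prod _ hm']
  calc ∫⁻ t in Ioo 0 T, ∫⁻ x, ‖f t x‖ₑ ^ (2 : ℝ) ∂μ
      ≤ ∫⁻ _ in Ioo 0 T, ENNReal.ofReal C ^ (2 : ℝ) := by
        refine lintegral_mono_ae ?_
        filter_upwards [hC] with t ht
        have h1 : eLpNorm (f t) 2 μ ^ (2 : ℝ) = ∫⁻ x, ‖f t x‖ₑ ^ (2 : ℝ) ∂μ := by
          rw [eLpNorm_eq_lintegral_rpow_enorm_toReal (by norm_num) (by norm_num)]
          simp only [ENNReal.toReal_ofNat, one_div]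
          rw [← ENNReal.rpow_mul]
          norm_num
        rw [← h1]
        gcongr
    _ < ⊤ := by
        rw [lintegral_const]
        exact ENNReal.mul_lt_top (ENNReal.rpow_lt_top_of_nonneg (by norm_num)
          ENNReal.ofReal_ne_top) (by simp)

/-- The extension of a function on `[0,T] × ℝ²` that is constant in time outside `[0,T]`. -/
def clampExtend (T : ℝ) (w : ℝ → Plane → ℝ) (p : ℝ × Plane) : ℝ := w (max 0 (min p.1 T)) p.2

lemma clampExtend_of_mem {T : ℝ} {w : ℝ → Plane → ℝ} {p : ℝ × Plane} (h : p.1 ∈ Icc 0 T) :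
    clampExtend T w p = w p.1 p.2 := by
  simp [clampExtend, h.1, h.2]

lemma clamp_mem {T : ℝ} (hT : 0 ≤ T) (t : ℝ) : max 0 (min t T) ∈ Icc 0 T :=
  ⟨le_max_left _ _, max_le hT (min_le_right _ _)⟩

lemma abs_clamp_sub_le (T s t : ℝ) : |max 0 (min s T) - max 0 (min t T)| ≤ |s - t| := by
  refine (abs_max_sub_max_le_max _ _ _ _).trans ?_
  rw [sub_self, abs_zero, max_eq_right (abs_nonneg _)]
  refine (abs_min_sub_min_le_max _ _ _ _).trans ?_
  rw [sub_self, abs_zero, max_eq_left (abs_nonneg _)]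

lemma isCompact_closedBigBox : IsCompact {y : Plane | ∀ i, y i ∈ Icc (-1 : ℝ) 2} := by
  have h1 : IsCompact (univ.pi fun _ : Fin 2 => Icc (-1 : ℝ) 2) :=
    isCompact_univ_pi fun _ => isCompact_Icc
  have h2 := h1.image (PiLp.continuous_toLp 2 (fun _ : Fin 2 => ℝ))
  convert h2 using 1
  ext y
  constructor
  · exact fun hy => ⟨y.ofLp, fun i _ => hy i, rfl⟩
  · rintro ⟨v, hv, rfl⟩ i
    exact hv i trivial

lemma clampExtend_uniform {T : ℝ} (hT : 0 ≤ T) {w : ℝ → Plane → ℝ}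
    (hper : ∀ t, TorusPeriodic (w t))
    (hc : ContinuousOn (Function.uncurry w) (Icc 0 T ×ˢ univ)) {δ : ℝ} (hδ : 0 < δ) :
    ∃ r > 0, ∀ p q : ℝ × Plane, dist p q < r →
      dist (clampExtend T w p) (clampExtend T w q) ≤ δ := by
  have hK : IsCompact (Icc 0 T ×ˢ {y : Plane | ∀ i, y i ∈ Icc (-1 : ℝ) 2}) :=
    isCompact_Icc.prod isCompact_closedBigBox
  have huc := hK.uniformContinuousOn_of_continuous
    (hc.mono (prod_mono le_rfl (subset_univ _)))
  rw [Metric.uniformContinuousOn_iff] at huc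
  obtain ⟨r, hr, hr'⟩ := huc δ hδ
  refine ⟨min r 1, by positivity, ?_⟩
  rintro ⟨s, y⟩ ⟨t, y'⟩ hd
  obtain ⟨k, y₀, hy₀, rfl⟩ := exists_mem_halfOpenCell y
  have hd1 : dist s t < min r 1 := (le_max_left _ _).trans_lt hd
  have hd2 : dist (y₀ + latticeVec k) y' < min r 1 := (le_max_right _ _).trans_lt hd
  have hd3 : dist y₀ (y' - latticeVec k) = dist (y₀ + latticeVec k) y' := by
    rw [dist_eq_norm, dist_eq_norm]; congr 1; abel
  have e1 : clampExtend T w (s, y₀ + latticeVec k)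
      = Function.uncurry w (max 0 (min s T), y₀) := hper _ _ _
  have e2 : clampExtend T w (t, y')
      = Function.uncurry w (max 0 (min t T), y' - latticeVec k) := ((hper _).sub k y').symm
  rw [e1, e2]
  refine (hr' _ ⟨clamp_mem hT s, fun i => ?_⟩ _ ⟨clamp_mem hT t, fun i => ?_⟩ ?_).le
  · exact ⟨by linarith [(hy₀ i).1], by linarith [(hy₀ i).2]⟩
  · have h1 : ‖(y₀ - (y' - latticeVec k)) i‖ ≤ ‖y₀ - (y' - latticeVec k)‖ :=
      PiLp.norm_apply_le _ i
    rw [← dist_eq_norm, hd3] at h1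
    have h2 : |y₀ i - (y' - latticeVec k) i| < 1 :=
      h1.trans_lt (hd2.trans_le (min_le_right _ _))
    rw [abs_lt] at h2
    have h3 := hy₀ i
    constructor
    · linarith [h3.1]
    · linarith [h3.2]
  · rw [Prod.dist_eq, max_lt_iff]
    refine ⟨lt_of_le_of_lt ?_ (hd1.trans_le (min_le_left _ _)), ?_⟩
    · exact abs_clamp_sub_le T s t
    · rw [hd3]; exact hd2.trans_le (min_le_left _ _)

lemma continuous_clampExtend {T : ℝ} (hT : 0 ≤ T) {w : ℝ → Plane → ℝ}
    (hper : ∀ t, TorusPeriodic (w t))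
    (hc : ContinuousOn (Function.uncurry w) (Icc 0 T ×ˢ univ)) :
    Continuous (clampExtend T w) := by
  rw [Metric.continuous_iff]
  intro p ε hε
  obtain ⟨r, hr, h⟩ := clampExtend_uniform hT hper hc (half_pos hε)
  exact ⟨r, hr, fun q hq => (h q p hq).trans_lt (half_lt_self hε)⟩

instance volume_isAddHaarMeasure_timePlane : (volume : Measure (ℝ × Plane)).IsAddHaarMeasure :=
  inferInstanceAs ((volume : Measure ℝ).prod (volume : Measure Plane)).IsAddHaarMeasure

/-! ### Convolution and weak derivatives -/

open scoped Convolution in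
/-- The convolution of a kernel and a function of time and space. -/
noncomputable def timeConv (ζ f : ℝ × Plane → ℝ) : ℝ × Plane → ℝ :=
  ζ ⋆[ContinuousLinearMap.lsmul ℝ ℝ, (volume : Measure (ℝ × Plane))] f

section Conv

variable {ζ f : ℝ × Plane → ℝ}

lemma contDiff_timeConv (hζ : ContDiff ℝ ∞ ζ) (hc : HasCompactSupport ζ) (hf : Continuous f) :
    ContDiff ℝ 1 (timeConv ζ f) :=
  hc.contDiff_convolution_left _ (n := 1) (hζ.of_le (by norm_num)) hf.locallyIntegrable

lemma fderiv_timeConv (hζ : ContDiff ℝ ∞ ζ) (hc : HasCompactSupport ζ) (hf : Continuous f)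
    (x v : ℝ × Plane) :
    fderiv ℝ (timeConv ζ f) x v = ∫ q, fderiv ℝ ζ (x - q) v * f q := by
  have h1 := hc.hasFDerivAt_convolution_left (ContinuousLinearMap.lsmul ℝ ℝ)
    (μ := (volume : Measure (ℝ × Plane))) (hζ.of_le (by norm_num)) hf.locallyIntegrable x
  have h2 : fderiv ℝ (timeConv ζ f) x = _ := h1.fderiv
  have hex := (hc.fderiv ℝ).convolutionExists_left
    ((ContinuousLinearMap.lsmul ℝ ℝ).precompL (ℝ × Plane))
    (hζ.continuous_fderiv (by norm_num)) (hf.locallyIntegrable (μ := volume)) x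
  rw [h2, convolution, ContinuousLinearMap.integral_apply hex,
    ← integral_sub_left_eq_self (fun q => fderiv ℝ ζ (x - q) v * f q) volume x]
  refine integral_congr_ae (Eventually.of_forall fun q => ?_)
  simp [sub_sub_cancel]

lemma fderiv_reflect (hζ : ContDiff ℝ ∞ ζ) (x q v : ℝ × Plane) :
    fderiv ℝ (fun q => ζ (x - q)) q v = - fderiv ℝ ζ (x - q) v := by
  have h1 : HasFDerivAt (fun q : ℝ × Plane => x - q) (-ContinuousLinearMap.id ℝ (ℝ × Plane)) q :=
    (hasFDerivAt_id q).const_sub x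
  have h2 := HasFDerivAt.comp (g := ζ) q
    ((hζ.differentiable (by norm_num) (x - q)).hasFDerivAt) h1
  have h3 : fderiv ℝ (fun q => ζ (x - q)) q = _ := h2.fderiv
  rw [h3]
  simp

lemma tsupport_reflect (x : ℝ × Plane) :
    tsupport (fun q => ζ (x - q)) = (fun q => x - q) ⁻¹' tsupport ζ :=
  tsupport_comp_eq_preimage ζ (Homeomorph.subLeft x)

lemma hasCompactSupport_reflect (hc : HasCompactSupport ζ) (x : ℝ × Plane) :
    HasCompactSupport (fun q => ζ (x - q)) :=
  hc.comp_homeomorph (Homeomorph.subLeft x)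

variable {T : ℝ} {w wt : ℝ → Plane → ℝ}

lemma fderiv_timeConv_time (hζ : ContDiff ℝ ∞ ζ) (hc : HasCompactSupport ζ)
    (hf : Continuous (clampExtend T w)) (hw : HasWeakTimeDeriv T w wt) {x : ℝ × Plane}
    (hx : ∀ q ∈ tsupport ζ, (x - q).1 ∈ Ioo 0 T) :
    fderiv ℝ (timeConv ζ (clampExtend T w)) x (1, 0) =
      ∫ q, ζ q * wt (x - q).1 (x - q).2 := by
  have hsup : tsupport (fun q => ζ (x - q)) ⊆ Ioo 0 T ×ˢ univ := by
    intro q hq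
    rw [tsupport_reflect] at hq
    have := hx _ hq
    rw [sub_sub_cancel] at this
    exact ⟨this, trivial⟩
  have h1 := hw (fun q => ζ (x - q)) (hζ.comp (contDiff_const.sub contDiff_id))
    (hasCompactSupport_reflect hc x) hsup
  rw [fderiv_timeConv hζ hc hf, ← integral_sub_left_eq_self
    (fun q => ζ q * wt (x - q).1 (x - q).2) volume x]
  simp only [sub_sub_cancel]
  rw [← neg_eq_iff_eq_neg] at h1
  rw [← h1, ← integral_neg]
  refine integral_congr_ae (Eventually.of_forall fun q => ?_)
  beta_reduce
  rw [fderiv_reflect hζ]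
  by_cases hq : q.1 ∈ Icc 0 T
  · rw [clampExtend_of_mem hq]; ring
  · have h0 : fderiv ℝ ζ (x - q) (1, 0) = 0 := by
      by_contra hne
      have h2 : fderiv ℝ (fun q => ζ (x - q)) q ≠ 0 := by
        intro h3
        have := fderiv_reflect hζ x q (1, 0)
        rw [h3] at this
        simp at this
        exact hne this
      have h4 : q ∈ tsupport (fun q => ζ (x - q)) :=
        tsupport_fderiv_subset ℝ (subset_tsupport _ h2)
      exact hq (Ioo_subset_Icc_self (hsup h4).1)
    rw [h0]; simp

lemma fderiv_timeConv_space (hζ : ContDiff ℝ ∞ ζ) (hc : HasCompactSupport ζ)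
    (hf : Continuous (clampExtend T w)) {dw : ℝ → Plane → Plane →L[ℝ] ℝ}
    (hw : ∀ᵐ t ∂(volume.restrict (Ioo 0 T)), HasWeakFDeriv (w t) (dw t)) {x : ℝ × Plane}
    (hx : ∀ q ∈ tsupport ζ, (x - q).1 ∈ Ioo 0 T) {v : Plane}
    (hint : Integrable (fun q => ζ q * dw (x - q).1 (x - q).2 v)) :
    fderiv ℝ (timeConv ζ (clampExtend T w)) x (0, v) =
      ∫ q, ζ q * dw (x - q).1 (x - q).2 v := by
  set ψ : ℝ × Plane → ℝ := fun q => ζ (x - q) with hψ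
  have hψs : ContDiff ℝ ∞ ψ := hζ.comp (contDiff_const.sub contDiff_id)
  have hψc : HasCompactSupport ψ := hasCompactSupport_reflect hc x
  have hsup : tsupport ψ ⊆ Ioo 0 T ×ˢ univ := by
    intro q hq
    rw [hψ, tsupport_reflect] at hq
    have := hx _ hq
    rw [sub_sub_cancel] at this
    exact ⟨this, trivial⟩
  have hψ0 : ∀ s ∉ Ioo 0 T, ∀ y, ψ (s, y) = 0 := fun s hs y =>
    image_eq_zero_of_notMem_tsupport fun h => hs (hsup h).1
  have hDψ0 : ∀ s ∉ Ioo 0 T, ∀ y, fderiv ℝ ψ (s, y) = 0 := fun s hs y =>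
    image_eq_zero_of_notMem_tsupport (f := fderiv ℝ ψ)
      fun h => hs (hsup (tsupport_fderiv_subset ℝ h)).1
  have hint' : Integrable (fun q : ℝ × Plane => ψ q * dw q.1 q.2 v) := by
    have := hint.comp_sub_left x
    simpa only [sub_sub_cancel] using this
  rw [fderiv_timeConv hζ hc hf, ← integral_sub_left_eq_self
    (fun q => ζ q * dw (x - q).1 (x - q).2 v) volume x]
  simp only [sub_sub_cancel]
  have e1 : ∀ q, fderiv ℝ ζ (x - q) (0, v) * clampExtend T w q =
      - (fderiv ℝ ψ q (0, v) * clampExtend T w q) := fun q => by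
    rw [hψ, fderiv_reflect hζ]; ring
  simp_rw [e1]
  rw [integral_neg]
  have hDc : Continuous fun q => fderiv ℝ ψ q (0, v) :=
    (hψs.continuous_fderiv (by norm_num)).clm_apply continuous_const
  have hint1 : Integrable (fun q : ℝ × Plane => fderiv ℝ ψ q (0, v) * clampExtend T w q) := by
    refine (hDc.mul hf).integrable_of_hasCompactSupport ?_
    refine HasCompactSupport.mul_right ?_
    exact (hψc.fderiv ℝ).comp_left (g := fun L : ℝ × Plane →L[ℝ] ℝ => L (0, v)) rfl
  rw [Measure.volume_eq_prod] at hint1 hint' ⊢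
  rw [integral_prod _ hint1]
  have e2 : ∫ q, ψ q * dw q.1 q.2 v ∂(volume : Measure ℝ).prod (volume : Measure Plane) = _ :=
    integral_prod _ hint'
  change -_ = ∫ q, ψ q * dw q.1 q.2 v ∂(volume : Measure ℝ).prod (volume : Measure Plane)
  rw [e2, ← integral_neg]
  refine integral_congr_ae ?_
  have hae : ∀ᵐ s ∂(volume : Measure ℝ), s ∈ Ioo 0 T → HasWeakFDeriv (w s) (dw s) :=
    (ae_restrict_iff' measurableSet_Ioo).1 hw
  filter_upwards [hae] with s hs
  by_cases hsT : s ∈ Ioo 0 T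
  · have hslice : ∀ y, HasFDerivAt (fun y => ψ (s, y))
        ((fderiv ℝ ψ (s, y)).comp (ContinuousLinearMap.inr ℝ ℝ Plane)) y := fun y =>
      HasFDerivAt.comp (g := ψ) y ((hψs.differentiable (by norm_num) (s, y)).hasFDerivAt)
        (hasFDerivAt_prodMk_right s y)
    have h1 := (hs hsT).2.2 (fun y => ψ (s, y)) (hψs.comp (contDiff_const.prodMk contDiff_id))
      (HasCompactSupport.intro (IsCompact.image hψc continuous_snd) fun y hy =>
        image_eq_zero_of_notMem_tsupport fun h => hy ⟨(s, y), h, rfl⟩) v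
    have h2 : ∀ y, fderiv ℝ (fun y => ψ (s, y)) y v = fderiv ℝ ψ (s, y) (0, v) := fun y => by
      rw [(hslice y).fderiv]; simp
    simp only [h2, smul_eq_mul] at h1
    have h3 : ∀ y, clampExtend T w (s, y) = w s y := fun y =>
      clampExtend_of_mem (p := (s, y)) (Ioo_subset_Icc_self hsT)
    simp only [h3]
    rw [h1, neg_neg]
  · simp [hψ0 s hsT, hDψ0 s hsT]

end Conv

lemma lintegral_mul_sq_le {α : Type*} [MeasurableSpace α] {μ : Measure α} {k h : α → ℝ≥0∞}
    (hk : Measurable k) (hh : Measurable h) :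
    (∫⁻ x, k x * h x ∂μ) ^ (2 : ℝ) ≤ (∫⁻ x, k x ∂μ) * ∫⁻ x, k x * h x ^ (2 : ℝ) ∂μ := by
  have hpq : Real.HolderConjugate 2 2 := Real.HolderConjugate.two_two
  have h1 := ENNReal.lintegral_mul_le_Lp_mul_Lq μ hpq
    (f := fun x => k x ^ (1 / 2 : ℝ)) (g := fun x => k x ^ (1 / 2 : ℝ) * h x)
    (hk.pow_const _).aemeasurable ((hk.pow_const _).mul hh).aemeasurable
  have e0 : ∀ x, k x ^ (1 / 2 : ℝ) * k x ^ (1 / 2 : ℝ) = k x := fun x => by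
    rw [← ENNReal.rpow_add_of_nonneg _ _ (by norm_num) (by norm_num)]
    norm_num
  have e1 : ∀ x, ((fun x => k x ^ (1 / 2 : ℝ)) * fun x => k x ^ (1 / 2 : ℝ) * h x) x
      = k x * h x := fun x => by
    simp only [Pi.mul_apply]
    rw [← mul_assoc, e0]
  have e2 : ∀ x, (k x ^ (1 / 2 : ℝ)) ^ (2 : ℝ) = k x := fun x => by
    rw [← ENNReal.rpow_mul]; norm_num
  have e3 : ∀ x, (k x ^ (1 / 2 : ℝ) * h x) ^ (2 : ℝ) = k x * h x ^ (2 : ℝ) := fun x => by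
    rw [ENNReal.mul_rpow_of_nonneg _ _ (by norm_num), e2]
  simp_rw [e1, e2, e3] at h1
  calc (∫⁻ x, k x * h x ∂μ) ^ (2 : ℝ)
      ≤ ((∫⁻ x, k x ∂μ) ^ (1 / 2 : ℝ) *
          (∫⁻ x, k x * h x ^ (2 : ℝ) ∂μ) ^ (1 / 2 : ℝ)) ^ (2 : ℝ) := by gcongr
    _ = _ := by
        rw [ENNReal.mul_rpow_of_nonneg _ _ (by norm_num), ← ENNReal.rpow_mul, ← ENNReal.rpow_mul]
        norm_num

lemma volume_bigBox_lt_top : volume bigBox < ⊤ :=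
  (measure_mono (fun y (hy : y ∈ bigBox) i => Ico_subset_Icc_self (hy i) :
    bigBox ⊆ {y : Plane | ∀ i, y i ∈ Icc (-1 : ℝ) 2})).trans_lt
    isCompact_closedBigBox.measure_lt_top

/-- A periodic function of class `L^∞(0,T;L²)`, restricted to a box larger than the period cell. -/
lemma MemLinftyLp.exists_local_representative {F : Type*} [NormedAddCommGroup F] {T : ℝ}
    {f : ℝ → Plane → F} (h : MemLinftyLp T 2 torusMeasure f) (hper : ∀ t, TorusPeriodic (f t)) :
    ∃ g : ℝ × Plane → F, StronglyMeasurable g ∧ Integrable g ∧ ∫⁻ p, ‖g p‖ₑ ^ (2 : ℝ) < ⊤ ∧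
      ∀ᵐ p : ℝ × Plane, p ∈ Ioo 0 T ×ˢ bigBox → g p = f p.1 p.2 := by
  have hQ : MeasurableSet (Ioo 0 T ×ˢ bigBox) := measurableSet_Ioo.prod measurableSet_bigBox
  have hm : AEStronglyMeasurable (Function.uncurry f) (volume.restrict (Ioo 0 T ×ˢ bigBox)) := by
    have h1 := h.1
    rw [prod_torusMeasure] at h1
    exact (aestronglyMeasurable_of_periodic hper measurableSet_Ioo h1).mono_measure
      (Measure.restrict_mono (prod_mono le_rfl (subset_univ _)) le_rfl)
  have hL : ∫⁻ p in Ioo 0 T ×ˢ bigBox, ‖f p.1 p.2‖ₑ ^ (2 : ℝ) < ⊤ := by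
    refine (setLIntegral_bigBox_le hper 2).trans_lt (ENNReal.mul_lt_top (by simp) ?_)
    have := h.lintegral_sq_lt_top
    rwa [prod_torusMeasure] at this
  set g := (Ioo 0 T ×ˢ bigBox).indicator (hm.mk _) with hg
  have hgm : StronglyMeasurable g := hm.stronglyMeasurable_mk.indicator hQ
  have hge : ∀ᵐ p : ℝ × Plane, p ∈ Ioo 0 T ×ˢ bigBox → g p = f p.1 p.2 := by
    filter_upwards [(ae_restrict_iff' hQ).1 hm.ae_eq_mk] with p hp hpQ
    rw [hg, indicator_of_mem hpQ, ← hp hpQ]; rfl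
  have hg2 : ∫⁻ p, ‖g p‖ₑ ^ (2 : ℝ) < ⊤ := by
    refine lt_of_le_of_lt ?_ hL
    rw [← lintegral_indicator hQ]
    refine lintegral_mono_ae ?_
    filter_upwards [hge] with p hp
    by_cases hpQ : p ∈ Ioo 0 T ×ˢ bigBox
    · rw [indicator_of_mem hpQ, hp hpQ]
    · rw [hg, indicator_of_notMem hpQ]; simp
  refine ⟨g, hgm, ?_, hg2, hge⟩
  have hfin : IsFiniteMeasure ((volume : Measure (ℝ × Plane)).restrict (Ioo 0 T ×ˢ bigBox)) := by
    refine ⟨?_⟩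
    rw [Measure.restrict_apply_univ, Measure.volume_eq_prod, Measure.prod_prod]
    exact ENNReal.mul_lt_top (by simp) volume_bigBox_lt_top
  have hmem : MemLp g 2 (volume.restrict (Ioo 0 T ×ˢ bigBox)) := by
    refine ⟨hgm.aestronglyMeasurable, ?_⟩
    rw [eLpNorm_eq_lintegral_rpow_enorm_toReal (by norm_num) (by norm_num)]
    refine ENNReal.rpow_lt_top_of_nonneg (by norm_num) (lt_of_le_of_lt ?_ hg2).ne
    simp only [ENNReal.toReal_ofNat]
    exact lintegral_mono' Measure.restrict_le_self le_rfl
  have h1 : IntegrableOn g (Ioo 0 T ×ˢ bigBox) := hmem.integrable (by norm_num)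
  rw [hg, integrable_indicator_iff hQ]
  exact h1.congr (by
    filter_upwards [ae_restrict_mem hQ] with p hp
    rw [hg, indicator_of_mem hp])

/-- Smooth approximation of the displacement on `[0,τ]`: uniform, with convergence of the time
derivative in `L¹` and with a bound of the space derivative in `L²`. -/
theorem IsShellDisplacement.exists_mollification {T τ : ℝ} (hT : 0 < T) (hτT : τ < T)
    {w wt : ℝ → Plane → ℝ} (hw : IsShellDisplacement T w wt) :
    ∃ C : ℝ≥0∞, C ≠ ⊤ ∧ ∀ δ > 0, ∃ W : ℝ × Plane → ℝ, ContDiff ℝ 1 W ∧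
      (∀ t, TorusPeriodic fun y => W (t, y)) ∧ (∀ p, |W p - clampExtend T w p| ≤ δ) ∧
      ∫⁻ p in Ioo 0 τ ×ˢ halfOpenCell, ‖fderiv ℝ W p (1, 0) - wt p.1 p.2‖ₑ ≤ ENNReal.ofReal δ ∧
      ∫⁻ p in Ioo 0 τ ×ˢ halfOpenCell,
        ‖(fderiv ℝ W p).comp (ContinuousLinearMap.inr ℝ ℝ Plane)‖ₑ ^ (2 : ℝ) ≤ C := by
  obtain ⟨-, dw, ddw, hdwper, -, hdw, -, hweak⟩ := hw.memLinftyH2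
  have hweak' : ∀ᵐ t ∂(volume.restrict (Ioo 0 T)), HasWeakFDeriv (w t) (dw t) := by
    filter_upwards [hweak] with t ht using ht.1
  obtain ⟨g, hgm, hgi, -, hge⟩ := hw.memLinftyL2_wt.exists_local_representative hw.periodic_wt
  obtain ⟨d, hdm, hdi, hd2, hde⟩ := hdw.exists_local_representative hdwper
  have hcont := continuous_clampExtend hT.le hw.periodic hw.continuousOn
  refine ⟨∫⁻ p, ‖d p‖ₑ ^ (2 : ℝ), hd2.ne, fun δ hδ => ?_⟩
  obtain ⟨r₁, hr₁, hunif⟩ := clampExtend_uniform hT.le hw.periodic hw.continuousOn (half_pos hδ)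
  obtain ⟨r₂, hr₂, htrans⟩ := exists_lintegral_translate_sub_le hgi
    (ENNReal.ofReal_pos.2 hδ)
  obtain ⟨σ, hσ0, hσ1, hσ2, hσ3, hσ4⟩ : ∃ σ : ℝ, 0 < σ ∧ 2 * σ < r₁ ∧ 2 * σ < r₂ ∧
      2 * σ < T - τ ∧ 2 * σ < 1 := by
    have hm : 0 < min (min r₁ r₂) (min (T - τ) 1) :=
      lt_min (lt_min hr₁ hr₂) (lt_min (by linarith) one_pos)
    have h1 := min_le_left (min r₁ r₂) (min (T - τ) 1)
    have h2 := min_le_right (min r₁ r₂) (min (T - τ) 1)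
    have h3 := min_le_left r₁ r₂
    have h4 := min_le_right r₁ r₂
    have h5 := min_le_left (T - τ) 1
    have h6 := min_le_right (T - τ) 1
    exact ⟨min (min r₁ r₂) (min (T - τ) 1) / 3, by positivity, by linarith, by linarith,
      by linarith, by linarith⟩
  let φ : ContDiffBump (0 : ℝ × Plane) := ⟨σ / 4, σ / 2, by positivity, by linarith⟩
  have hφr : φ.rOut = σ / 2 := rfl
  set ζ : ℝ × Plane → ℝ := φ.normed volume with hζdef
  have hζ : ContDiff ℝ ∞ ζ := φ.contDiff_normed
  have hζc : HasCompactSupport ζ := φ.hasCompactSupport_normed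
  have hζ0 : ∀ q, 0 ≤ ζ q := φ.nonneg_normed
  have hζsup : ∀ q ∈ tsupport ζ, ‖q‖ ≤ σ / 2 := fun q hq => by
    rw [hζdef, φ.tsupport_normed_eq, mem_closedBall_zero_iff] at hq
    exact hq
  have hζ1 : ∫ q, ζ q = 1 := φ.integral_normed
  have hζi : Integrable ζ := φ.integrable_normed
  have hζl : ∫⁻ q, ‖ζ q‖ₑ = 1 := by
    have h1 := ofReal_integral_eq_lintegral_ofReal hζi (Eventually.of_forall hζ0)
    rw [hζ1, ENNReal.ofReal_one] at h1
    rw [h1]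
    exact lintegral_congr fun q => Real.enorm_eq_ofReal (hζ0 q)
  obtain ⟨Z, hZ⟩ := hζ.continuous.bounded_above_of_compact_support hζc
  set s : ℝ × Plane := (σ, 0) with hs
  have hsn : ‖s‖ = σ := by simp [hs, Prod.norm_def, abs_of_pos hσ0, hσ0.le]
  set V := timeConv ζ (clampExtend T w) with hV
  have hVs : ContDiff ℝ 1 V := contDiff_timeConv hζ hζc hcont
  have hfW : ∀ p, fderiv ℝ (fun p => V (p + s)) p = fderiv ℝ V (p + s) := fun p => by
    rw [fderiv_comp_add_right]
  have hmem : ∀ p ∈ Ioo 0 τ ×ˢ halfOpenCell, ∀ q ∈ tsupport ζ,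
      p + s - q ∈ Ioo 0 T ×ˢ bigBox := by
    rintro ⟨t, y⟩ ⟨ht, hy⟩ ⟨t', y'⟩ hq
    have hq' := hζsup _ hq
    have h1 : |t'| ≤ σ / 2 := (le_max_left _ _).trans hq'
    have h2 : ‖y'‖ ≤ σ / 2 := (le_max_right _ _).trans hq'
    rw [abs_le] at h1
    have ht' : t ∈ Ioo 0 τ := ht
    refine ⟨?_, fun i => ?_⟩
    · change t + σ - t' ∈ Ioo 0 T
      exact ⟨by linarith [ht'.1], by linarith [ht'.2]⟩
    · have h3 : |y' i| ≤ σ / 2 := (PiLp.norm_apply_le y' i).trans h2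
      rw [abs_le] at h3
      have h4 := hy i
      change y i + 0 - y' i ∈ Ico (-1 : ℝ) 2
      have h5 : y i ∈ Ico (0 : ℝ) 1 := h4
      exact ⟨by linarith [h5.1], by linarith [h5.2]⟩
  have hae : ∀ (x : ℝ × Plane) {P : ℝ × Plane → Prop}, (∀ᵐ p, P p) → ∀ᵐ q, P (x - q) :=
    fun x P hP => (quasiMeasurePreserving_sub_left volume x).ae hP
  have hζm : Measurable fun q => ‖ζ q‖ₑ := hζ.continuous.enorm.measurable
  -- the time derivative
  have htime : ∀ p ∈ Ioo 0 τ ×ˢ halfOpenCell,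
      fderiv ℝ V (p + s) (1, 0) = ∫ q, ζ q * g (p + s - q) := by
    intro p hp
    rw [hV, fderiv_timeConv_time hζ hζc hcont hw.timeDeriv fun q hq => (hmem p hp q hq).1]
    refine integral_congr_ae ?_
    filter_upwards [hae (p + s) hge] with q hq
    by_cases hqs : q ∈ tsupport ζ
    · rw [hq (hmem p hp q hqs)]
    · rw [image_eq_zero_of_notMem_tsupport hqs, zero_mul, zero_mul]
  have hgint : ∀ x, Integrable fun q => ζ q * g (x - q) := fun x =>
    (hgi.comp_sub_left x).bdd_mul hζ.continuous.aestronglyMeasurable (Eventually.of_forall hZ)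
  have hdint : ∀ x, Integrable fun q => ζ q • d (x - q) := fun x =>
    (hdi.comp_sub_left x).bdd_smul Z hζ.continuous.aestronglyMeasurable
      (Eventually.of_forall hZ)
  have hspace : ∀ p ∈ Ioo 0 τ ×ˢ halfOpenCell,
      (fderiv ℝ V (p + s)).comp (ContinuousLinearMap.inr ℝ ℝ Plane) =
        ∫ q, ζ q • d (p + s - q) := by
    intro p hp
    have hcongr : ∀ v : Plane, (fun q => ζ q * d (p + s - q) v) =ᵐ[volume]
        fun q => ζ q * dw (p + s - q).1 (p + s - q).2 v := by
      intro v
      filter_upwards [hae (p + s) hde] with q hq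
      by_cases hqs : q ∈ tsupport ζ
      · rw [hq (hmem p hp q hqs)]
      · rw [image_eq_zero_of_notMem_tsupport hqs, zero_mul, zero_mul]
    refine ContinuousLinearMap.ext fun v => ?_
    have hvint : Integrable fun q => ζ q * d (p + s - q) v := by
      have := (ContinuousLinearMap.apply ℝ ℝ v).integrable_comp (hdint (p + s))
      exact this
    rw [ContinuousLinearMap.integral_apply (hdint (p + s))]
    change fderiv ℝ V (p + s) (0, v) = ∫ q, ζ q * d (p + s - q) v
    rw [hV, fderiv_timeConv_space hζ hζc hcont hweak' (fun q hq => (hmem p hp q hq).1)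
      (hvint.congr (hcongr v))]
    exact (integral_congr_ae (hcongr v)).symm
  refine ⟨fun p => V (p + s), hVs.comp (contDiff_id.add contDiff_const), ?_, ?_, ?_, ?_⟩
  · intro t k y
    change V ((t, y + latticeVec k) + s) = V ((t, y) + s)
    rw [hV, timeConv]
    simp only [convolution]
    refine integral_congr_ae (Eventually.of_forall fun q => ?_)
    beta_reduce
    congr 1
    simp only [clampExtend, Prod.fst_sub, Prod.fst_add, Prod.snd_sub, Prod.snd_add]
    rw [show y + latticeVec k + s.2 - q.2 = (y + s.2 - q.2) + latticeVec k by abel,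
      hw.periodic]
  · intro p
    have h1 : dist (V (p + s)) (clampExtend T w (p + s)) ≤ δ / 2 := by
      refine ContDiffBump.dist_normed_convolution_le hcont.aestronglyMeasurable ?_
      intro y hy
      refine hunif _ _ ((Metric.mem_ball.1 hy).trans ?_)
      rw [hφr]; linarith
    have h2 : dist (clampExtend T w (p + s)) (clampExtend T w p) ≤ δ / 2 := by
      refine hunif _ _ ?_
      rw [dist_eq_norm, add_sub_cancel_left, hsn]
      linarith
    have h3 := dist_triangle (V (p + s)) (clampExtend T w (p + s)) (clampExtend T w p)
    rw [← Real.dist_eq]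
    linarith
  · have hae_g : ∀ᵐ p ∂(volume.restrict (Ioo 0 τ ×ˢ halfOpenCell)), g p = wt p.1 p.2 := by
      rw [ae_restrict_iff' (measurableSet_Ioo.prod measurableSet_halfOpenCell)]
      filter_upwards [hge] with p hp hpm
      refine hp ⟨⟨hpm.1.1, hpm.1.2.trans hτT⟩, fun i => ?_⟩
      exact ⟨by linarith [(hpm.2 i).1], by linarith [(hpm.2 i).2]⟩
    have hmeas : Measurable (Function.uncurry fun (p q : ℝ × Plane) =>
        ‖ζ q‖ₑ * ‖g (p + (s - q)) - g p‖ₑ) := by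
      refine (hζm.comp measurable_snd).mul ?_
      have h1 : StronglyMeasurable fun z : (ℝ × Plane) × (ℝ × Plane) =>
          g (z.1 + (s - z.2)) - g z.1 :=
        (hgm.comp_measurable (by fun_prop)).sub (hgm.comp_measurable measurable_fst)
      exact h1.enorm
    calc ∫⁻ p in Ioo 0 τ ×ˢ halfOpenCell,
          ‖fderiv ℝ (fun p => V (p + s)) p (1, 0) - wt p.1 p.2‖ₑ
        ≤ ∫⁻ p in Ioo 0 τ ×ˢ halfOpenCell, ∫⁻ q, ‖ζ q‖ₑ * ‖g (p + (s - q)) - g p‖ₑ := by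
          refine lintegral_mono_ae ?_
          filter_upwards [hae_g, ae_restrict_mem
            (measurableSet_Ioo.prod measurableSet_halfOpenCell)] with p hpg hpm
          rw [hfW, htime p hpm, ← hpg]
          have e1 : g p = ∫ q, ζ q * g p := by rw [integral_mul_const, hζ1, one_mul]
          conv_lhs => rw [e1]
          rw [← integral_sub (hgint _) (hζi.mul_const _)]
          refine (enorm_integral_le_lintegral_enorm _).trans (lintegral_mono fun q => ?_)
          rw [← mul_sub, enorm_mul, add_sub_assoc]
      _ ≤ ∫⁻ p, ∫⁻ q, ‖ζ q‖ₑ * ‖g (p + (s - q)) - g p‖ₑ :=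
          lintegral_mono' Measure.restrict_le_self le_rfl
      _ = ∫⁻ q, ∫⁻ p, ‖ζ q‖ₑ * ‖g (p + (s - q)) - g p‖ₑ :=
          lintegral_lintegral_swap hmeas.aemeasurable
      _ ≤ ∫⁻ q, ‖ζ q‖ₑ * ENNReal.ofReal δ := by
          refine lintegral_mono fun q => ?_
          beta_reduce
          rw [lintegral_const_mul' _ _ enorm_ne_top]
          by_cases hq : q ∈ tsupport ζ
          · refine mul_le_mul' le_rfl (htrans _ ?_)
            have := hζsup q hq
            refine (norm_sub_le _ _).trans_lt ?_
            rw [hsn]; linarith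
          · rw [image_eq_zero_of_notMem_tsupport hq]; simp
      _ = ENNReal.ofReal δ := by
          rw [lintegral_mul_const' _ _ ENNReal.ofReal_ne_top, hζl, one_mul]
  · have hmeas : Measurable (Function.uncurry fun (p q : ℝ × Plane) =>
        ‖ζ q‖ₑ * ‖d (p + (s - q))‖ₑ ^ (2 : ℝ)) := by
      refine (hζm.comp measurable_snd).mul (Measurable.pow_const ?_ _)
      exact (hdm.comp_measurable (by fun_prop :
        Measurable fun z : (ℝ × Plane) × (ℝ × Plane) => z.1 + (s - z.2))).enorm
    calc ∫⁻ p in Ioo 0 τ ×ˢ halfOpenCell,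
          ‖(fderiv ℝ (fun p => V (p + s)) p).comp (ContinuousLinearMap.inr ℝ ℝ Plane)‖ₑ ^ (2 : ℝ)
        ≤ ∫⁻ p in Ioo 0 τ ×ˢ halfOpenCell, ∫⁻ q, ‖ζ q‖ₑ * ‖d (p + (s - q))‖ₑ ^ (2 : ℝ) := by
          refine setLIntegral_mono' (measurableSet_Ioo.prod measurableSet_halfOpenCell)
            fun p hpm => ?_
          rw [hfW, hspace p hpm]
          have h1 : ‖∫ q, ζ q • d (p + s - q)‖ₑ ≤ ∫⁻ q, ‖ζ q‖ₑ * ‖d (p + (s - q))‖ₑ := by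
            refine (enorm_integral_le_lintegral_enorm _).trans (lintegral_mono fun q => ?_)
            rw [enorm_smul, add_sub_assoc]
          have hdm' : Measurable fun q => ‖d (p + (s - q))‖ₑ :=
            (hdm.comp_measurable (by fun_prop : Measurable fun q => p + (s - q))).enorm
          have h2 := lintegral_mul_sq_le (μ := (volume : Measure (ℝ × Plane))) hζm hdm'
          rw [hζl, one_mul] at h2
          exact (ENNReal.rpow_le_rpow h1 (by norm_num)).trans h2
      _ ≤ ∫⁻ p, ∫⁻ q, ‖ζ q‖ₑ * ‖d (p + (s - q))‖ₑ ^ (2 : ℝ) :=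
          lintegral_mono' Measure.restrict_le_self le_rfl
      _ = ∫⁻ q, ∫⁻ p, ‖ζ q‖ₑ * ‖d (p + (s - q))‖ₑ ^ (2 : ℝ) :=
          lintegral_lintegral_swap hmeas.aemeasurable
      _ = ∫⁻ q, ‖ζ q‖ₑ * ∫⁻ p, ‖d p‖ₑ ^ (2 : ℝ) := by
          refine lintegral_congr fun q => ?_
          rw [lintegral_const_mul' _ _ enorm_ne_top,
            lintegral_add_right_eq_self (fun p => ‖d p‖ₑ ^ (2 : ℝ)) (s - q)]
      _ = ∫⁻ p, ‖d p‖ₑ ^ (2 : ℝ) := by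
          rw [lintegral_mul_const' _ _ hd2.ne, hζl, one_mul]

lemma slabMeasure_eq_prod (a' b' : ℝ) :
    slabMeasure a' b' = torusMeasure.prod (volume.restrict (Icc a' b')) := by
  rw [slabMeasure, torusMeasure_eq, Measure.prod_restrict]; rfl

instance (a' b' : ℝ) : IsFiniteMeasure (slabMeasure a' b') := by
  rw [slabMeasure_eq_prod]; infer_instance

/-- The set of points at height between `η` and `η + h`. -/
def graphLayer (η : Plane → ℝ) (h : ℝ) : Set (Plane × ℝ) := {p | p.2 ∈ Icc (η p.1) (η p.1 + h)}

lemma measurableSet_graphLayer {η : Plane → ℝ} (hη : Continuous η) (h : ℝ) :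
    MeasurableSet (graphLayer η h) := by
  have h1 : IsClosed (graphLayer η h) := by
    have : graphLayer η h = {p | η p.1 ≤ p.2} ∩ {p | p.2 ≤ η p.1 + h} := rfl
    rw [this]
    exact (isClosed_le (by fun_prop) (by fun_prop)).inter (isClosed_le (by fun_prop) (by fun_prop))
  exact h1.measurableSet

lemma lintegral_graphLayer {η : Plane → ℝ} (hη : Continuous η) {h a' b' : ℝ}
    (hη1 : ∀ y, a' ≤ η y) (hη2 : ∀ y, η y + h ≤ b') {F : Plane × ℝ → ℝ≥0∞}
    (hF : Measurable F) :
    ∫⁻ p in graphLayer η h, F p ∂(slabMeasure a' b') =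
      ∫⁻ y, (∫⁻ z in Icc (η y) (η y + h), F (y, z)) ∂torusMeasure := by
  rw [← lintegral_indicator (measurableSet_graphLayer hη h), slabMeasure_eq_prod,
    lintegral_prod _ (hF.indicator (measurableSet_graphLayer hη h)).aemeasurable]
  refine lintegral_congr fun y => ?_
  have h1 : ∀ z, (graphLayer η h).indicator F (y, z) =
      (Icc (η y) (η y + h)).indicator (fun z => F (y, z)) z := fun z => by
    by_cases hz : z ∈ Icc (η y) (η y + h)
    · rw [indicator_of_mem hz, indicator_of_mem (show (y, z) ∈ graphLayer η h from hz)]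
    · rw [indicator_of_notMem hz, indicator_of_notMem (show (y, z) ∉ graphLayer η h from hz)]
  simp_rw [h1]
  rw [lintegral_indicator measurableSet_Icc, Measure.restrict_restrict measurableSet_Icc,
    inter_eq_left.2 (Icc_subset_Icc (hη1 y) (hη2 y))]

section Trace

variable {Ω : Set Space3} {φ n : Plane → Space3}

lemma lintegral_graphLayer_sub_le (hΩ : IsReferenceDomain Ω φ n) {a' b' h : ℝ}
    {η : Plane → ℝ} (hη : Continuous η) (hη1 : ∀ y, a' ≤ η y) (hη2 : ∀ y, η y + h ≤ b')
    {v : Space3 → Space3} (hv : ContDiff ℝ 1 v) {q : Plane → ℝ≥0∞} (hq : Measurable q) :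
    ∫⁻ p in graphLayer η h, q p.1 * ‖v (tubeMap φ n p) - v (tubeMap φ n (p.1, η p.1))‖ₑ
        ∂(slabMeasure a' b') ≤
      ENNReal.ofReal h * ∫⁻ p in graphLayer η h, q p.1 * ‖fderiv ℝ v (tubeMap φ n p)‖ₑ
        ∂(slabMeasure a' b') := by
  have hΨ := hΩ.continuous_tubeMap
  have hD : Continuous (fderiv ℝ v) := hv.continuous_fderiv (by norm_num)
  have hm1 : Measurable fun p : Plane × ℝ =>
      q p.1 * ‖v (tubeMap φ n p) - v (tubeMap φ n (p.1, η p.1))‖ₑ := by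
    refine (hq.comp measurable_fst).mul ?_
    exact ((hv.continuous.comp hΨ).sub (hv.continuous.comp (hΨ.comp (by fun_prop)))).enorm.measurable
  have hm2 : Measurable fun p : Plane × ℝ => q p.1 * ‖fderiv ℝ v (tubeMap φ n p)‖ₑ := by
    refine (hq.comp measurable_fst).mul ?_
    exact (hD.comp hΨ).enorm.measurable
  rw [lintegral_graphLayer hη hη1 hη2 hm1, lintegral_graphLayer hη hη1 hη2 hm2,
    ← lintegral_const_mul' _ _ ENNReal.ofReal_ne_top]
  refine lintegral_mono fun y => ?_
  beta_reduce
  have hqm : Measurable fun z : ℝ => ‖fderiv ℝ v (tubeMap φ n (y, z))‖ₑ :=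
    (hD.comp (hΨ.comp (by fun_prop))).enorm.measurable
  have hn : ‖n y‖ₑ = 1 := by
    rw [← ofReal_norm, hΩ.normal_unit, ENNReal.ofReal_one]
  have hpt : ∀ z ∈ Icc (η y) (η y + h),
      ‖v (tubeMap φ n (y, z)) - v (tubeMap φ n (y, η y))‖ₑ ≤
        ∫⁻ s in Icc (η y) (η y + h), ‖fderiv ℝ v (tubeMap φ n (y, s))‖ₑ := by
    intro z hz
    have h1 := enorm_sub_le_lintegral_deriv (f := fun s : ℝ => v (tubeMap φ n (y, s)))
      (f' := fun s => fderiv ℝ v (tubeMap φ n (y, s)) (n y)) hz.1 (fun s => by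
        have h2 : HasDerivAt (fun s : ℝ => tubeMap φ n (y, s)) (n y) s := by
          have h5 := ((hasDerivAt_id s).smul_const (n y)).const_add (φ y)
          rw [one_smul] at h5
          exact h5
        exact ((hv.differentiable (by norm_num) _).hasFDerivAt).comp_hasDerivAt s h2)
      ((hD.comp (hΨ.comp (by fun_prop))).clm_apply continuous_const)
    refine h1.trans ?_
    refine (lintegral_mono fun s => ?_).trans (lintegral_mono_set (Icc_subset_Icc le_rfl hz.2))
    refine (ContinuousLinearMap.le_opENorm _ _).trans ?_
    rw [hn, mul_one]
  calc ∫⁻ z in Icc (η y) (η y + h), q y * ‖v (tubeMap φ n (y, z)) - v (tubeMap φ n (y, η y))‖ₑ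
      ≤ ∫⁻ _ in Icc (η y) (η y + h), q y *
          ∫⁻ s in Icc (η y) (η y + h), ‖fderiv ℝ v (tubeMap φ n (y, s))‖ₑ :=
        setLIntegral_mono' measurableSet_Icc fun z hz => mul_le_mul' le_rfl (hpt z hz)
    _ = _ := by
        rw [lintegral_const, Measure.restrict_apply_univ, Real.volume_Icc, add_sub_cancel_left,
          mul_comm, ← lintegral_const_mul _ hqm]

/-- Composition with the normal coordinates is bounded on `L¹`. -/
lemma lintegral_comp_tubeMap_le (hΩ : IsReferenceDomain Ω φ n) {a' b' : ℝ} {C : ℝ≥0∞}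
    (hC : Measure.map (tubeMap φ n) (slabMeasure a' b') ≤ C • (volume : Measure Space3))
    {F : Space3 → ℝ≥0∞} (hF : AEMeasurable F) :
    ∫⁻ p, F (tubeMap φ n p) ∂(slabMeasure a' b') ≤ C * ∫⁻ x, F x := by
  have hac : Measure.map (tubeMap φ n) (slabMeasure a' b') ≪ (volume : Measure Space3) :=
    (Measure.absolutelyContinuous_of_le hC).trans Measure.smul_absolutelyContinuous
  rw [← lintegral_map' (hF.mono_ac hac) hΩ.continuous_tubeMap.measurable.aemeasurable]
  refine (lintegral_mono' hC le_rfl).trans ?_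
  rw [lintegral_smul_measure, smul_eq_mul]

lemma aemeasurable_comp_tubeMap (hΩ : IsReferenceDomain Ω φ n) {a' b' : ℝ} {C : ℝ≥0∞}
    (hC : Measure.map (tubeMap φ n) (slabMeasure a' b') ≤ C • (volume : Measure Space3))
    {F : Space3 → ℝ≥0∞} (hF : AEMeasurable F) :
    AEMeasurable (fun p => F (tubeMap φ n p)) (slabMeasure a' b') := by
  have hac : Measure.map (tubeMap φ n) (slabMeasure a' b') ≪ (volume : Measure Space3) :=
    (Measure.absolutelyContinuous_of_le hC).trans Measure.smul_absolutelyContinuous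
  exact (hF.mono_ac hac).comp_measurable hΩ.continuous_tubeMap.measurable

lemma lintegral_indicator_sub {F : Type*} [NormedAddCommGroup F] {B : Set Space3}
    (hB : MeasurableSet B) {f v : Space3 → F} (hv : ∀ x ∉ B, v x = 0) :
    ∫⁻ x, ‖B.indicator f x - v x‖ₑ = ∫⁻ x in B, ‖v x - f x‖ₑ := by
  rw [← lintegral_indicator hB]
  refine lintegral_congr fun x => ?_
  by_cases hx : x ∈ B
  · rw [indicator_of_mem hx, indicator_of_mem hx, ← enorm_neg, neg_sub]
  · rw [indicator_of_notMem hx, indicator_of_notMem hx, hv x hx, sub_zero, enorm_zero]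

/-- A field in `H₀¹` deviates from its trace, in a layer of width `h` above the deformed boundary,
by at most `h` times its gradient, in a weighted `L¹` space. -/
theorem IsLagrangianTrace.lintegral_graphLayer_le (hΩ : IsReferenceDomain Ω φ n) {a' b' h r : ℝ}
    {C : ℝ≥0∞} (hCt : C ≠ ⊤)
    (hC : Measure.map (tubeMap φ n) (slabMeasure a' b') ≤ C • (volume : Measure Space3))
    {η : Plane → ℝ} (hη : Continuous η) (hη1 : ∀ y, a' ≤ η y) (hη2 : ∀ y, η y + h ≤ b')
    {f : Space3 → Space3} {Df : Space3 → Space3 →L[ℝ] Space3} {g : Plane → Space3}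
    (hf : AEStronglyMeasurable f (volume.restrict (Metric.ball 0 r)))
    (hDf : AEStronglyMeasurable Df (volume.restrict (Metric.ball 0 r)))
    (hg : AEStronglyMeasurable g torusMeasure)
    (htr : IsLagrangianTrace (Metric.ball 0 r) (shellMap φ n η) f Df g)
    {q : Plane → ℝ≥0∞} (hq : Measurable q) {Q : ℝ≥0∞} (hQt : Q ≠ ⊤) (hQ : ∀ y, q y ≤ Q) :
    ∫⁻ p in graphLayer η h, q p.1 * ‖(Metric.ball 0 r).indicator f (tubeMap φ n p) - g p.1‖ₑ
        ∂(slabMeasure a' b') ≤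
      ENNReal.ofReal h * ∫⁻ p in graphLayer η h,
        q p.1 * ‖(Metric.ball 0 r).indicator Df (tubeMap φ n p)‖ₑ ∂(slabMeasure a' b') := by
  obtain ⟨v, ⟨hv1, hv2, hv3⟩, hv4⟩ := htr
  set B := Metric.ball (0 : Space3) r with hB
  have hBm : MeasurableSet B := measurableSet_ball
  set μ := (volume : Measure Space3).restrict B with hμ
  have hμf : IsFiniteMeasure μ := ⟨by
    rw [hμ, Measure.restrict_apply_univ]; exact measure_ball_lt_top⟩
  have hvD : ∀ k, Continuous (fderiv ℝ (v k)) := fun k =>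
    (hv1 k).1.continuous_fderiv (by norm_num)
  have hΨ := hΩ.continuous_tubeMap
  have e1 := tendsto_lintegral_enorm_of_eLpNorm_two
    (fun k => ((hv1 k).1.continuous.aestronglyMeasurable.sub hf)) hv2
  have e2 := tendsto_lintegral_enorm_of_eLpNorm_two
    (fun k => ((hvD k).aestronglyMeasurable.sub hDf)) hv3
  have hΦ : Continuous (shellMap φ n η) := hΨ.comp (by fun_prop : Continuous fun y => (y, η y))
  have e3 := tendsto_lintegral_enorm_of_eLpNorm_two
    (fun k => (((hv1 k).1.continuous.comp hΦ).aestronglyMeasurable.sub hg)) hv4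
  have hv0 : ∀ k, ∀ x ∉ B, v k x = 0 := fun k x hx =>
    image_eq_zero_of_notMem_tsupport fun h' => hx ((hv1 k).2.2 h')
  have hDv0 : ∀ k, ∀ x ∉ B, fderiv ℝ (v k) x = 0 := fun k x hx =>
    image_eq_zero_of_notMem_tsupport (f := fderiv ℝ (v k))
      fun h' => hx ((hv1 k).2.2 (tsupport_fderiv_subset ℝ h'))
  have hfi : AEStronglyMeasurable (B.indicator f) volume :=
    (aestronglyMeasurable_indicator_iff hBm).2 hf
  have hDfi : AEStronglyMeasurable (B.indicator Df) volume :=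
    (aestronglyMeasurable_indicator_iff hBm).2 hDf
  set ν := slabMeasure a' b' with hν
  set S := graphLayer η h with hS
  set I := ∫⁻ p in S, q p.1 * ‖B.indicator Df (tubeMap φ n p)‖ₑ ∂ν with hI
  set h' := ENNReal.ofReal h with hh'
  have hqm : Measurable fun p : Plane × ℝ => q p.1 := hq.comp measurable_fst
  have a1 : ∀ k, AEMeasurable (fun x => ‖B.indicator f x - v k x‖ₑ) volume := fun k =>
    (hfi.sub (hv1 k).1.continuous.aestronglyMeasurable).enorm
  have a2 : ∀ k, AEMeasurable (fun x => ‖B.indicator Df x - fderiv ℝ (v k) x‖ₑ) volume := fun k =>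
    (hDfi.sub (hvD k).aestronglyMeasurable).enorm
  have t1 : ∀ k, ∫⁻ p in S, q p.1 * ‖B.indicator f (tubeMap φ n p) - v k (tubeMap φ n p)‖ₑ ∂ν ≤
      Q * (C * ∫⁻ x, ‖v k x - f x‖ₑ ∂μ) := fun k => by
    calc _ ≤ ∫⁻ p in S, Q * ‖B.indicator f (tubeMap φ n p) - v k (tubeMap φ n p)‖ₑ ∂ν :=
          lintegral_mono fun p => mul_le_mul' (hQ _) le_rfl
      _ = Q * ∫⁻ p in S, ‖B.indicator f (tubeMap φ n p) - v k (tubeMap φ n p)‖ₑ ∂ν :=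
          lintegral_const_mul' _ _ hQt
      _ ≤ _ := by
          refine mul_le_mul' le_rfl ?_
          refine (setLIntegral_le_lintegral _ _).trans ?_
          rw [← lintegral_indicator_sub hBm (hv0 k)]
          exact lintegral_comp_tubeMap_le hΩ hC (a1 k)
  have t2 : ∀ k, ∫⁻ p in S, q p.1 * ‖fderiv ℝ (v k) (tubeMap φ n p)‖ₑ ∂ν ≤
      I + Q * (C * ∫⁻ x, ‖fderiv ℝ (v k) x - Df x‖ₑ ∂μ) := fun k => by
    calc _ ≤ ∫⁻ p in S, (q p.1 * ‖B.indicator Df (tubeMap φ n p)‖ₑ +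
            Q * ‖B.indicator Df (tubeMap φ n p) - fderiv ℝ (v k) (tubeMap φ n p)‖ₑ) ∂ν := by
          refine lintegral_mono fun p => ?_
          calc q p.1 * ‖fderiv ℝ (v k) (tubeMap φ n p)‖ₑ
              ≤ q p.1 * (‖B.indicator Df (tubeMap φ n p)‖ₑ +
                ‖fderiv ℝ (v k) (tubeMap φ n p) - B.indicator Df (tubeMap φ n p)‖ₑ) :=
                mul_le_mul' le_rfl (enorm_le_add_enorm_sub _ _)
            _ ≤ _ := by
                rw [mul_add]
                refine add_le_add le_rfl (mul_le_mul' (hQ _) (le_of_eq ?_))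
                exact enorm_sub_rev _ _
      _ = I + ∫⁻ p in S, Q * ‖B.indicator Df (tubeMap φ n p) - fderiv ℝ (v k) (tubeMap φ n p)‖ₑ
            ∂ν := by
          refine lintegral_add_left' ?_ _
          exact (hqm.aemeasurable.mul (aemeasurable_comp_tubeMap hΩ hC hDfi.enorm)).restrict
      _ ≤ _ := by
          refine add_le_add le_rfl ?_
          rw [lintegral_const_mul' _ _ hQt]
          refine mul_le_mul' le_rfl ?_
          refine (setLIntegral_le_lintegral _ _).trans ?_
          rw [← lintegral_indicator_sub hBm (hDv0 k)]
          exact lintegral_comp_tubeMap_le hΩ hC (a2 k)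
  set L := volume (Icc a' b') with hL
  have hLt : L ≠ ⊤ := by rw [hL, Real.volume_Icc]; exact ENNReal.ofReal_ne_top
  have t3 : ∀ k, ∫⁻ p in S, q p.1 * ‖v k (tubeMap φ n (p.1, η p.1)) - g p.1‖ₑ ∂ν ≤
      Q * (L * ∫⁻ y, ‖v k (shellMap φ n η y) - g y‖ₑ ∂torusMeasure) := fun k => by
    calc _ ≤ ∫⁻ p, Q * ‖v k (tubeMap φ n (p.1, η p.1)) - g p.1‖ₑ ∂ν := by
          refine (setLIntegral_le_lintegral _ _).trans
            (lintegral_mono fun p => mul_le_mul' (hQ _) le_rfl)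
      _ = Q * ∫⁻ p, ‖v k (tubeMap φ n (p.1, η p.1)) - g p.1‖ₑ ∂ν := lintegral_const_mul' _ _ hQt
      _ = _ := by
          congr 1
          have ham : AEMeasurable (fun y => ‖v k (shellMap φ n η y) - g y‖ₑ) torusMeasure :=
            (((hv1 k).1.continuous.comp hΦ).aestronglyMeasurable.sub hg).enorm
          rw [hν, slabMeasure_eq_prod, lintegral_prod]
          · have : ∀ y, ∫⁻ _ in Icc a' b', ‖v k (tubeMap φ n (y, η y)) - g y‖ₑ =
              ‖v k (shellMap φ n η y) - g y‖ₑ * L := fun y => by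
                rw [lintegral_const, Measure.restrict_apply_univ]; rfl
            simp_rw [this]
            rw [lintegral_mul_const' _ _ hLt, mul_comm]
          · exact ham.comp_fst
  have key : ∀ k, ∫⁻ p in S, q p.1 * ‖B.indicator f (tubeMap φ n p) - g p.1‖ₑ ∂ν ≤
      Q * (C * ∫⁻ x, ‖v k x - f x‖ₑ ∂μ) +
        (h' * (I + Q * (C * ∫⁻ x, ‖fderiv ℝ (v k) x - Df x‖ₑ ∂μ)) +
          Q * (L * ∫⁻ y, ‖v k (shellMap φ n η y) - g y‖ₑ ∂torusMeasure)) := by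
    intro k
    have m1 : AEMeasurable (fun p => q p.1 *
        ‖B.indicator f (tubeMap φ n p) - v k (tubeMap φ n p)‖ₑ) (ν.restrict S) :=
      (hqm.aemeasurable.mul (aemeasurable_comp_tubeMap hΩ hC (a1 k))).restrict
    have m2 : Measurable (fun p : Plane × ℝ => q p.1 *
        ‖v k (tubeMap φ n p) - v k (tubeMap φ n (p.1, η p.1))‖ₑ) := by
      refine hqm.mul ?_
      exact (((hv1 k).1.continuous.comp hΨ).sub
        ((hv1 k).1.continuous.comp (hΨ.comp (by fun_prop)))).enorm.measurable
    calc _ ≤ ∫⁻ p in S, (q p.1 * ‖B.indicator f (tubeMap φ n p) - v k (tubeMap φ n p)‖ₑ +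
          (q p.1 * ‖v k (tubeMap φ n p) - v k (tubeMap φ n (p.1, η p.1))‖ₑ +
            q p.1 * ‖v k (tubeMap φ n (p.1, η p.1)) - g p.1‖ₑ)) ∂ν := by
          refine lintegral_mono fun p => ?_
          rw [← mul_add, ← mul_add]
          refine mul_le_mul' le_rfl ?_
          have := enorm_add_le (B.indicator f (tubeMap φ n p) - v k (tubeMap φ n p))
            (v k (tubeMap φ n p) - v k (tubeMap φ n (p.1, η p.1)) +
              (v k (tubeMap φ n (p.1, η p.1)) - g p.1))
          refine le_trans (le_of_eq ?_) (this.trans (add_le_add le_rfl (enorm_add_le _ _)))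
          congr 1; abel
      _ = ∫⁻ p in S, q p.1 * ‖B.indicator f (tubeMap φ n p) - v k (tubeMap φ n p)‖ₑ ∂ν +
          (∫⁻ p in S, q p.1 * ‖v k (tubeMap φ n p) - v k (tubeMap φ n (p.1, η p.1))‖ₑ ∂ν +
            ∫⁻ p in S, q p.1 * ‖v k (tubeMap φ n (p.1, η p.1)) - g p.1‖ₑ ∂ν) := by
          rw [lintegral_add_left' m1, lintegral_add_left m2]
      _ ≤ _ := by
          refine add_le_add (t1 k) (add_le_add ?_ (t3 k))
          refine (lintegral_graphLayer_sub_le hΩ hη hη1 hη2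
            ((hv1 k).1.of_le (by norm_num)) hq).trans ?_
          exact mul_le_mul' le_rfl (t2 k)
  have hlim : Tendsto (fun k => Q * (C * ∫⁻ x, ‖v k x - f x‖ₑ ∂μ) +
        (h' * (I + Q * (C * ∫⁻ x, ‖fderiv ℝ (v k) x - Df x‖ₑ ∂μ)) +
          Q * (L * ∫⁻ y, ‖v k (shellMap φ n η y) - g y‖ₑ ∂torusMeasure))) atTop
      (𝓝 (Q * (C * 0) + (h' * (I + Q * (C * 0)) + Q * (L * 0)))) := by
    have hm : ∀ {c : ℝ≥0∞} {x : ℕ → ℝ≥0∞} {l : ℝ≥0∞}, c ≠ ⊤ → Tendsto x atTop (𝓝 l) →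
        Tendsto (fun k => c * x k) atTop (𝓝 (c * l)) := fun hc hx =>
      ENNReal.Tendsto.const_mul hx (Or.inr hc)
    refine (hm hQt (hm hCt e1)).add (Tendsto.add ?_ (hm hQt (hm hLt e3)))
    exact hm ENNReal.ofReal_ne_top (tendsto_const_nhds.add (hm hQt (hm hCt e2)))
  simp only [mul_zero, add_zero, zero_add] at hlim
  exact ge_of_tendsto' hlim key

end Trace

/-- A smoothed Heaviside function of the height above the graph of `W`, which vanishes below
height `ε` and equals `1` above height `2ε`. -/
noncomputable def levelProfile (W : ℝ × Plane → ℝ) (ε : ℝ) (q : ℝ × (Plane × ℝ)) : ℝ :=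
  Real.smoothTransition ((q.2.2 - W (q.1, q.2.1)) / ε - 1)

section Level

variable {Ω : Set Space3} {φ n : Plane → Space3} {a b : ℝ} {W : ℝ × Plane → ℝ} {ε : ℝ}

lemma contDiff_levelProfile (hW : ContDiff ℝ 1 W) (ε : ℝ) : ContDiff ℝ 1 (levelProfile W ε) := by
  refine contDiff_smoothTransition.comp (ContDiff.sub (ContDiff.div_const ?_ _) contDiff_const)
  exact (contDiff_snd.comp contDiff_snd).sub
    (hW.comp (contDiff_fst.prodMk (contDiff_fst.comp contDiff_snd)))

lemma levelProfile_eq_zero (hε : 0 < ε) {t : ℝ} {y : Plane} {z : ℝ} (h : z ≤ W (t, y) + ε) :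
    levelProfile W ε (t, (y, z)) = 0 := by
  refine Real.smoothTransition.zero_of_nonpos ?_
  have : (z - W (t, y)) / ε ≤ 1 := by rw [div_le_one hε]; linarith
  exact sub_nonpos.2 this

lemma levelProfile_eq_one (hε : 0 < ε) {t : ℝ} {y : Plane} {z : ℝ} (h : W (t, y) + 2 * ε ≤ z) :
    levelProfile W ε (t, (y, z)) = 1 := by
  refine Real.smoothTransition.one_of_one_le ?_
  have : 2 ≤ (z - W (t, y)) / ε := by rw [le_div_iff₀ hε]; linarith
  change 1 ≤ (z - W (t, y)) / ε - 1
  linarith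

lemma fderiv_levelProfile (hW : ContDiff ℝ 1 W) (t : ℝ) (y : Plane) (z s : ℝ)
    (ξ : Plane) (ζ : ℝ) :
    fderiv ℝ (levelProfile W ε) (t, (y, z)) (s, (ξ, ζ)) =
      deriv Real.smoothTransition ((z - W (t, y)) / ε - 1) *
        ((ζ - fderiv ℝ W (t, y) (s, ξ)) / ε) := by
  have h1 : HasDerivAt (fun r : ℝ => (t + r * s, (y + r • ξ, z + r * ζ)))
      (s, (ξ, ζ)) 0 := by
    have e1 : HasDerivAt (fun r : ℝ => t + r * s) s 0 := by
      simpa using ((hasDerivAt_id (0 : ℝ)).mul_const s).const_add t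
    have e2 : HasDerivAt (fun r : ℝ => y + r • ξ) ξ 0 := by
      simpa using ((hasDerivAt_id (0 : ℝ)).smul_const ξ).const_add y
    have e3 : HasDerivAt (fun r : ℝ => z + r * ζ) ζ 0 := by
      simpa using ((hasDerivAt_id (0 : ℝ)).mul_const ζ).const_add z
    exact e1.prodMk (e2.prodMk e3)
  have h1' : HasDerivAt (fun r : ℝ => (t + r * s, y + r • ξ)) (s, ξ) 0 := by
    have e1 : HasDerivAt (fun r : ℝ => t + r * s) s 0 := by
      simpa using ((hasDerivAt_id (0 : ℝ)).mul_const s).const_add t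
    have e2 : HasDerivAt (fun r : ℝ => y + r • ξ) ξ 0 := by
      simpa using ((hasDerivAt_id (0 : ℝ)).smul_const ξ).const_add y
    exact e1.prodMk e2
  have hL : HasFDerivAt (levelProfile W ε) (fderiv ℝ (levelProfile W ε) (t, (y, z)))
      (t + 0 * s, (y + (0 : ℝ) • ξ, z + 0 * ζ)) := by
    simpa using ((contDiff_levelProfile hW ε).differentiable (by norm_num) (t, (y, z))).hasFDerivAt
  have h2 := HasFDerivAt.comp_hasDerivAt
    (f := fun r : ℝ => (t + r * s, (y + r • ξ, z + r * ζ))) 0 hL h1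
  have hW' : HasFDerivAt W (fderiv ℝ W (t, y)) (t + 0 * s, y + (0 : ℝ) • ξ) := by
    simpa using (hW.differentiable (by norm_num) (t, y)).hasFDerivAt
  have h3 := HasFDerivAt.comp_hasDerivAt (f := fun r : ℝ => (t + r * s, y + r • ξ)) 0 hW' h1'
  have e3 : HasDerivAt (fun r : ℝ => z + r * ζ) ζ 0 := by
    simpa using ((hasDerivAt_id (0 : ℝ)).mul_const ζ).const_add z
  have h4 := (((e3.sub h3).div_const ε).sub_const 1)
  have hS : HasDerivAt Real.smoothTransition
      (deriv Real.smoothTransition ((z - W (t, y)) / ε - 1))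
      ((z + 0 * ζ - W (t + 0 * s, y + (0 : ℝ) • ξ)) / ε - 1) := by
    have := (contDiff_smoothTransition.differentiable (by norm_num)
      ((z - W (t, y)) / ε - 1)).hasDerivAt
    simpa using this
  have h5 := HasDerivAt.comp (h := fun r : ℝ => (z + r * ζ - W (t + r * s, y + r • ξ)) / ε - 1)
    0 hS h4
  exact h2.unique h5

/-- The derivative of a function given in normal coordinates. -/
lemma fderiv_apply_tubeMap (h : IsReferenceDomain Ω φ n) {G : ℝ × Space3 → ℝ}
    {H : ℝ × (Plane × ℝ) → ℝ} (hG : ContDiff ℝ 1 G)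
    (hGH : ∀ (t : ℝ) (p : Plane × ℝ), p.2 ∈ Ioo a b → G (t, tubeMap φ n p) = H (t, p))
    {t : ℝ} {p : Plane × ℝ} (hp : p.2 ∈ Ioo a b) (s : ℝ) (ξ : Plane × ℝ) :
    fderiv ℝ G (t, tubeMap φ n p) (s, fderiv ℝ (tubeMap φ n) p ξ) =
      fderiv ℝ H (t, p) (s, ξ) := by
  have h1 : HasFDerivAt (tubeMap φ n) (fderiv ℝ (tubeMap φ n) p) p :=
    (h.contDiff_tubeMap.differentiable (by norm_num) p).hasFDerivAt
  have h2 : HasFDerivAt (Prod.map id (tubeMap φ n))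
      ((ContinuousLinearMap.id ℝ ℝ).prodMap (fderiv ℝ (tubeMap φ n) p)) (t, p) :=
    HasFDerivAt.prodMap (p := (t, p)) (hasFDerivAt_id t) h1
  have h3 : HasFDerivAt G (fderiv ℝ G (t, tubeMap φ n p)) (Prod.map id (tubeMap φ n) (t, p)) :=
    (hG.differentiable (by norm_num) _).hasFDerivAt
  have h4 := HasFDerivAt.comp (f := Prod.map id (tubeMap φ n)) (t, p) h3 h2
  have h5 : H =ᶠ[𝓝 (t, p)] G ∘ Prod.map id (tubeMap φ n) := by
    have : {q : ℝ × (Plane × ℝ) | q.2.2 ∈ Ioo a b} ∈ 𝓝 (t, p) :=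
      (isOpen_Ioo.preimage (continuous_snd.comp continuous_snd)).mem_nhds hp
    filter_upwards [this] with q hq
    exact (hGH q.1 q.2 hq).symm
  rw [(h4.congr_of_eventuallyEq h5).fderiv]
  rfl

/-- The transport derivative of the level function, along a velocity `v`, in terms of the
defects `g - ∂ₜW` and `v - g n`. -/
lemma norm_fderiv_level_le (h : IsReferenceDomain Ω φ n)
    (hab : IsTubularInterval φ n a b) {G : ℝ × Space3 → ℝ} (hG : ContDiff ℝ 1 G)
    (hW : ContDiff ℝ 1 W) (hε : 0 < ε)
    (hGH : ∀ (t : ℝ) (p : Plane × ℝ), p.2 ∈ Ioo a b →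
      G (t, tubeMap φ n p) = levelProfile W ε (t, p))
    {cS : ℝ} (hS : ∀ x, |deriv Real.smoothTransition x| ≤ cS) {c : ℝ} (hc : 0 < c)
    {t : ℝ} {p : Plane × ℝ} (hp : p.2 ∈ Ioo a b)
    (hcp : ∀ ξ, c * ‖ξ‖ ≤ ‖fderiv ℝ (tubeMap φ n) p ξ‖) (g : ℝ) (v : Space3) :
    ‖fderiv ℝ G (t, tubeMap φ n p) (1, v)‖ ≤
      cS / ε * (‖fderiv ℝ W (t, p.1) (1, 0) - g‖ + c⁻¹ *
        ((1 + ‖(fderiv ℝ W (t, p.1)).comp (ContinuousLinearMap.inr ℝ ℝ Plane)‖) *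
          ‖v - g • n p.1‖)) := by
  obtain ⟨e, he, -⟩ := hab.exists_equiv h hp
  obtain ⟨y, z⟩ := p
  set A := (fderiv ℝ W (t, y)).comp (ContinuousLinearMap.inr ℝ ℝ Plane) with hA
  set ξ := e.symm (v - g • n y) with hξ
  have hξ' : fderiv ℝ (tubeMap φ n) (y, z) ξ = v - g • n y := by
    rw [← he]; exact e.apply_symm_apply _
  have hv : v = fderiv ℝ (tubeMap φ n) (y, z) (ξ + g • (0, 1)) := by
    rw [map_add, map_smul, hξ', h.fderiv_tubeMap_normal]; abel
  have hcξ := hcp ξ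
  rw [hξ'] at hcξ
  have hξn : ‖ξ‖ ≤ c⁻¹ * ‖v - g • n y‖ := by
    rw [inv_mul_eq_div, le_div_iff₀ hc]; linarith
  have e1 : fderiv ℝ G (t, tubeMap φ n (y, z)) (1, v) =
      deriv Real.smoothTransition ((z - W (t, y)) / ε - 1) *
        ((ξ.2 + g - (fderiv ℝ W (t, y) (1, 0) + A ξ.1)) / ε) := by
    have e2 : ξ + g • ((0 : Plane), (1 : ℝ)) = (ξ.1, ξ.2 + g) := by
      ext <;> simp
    rw [hv, fderiv_apply_tubeMap h hG hGH hp, e2, fderiv_levelProfile hW]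
    congr 3
    rw [hA, ContinuousLinearMap.comp_apply, ← map_add]
    simp
  have hA1 : |A ξ.1| ≤ ‖A‖ * ‖ξ‖ :=
    (A.le_opNorm _).trans (mul_le_mul_of_nonneg_left (norm_fst_le ξ) (norm_nonneg _))
  have hA2 : |ξ.2| ≤ ‖ξ‖ := norm_snd_le ξ
  have e3 : |ξ.2 + g - (fderiv ℝ W (t, y) (1, 0) + A ξ.1)| ≤
      |fderiv ℝ W (t, y) (1, 0) - g| + (1 + ‖A‖) * ‖ξ‖ := by
    have : ξ.2 + g - (fderiv ℝ W (t, y) (1, 0) + A ξ.1) =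
      -(fderiv ℝ W (t, y) (1, 0) - g) + (ξ.2 - A ξ.1) := by ring
    rw [this]
    refine (abs_add_le _ _).trans ?_
    rw [abs_neg]
    have := abs_sub (ξ.2) (A ξ.1)
    nlinarith
  rw [e1, norm_mul, norm_div, Real.norm_of_nonneg hε.le, Real.norm_eq_abs, Real.norm_eq_abs,
    Real.norm_eq_abs, div_mul_eq_mul_div, ← mul_div_assoc]
  refine div_le_div_of_nonneg_right ?_ hε.le
  refine mul_le_mul (hS _) (e3.trans ?_) (abs_nonneg _) ((abs_nonneg _).trans (hS 0))
  refine add_le_add le_rfl ?_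
  calc (1 + ‖A‖) * ‖ξ‖ ≤ (1 + ‖A‖) * (c⁻¹ * ‖v - g • n y‖) :=
        mul_le_mul_of_nonneg_left hξn (by positivity)
    _ = _ := by ring

lemma fderiv_level_eq_zero (h : IsReferenceDomain Ω φ n)
    (hab : IsTubularInterval φ n a b) {G : ℝ × Space3 → ℝ} (hG : ContDiff ℝ 1 G)
    (hW : ContDiff ℝ 1 W) (hε : 0 < ε)
    (hGH : ∀ (t : ℝ) (p : Plane × ℝ), p.2 ∈ Ioo a b →
      G (t, tubeMap φ n p) = levelProfile W ε (t, p))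
    {t : ℝ} {p : Plane × ℝ} (hp : p.2 ∈ Ioo a b)
    (hpW : p.2 ∉ Icc (W (t, p.1) + ε) (W (t, p.1) + 2 * ε)) (v : Space3) :
    fderiv ℝ G (t, tubeMap φ n p) (1, v) = 0 := by
  obtain ⟨e, he, -⟩ := hab.exists_equiv h hp
  obtain ⟨y, z⟩ := p
  have hv : v = fderiv ℝ (tubeMap φ n) (y, z) (e.symm v) := by
    rw [← he]; exact (e.apply_symm_apply _).symm
  have e1 : deriv Real.smoothTransition ((z - W (t, y)) / ε - 1) = 0 := by
    rcases lt_or_ge z (W (t, y) + ε) with h1 | h1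
    · refine deriv_smoothTransition_of_nonpos ?_
      have : (z - W (t, y)) / ε ≤ 1 := by rw [div_le_one hε]; linarith
      exact sub_nonpos.2 this
    · refine deriv_smoothTransition_of_one_le ?_
      have : 2 ≤ (z - W (t, y)) / ε := by
        rw [le_div_iff₀ hε]
        by_contra hcon
        exact hpW ⟨h1, by linarith⟩
      linarith
  rw [hv, fderiv_apply_tubeMap h hG hGH hp]
  obtain ⟨ξ, ζ⟩ := e.symm v
  rw [fderiv_levelProfile hW, e1, zero_mul]

/-- A `C¹` function with values in `{0, 1}` on an open set has vanishing derivative there. -/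
lemma fderiv_eq_zero_of_zero_or_one {E : Type*} [NormedAddCommGroup E] [NormedSpace ℝ E]
    {G : E → ℝ} {x : E} (hG : DifferentiableAt ℝ G x) (h : ∀ᶠ y in 𝓝 x, G y = 0 ∨ G y = 1) :
    fderiv ℝ G x = 0 := by
  rcases h.self_of_nhds with h0 | h1
  · have hloc : ∀ᶠ y in 𝓝 x, G y = 0 := by
      have := hG.continuousAt.eventually (gt_mem_nhds (show G x < 1 by rw [h0]; exact one_pos))
      filter_upwards [h, this] with y hy hy'
      exact hy.resolve_right hy'.ne
    have : G =ᶠ[𝓝 x] fun _ => (0 : ℝ) := hloc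
    rw [this.fderiv_eq, fderiv_fun_const]; rfl
  · have hloc : ∀ᶠ y in 𝓝 x, G y = 1 := by
      have := hG.continuousAt.eventually (lt_mem_nhds (show 0 < G x by rw [h1]; exact one_pos))
      filter_upwards [h, this] with y hy hy'
      exact hy.resolve_left hy'.ne'
    have : G =ᶠ[𝓝 x] fun _ => (1 : ℝ) := hloc
    rw [this.fderiv_eq, fderiv_fun_const]; rfl

end Level

section LevelEstimate

variable {Ω : Set Space3} {φ n : Plane → Space3} {a b : ℝ} {W : ℝ × Plane → ℝ} {ε : ℝ}

lemma slabMeasure_graphLayer_le {η : Plane → ℝ} (hη : Continuous η) (a' b' h : ℝ) :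
    slabMeasure a' b' (graphLayer η h) ≤ ENNReal.ofReal h * torusMeasure univ := by
  rw [slabMeasure_eq_prod, Measure.prod_apply (measurableSet_graphLayer hη h),
    ← lintegral_const]
  refine lintegral_mono fun y => ?_
  refine (Measure.restrict_apply_le _ _).trans ?_
  have : Prod.mk y ⁻¹' graphLayer η h = Icc (η y) (η y + h) := rfl
  rw [this, Real.volume_Icc, add_sub_cancel_left]

lemma lintegral_graphLayer_fst_le {η : Plane → ℝ} (a' b' h : ℝ) (F : Plane → ℝ≥0∞)
    (hη : Continuous η) :
    ∫⁻ p in graphLayer η h, F p.1 ∂(slabMeasure a' b') ≤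
      ENNReal.ofReal h * ∫⁻ y, F y ∂torusMeasure := by
  rw [← lintegral_indicator (measurableSet_graphLayer hη h), slabMeasure_eq_prod,
    ← lintegral_const_mul' _ _ ENNReal.ofReal_ne_top]
  refine (lintegral_prod_le _).trans (lintegral_mono fun y => ?_)
  have h1 : ∀ z, (graphLayer η h).indicator (fun p => F p.1) (y, z) =
      (Icc (η y) (η y + h)).indicator (fun _ => F y) z := fun z => by
    by_cases hz : z ∈ Icc (η y) (η y + h)
    · rw [indicator_of_mem hz, indicator_of_mem (show (y, z) ∈ graphLayer η h from hz)]
    · rw [indicator_of_notMem hz, indicator_of_notMem (show (y, z) ∉ graphLayer η h from hz)]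
  simp_rw [h1]
  rw [lintegral_indicator measurableSet_Icc, lintegral_const, mul_comm]
  refine mul_le_mul' ?_ le_rfl
  rw [Measure.restrict_apply_univ]
  refine (Measure.restrict_apply_le _ _).trans ?_
  rw [Real.volume_Icc, add_sub_cancel_left]

lemma lintegral_prod_comp_tubeMap_le (hΩ : IsReferenceDomain Ω φ n) {a' b' : ℝ} {C : ℝ≥0∞}
    (hCt : C ≠ ⊤)
    (hC : Measure.map (tubeMap φ n) (slabMeasure a' b') ≤ C • (volume : Measure Space3))
    {μ : Measure ℝ} [SFinite μ] {F : ℝ × Space3 → ℝ≥0∞}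
    (hF : AEMeasurable F (μ.prod volume)) :
    ∫⁻ q, F (q.1, tubeMap φ n q.2) ∂(μ.prod (slabMeasure a' b')) ≤
      C * ∫⁻ q, F q ∂(μ.prod volume) := by
  rw [lintegral_prod _ hF, ← lintegral_const_mul' _ _ hCt]
  refine (lintegral_prod_le _).trans (lintegral_mono_ae ?_)
  filter_upwards [hF.aestronglyMeasurable.prodMk_left] with t ht
  exact lintegral_comp_tubeMap_le hΩ hC ht.aemeasurable

lemma aemeasurable_prod_comp_tubeMap (hΩ : IsReferenceDomain Ω φ n) {a' b' : ℝ} {C : ℝ≥0∞}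
    (hC : Measure.map (tubeMap φ n) (slabMeasure a' b') ≤ C • (volume : Measure Space3))
    {μ : Measure ℝ} [SFinite μ] {F : ℝ × Space3 → ℝ≥0∞}
    (hF : AEMeasurable F (μ.prod volume)) :
    AEMeasurable (fun q : ℝ × (Plane × ℝ) => F (q.1, tubeMap φ n q.2))
      (μ.prod (slabMeasure a' b')) := by
  have hq : Measure.QuasiMeasurePreserving (tubeMap φ n) (slabMeasure a' b') volume :=
    ⟨hΩ.continuous_tubeMap.measurable,
      (Measure.absolutelyContinuous_of_le hC).trans Measure.smul_absolutelyContinuous⟩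
  exact hF.comp_quasiMeasurePreserving (MeasureTheory.QuasiMeasurePreserving.prodMap (Measure.QuasiMeasurePreserving.id μ) hq)

/-- The transport derivative of the level function, at a fixed time. -/
lemma IsLagrangianTrace.lintegral_fderiv_level_le (hΩ : IsReferenceDomain Ω φ n)
    (hab : IsTubularInterval φ n a b) {a' b' r : ℝ} (ha : a < a') (hb' : b' < b)
    {C : ℝ≥0∞} (hCt : C ≠ ⊤)
    (hC : Measure.map (tubeMap φ n) (slabMeasure a' b') ≤ C • (volume : Measure Space3))
    (hC' : (volume : Measure Space3).restrict (tubeMap φ n '' (univ ×ˢ Icc a' b')) ≤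
        C • Measure.map (tubeMap φ n) (slabMeasure a' b'))
    {cS : ℝ} (hS : ∀ x, |deriv Real.smoothTransition x| ≤ cS) {c : ℝ} (hc : 0 < c)
    (hcp : ∀ p ∈ closedCell ×ˢ Icc a' b', ∀ ξ, c * ‖ξ‖ ≤ ‖fderiv ℝ (tubeMap φ n) p ξ‖)
    {G : ℝ × Space3 → ℝ} (hG : ContDiff ℝ 1 G) (hW : ContDiff ℝ 1 W) (hε : 0 < ε)
    (hGH : ∀ (t : ℝ) (p : Plane × ℝ), p.2 ∈ Ioo a b →
      G (t, tubeMap φ n p) = levelProfile W ε (t, p)) {t : ℝ}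
    (hGK : ∀ x ∉ tubeMap φ n '' (univ ×ˢ Icc a' b'), fderiv ℝ G (t, x) = 0)
    (hper : TorusPeriodic fun y => W (t, y))
    {η : Plane → ℝ} (hη : Continuous η) (hη1 : ∀ y, a' ≤ η y) (hη2 : ∀ y, η y + 3 * ε ≤ b')
    (hWη : ∀ y, |W (t, y) - η y| ≤ ε)
    {f : Space3 → Space3} {Df : Space3 → Space3 →L[ℝ] Space3} {g : Plane → ℝ}
    (hf : AEStronglyMeasurable f (volume.restrict (Metric.ball 0 r)))
    (hDf : AEStronglyMeasurable Df (volume.restrict (Metric.ball 0 r)))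
    (hg : AEStronglyMeasurable g torusMeasure)
    (htr : IsLagrangianTrace (Metric.ball 0 r) (shellMap φ n η) f Df (fun y => g y • n y)) :
    ∫⁻ x in Metric.ball 0 r, ‖fderiv ℝ G (t, x) (1, f x)‖ₑ ≤
      C * (ENNReal.ofReal (3 * cS) *
        (∫⁻ y, ‖fderiv ℝ W (t, y) (1, 0) - g y‖ₑ ∂torusMeasure + ENNReal.ofReal c⁻¹ *
          ∫⁻ p in graphLayer η (3 * ε),
            (1 + ‖(fderiv ℝ W (t, p.1)).comp (ContinuousLinearMap.inr ℝ ℝ Plane)‖ₑ) *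
            ‖(Metric.ball 0 r).indicator Df (tubeMap φ n p)‖ₑ ∂(slabMeasure a' b'))) := by
  set B := Metric.ball (0 : Space3) r with hB
  have hBm : MeasurableSet B := measurableSet_ball
  set A : Plane → (Plane →L[ℝ] ℝ) := fun y =>
    (fderiv ℝ W (t, y)).comp (ContinuousLinearMap.inr ℝ ℝ Plane) with hA
  have hDW : Continuous fun y : Plane => fderiv ℝ W (t, y) :=
    (hW.continuous_fderiv (by norm_num)).comp (by fun_prop)
  have hAc : Continuous A := hDW.clm_comp continuous_const
  set q : Plane → ℝ≥0∞ := fun y => 1 + ‖A y‖ₑ with hq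
  have hqm : Measurable q := measurable_const.add hAc.enorm.measurable
  set S := graphLayer η (3 * ε) with hS'
  have hSm : MeasurableSet S := measurableSet_graphLayer hη _
  set F : Space3 → ℝ≥0∞ := B.indicator fun x => ‖fderiv ℝ G (t, x) (1, f x)‖ₑ with hF
  have hDG : Continuous fun x : Space3 => fderiv ℝ G (t, x) :=
    (hG.continuous_fderiv (by norm_num)).comp (by fun_prop)
  have hFm : AEMeasurable F := by
    rw [hF, aemeasurable_indicator_iff hBm]
    have h1 : AEStronglyMeasurable (fun x => fderiv ℝ G (t, x) (1, f x)) (volume.restrict B) := by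
      have h2 : Continuous fun p : Space3 × Space3 => fderiv ℝ G (t, p.1) (1, p.2) :=
        (hDG.comp continuous_fst).clm_apply (by fun_prop)
      exact h2.comp_aestronglyMeasurable (aestronglyMeasurable_id.prodMk hf)
    exact h1.enorm
  have hac : Measure.map (tubeMap φ n) (slabMeasure a' b') ≪ (volume : Measure Space3) :=
    (Measure.absolutelyContinuous_of_le hC).trans Measure.smul_absolutelyContinuous
  have step1 : ∫⁻ x in B, ‖fderiv ℝ G (t, x) (1, f x)‖ₑ ≤
      C * ∫⁻ p, F (tubeMap φ n p) ∂(slabMeasure a' b') := by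
    rw [← lintegral_indicator hBm, ← lintegral_map' (hFm.mono_ac hac)
      hΩ.continuous_tubeMap.measurable.aemeasurable, ← smul_eq_mul, ← lintegral_smul_measure]
    refine le_trans (le_of_eq ?_) (lintegral_mono' hC' le_rfl)
    rw [← lintegral_indicator (isCompact_tubeMap_image hΩ a' b').isClosed.measurableSet]
    refine lintegral_congr fun x => ?_
    by_cases hx : x ∈ tubeMap φ n '' (univ ×ˢ Icc a' b')
    · rw [indicator_of_mem hx]
    · rw [indicator_of_notMem hx]
      by_cases hxB : x ∈ B
      · rw [indicator_of_mem hxB, hGK x hx]; simp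
      · rw [indicator_of_notMem hxB]
  refine step1.trans (mul_le_mul' le_rfl ?_)
  have hcS : 0 ≤ cS := (abs_nonneg _).trans (hS 0)
  have hpt : ∀ᵐ p ∂(slabMeasure a' b'), F (tubeMap φ n p) ≤ ENNReal.ofReal (cS / ε) *
      S.indicator (fun p => ‖fderiv ℝ W (t, p.1) (1, 0) - g p.1‖ₑ + ENNReal.ofReal c⁻¹ *
        (q p.1 * ‖B.indicator f (tubeMap φ n p) - g p.1 • n p.1‖ₑ)) p := by
    rw [slabMeasure]
    filter_upwards [ae_restrict_mem (measurableSet_halfOpenCell.prod measurableSet_Icc)] with p hp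
    have hpI : p.2 ∈ Ioo a b := ⟨ha.trans_le hp.2.1, hp.2.2.trans_lt hb'⟩
    by_cases hpB : tubeMap φ n p ∈ B
    swap
    · rw [hF, indicator_of_notMem hpB]; exact zero_le
    have e1 : F (tubeMap φ n p) =
        ‖fderiv ℝ G (t, tubeMap φ n p) (1, f (tubeMap φ n p))‖ₑ := indicator_of_mem hpB _
    rw [e1]
    by_cases hpS : p ∈ S
    · rw [indicator_of_mem hpS, indicator_of_mem hpB, ← ofReal_norm]
      refine (ENNReal.ofReal_le_ofReal (norm_fderiv_level_le hΩ hab hG hW hε hGH hS hc hpI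
        (hcp p ⟨halfOpenCell_subset hp.1, hp.2⟩) (g p.1) _)).trans (le_of_eq ?_)
      have hci : 0 ≤ c⁻¹ := (inv_pos.2 hc).le
      rw [ENNReal.ofReal_mul (by positivity), ENNReal.ofReal_add (norm_nonneg _) (by positivity),
        ENNReal.ofReal_mul hci, ENNReal.ofReal_mul (by positivity),
        ENNReal.ofReal_add zero_le_one (norm_nonneg _), ENNReal.ofReal_one, ofReal_norm,
        ofReal_norm, ofReal_norm]
    · rw [fderiv_level_eq_zero hΩ hab hG hW hε hGH hpI, enorm_zero]
      · exact zero_le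
      · intro hmem
        have := abs_le.1 (hWη p.1)
        exact hpS ⟨by linarith [hmem.1], by linarith [hmem.2]⟩
  obtain ⟨Q, hQ⟩ : ∃ Q : ℝ, ∀ y, ‖A y‖ ≤ Q := by
    have hAper : TorusPeriodic A := by
      intro k y
      have h1 : (fun x : ℝ × Plane => W (t, x.2 + latticeVec k)) = fun x => W (t, x.2) := by
        funext x; exact hper k x.2
      have hA' : ∀ y, A y = fderiv ℝ (fun y => W (t, y)) y := fun y => by
        have h2 : HasFDerivAt (fun y : Plane => (t, y)) (ContinuousLinearMap.inr ℝ ℝ Plane) y :=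
          (hasFDerivAt_prodMk_right t y)
        exact (HasFDerivAt.comp (f := fun y : Plane => (t, y)) y
          (hW.differentiable (by norm_num) (t, y)).hasFDerivAt h2).fderiv.symm
      rw [hA', hA']
      exact hper.fderiv k y
    obtain ⟨Q, hQ⟩ := isCompact_closedCell.exists_bound_of_continuousOn hAc.continuousOn
    refine ⟨Q, fun y => ?_⟩
    obtain ⟨k, y₀, hy₀, rfl⟩ := exists_mem_halfOpenCell y
    rw [hAper k y₀]
    exact hQ _ (halfOpenCell_subset hy₀)
  have hqQ : ∀ y, q y ≤ 1 + ENNReal.ofReal Q := fun y => by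
    refine add_le_add le_rfl ?_
    rw [← ofReal_norm]
    exact ENNReal.ofReal_le_ofReal (hQ y)
  have hnc := hΩ.normal_continuous
  have htrace := htr.lintegral_graphLayer_le hΩ hCt hC hη hη1 hη2 hf hDf
    (hg.smul hnc.aestronglyMeasurable) hqm (by finiteness) hqQ
  have hm1 : AEMeasurable (fun p : Plane × ℝ => ‖fderiv ℝ W (t, p.1) (1, 0) - g p.1‖ₑ)
      ((slabMeasure a' b').restrict S) := by
    refine AEMeasurable.restrict ?_
    rw [slabMeasure_eq_prod]
    have : AEMeasurable (fun y => ‖fderiv ℝ W (t, y) (1, 0) - g y‖ₑ) torusMeasure :=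
      ((hDW.clm_apply continuous_const).aestronglyMeasurable.sub hg).enorm
    exact this.comp_fst
  calc ∫⁻ p, F (tubeMap φ n p) ∂(slabMeasure a' b')
      ≤ ∫⁻ p, ENNReal.ofReal (cS / ε) *
      S.indicator (fun p => ‖fderiv ℝ W (t, p.1) (1, 0) - g p.1‖ₑ + ENNReal.ofReal c⁻¹ *
        (q p.1 * ‖B.indicator f (tubeMap φ n p) - g p.1 • n p.1‖ₑ)) p ∂(slabMeasure a' b') :=
        lintegral_mono_ae hpt
    _ = ENNReal.ofReal (cS / ε) *
        (∫⁻ p in S, ‖fderiv ℝ W (t, p.1) (1, 0) - g p.1‖ₑ ∂(slabMeasure a' b') +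
          ENNReal.ofReal c⁻¹ * ∫⁻ p in S, q p.1 *
            ‖B.indicator f (tubeMap φ n p) - g p.1 • n p.1‖ₑ ∂(slabMeasure a' b')) := by
        rw [lintegral_const_mul' _ _ ENNReal.ofReal_ne_top, lintegral_indicator hSm,
          lintegral_add_left' hm1, lintegral_const_mul' _ _ ENNReal.ofReal_ne_top]
    _ ≤ ENNReal.ofReal (cS / ε) *
        (ENNReal.ofReal (3 * ε) * ∫⁻ y, ‖fderiv ℝ W (t, y) (1, 0) - g y‖ₑ ∂torusMeasure +
          ENNReal.ofReal c⁻¹ * (ENNReal.ofReal (3 * ε) * ∫⁻ p in S, q p.1 *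
            ‖B.indicator Df (tubeMap φ n p)‖ₑ ∂(slabMeasure a' b'))) :=
        mul_le_mul' le_rfl (add_le_add (lintegral_graphLayer_fst_le a' b' _
          (fun y => ‖fderiv ℝ W (t, y) (1, 0) - g y‖ₑ) hη)
          (mul_le_mul' le_rfl htrace))
    _ = _ := by
        have e : ENNReal.ofReal (3 * cS) = ENNReal.ofReal (cS / ε) * ENNReal.ofReal (3 * ε) := by
          rw [← ENNReal.ofReal_mul (by positivity)]
          congr 1
          field_simp
        rw [e]
        ring

end LevelEstimate

section LevelFunction

variable {Ω : Set Space3} {φ n : Plane → Space3} {a b : ℝ}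

/-- A displacement with values in `(a, b)` keeps a positive distance from `a` and `b`. -/
lemma exists_margin {T : ℝ} (hT : 0 ≤ T) {w : ℝ → Plane → ℝ}
    (hper : ∀ t, TorusPeriodic (w t))
    (hc : ContinuousOn (Function.uncurry w) (Icc 0 T ×ˢ univ))
    (hw : ∀ t ∈ Icc 0 T, ∀ y : Plane, w t y ∈ Ioo a b) :
    ∃ a' b' m : ℝ, a < a' ∧ b' < b ∧ 0 < m ∧
      ∀ p, a' ≤ clampExtend T w p ∧ clampExtend T w p + m ≤ b' := by
  have hK : IsCompact (Icc 0 T ×ˢ closedCell) := isCompact_Icc.prod isCompact_closedCell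
  have hne : (Icc 0 T ×ˢ closedCell).Nonempty :=
    ⟨(0, 0), ⟨le_rfl, hT⟩, fun i => ⟨le_rfl, zero_le_one⟩⟩
  have hc' := hc.mono (prod_mono (le_refl (Icc 0 T)) (subset_univ closedCell))
  obtain ⟨p, hp, hmin⟩ := hK.exists_isMinOn hne hc'
  obtain ⟨q, hq, hmax⟩ := hK.exists_isMaxOn hne hc'
  have h1 := hw p.1 hp.1 p.2
  have h2 := hw q.1 hq.1 q.2
  refine ⟨(a + w p.1 p.2) / 2, (w q.1 q.2 + b) / 2, (b - w q.1 q.2) / 2, by linarith [h1.1],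
    by linarith [h2.2], by linarith [h2.2], fun x => ?_⟩
  obtain ⟨k, y₀, hy₀, hy⟩ := exists_mem_halfOpenCell x.2
  have hx : clampExtend T w x = w (max 0 (min x.1 T)) y₀ := by
    rw [clampExtend, hy]; exact hper _ k y₀
  have hmem : (max 0 (min x.1 T), y₀) ∈ Icc 0 T ×ˢ closedCell :=
    ⟨clamp_mem hT _, halfOpenCell_subset hy₀⟩
  have h3 : w p.1 p.2 ≤ w (max 0 (min x.1 T)) y₀ := hmin hmem
  have h4 : w (max 0 (min x.1 T)) y₀ ≤ w q.1 q.2 := hmax hmem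
  rw [hx]
  constructor <;> linarith [h1.1]

lemma MemL2L2.memLp_restrict {F : Type*} [NormedAddCommGroup F] {T τ : ℝ} (hτ : τ ≤ T)
    {B : Set Space3} {f : ℝ → Space3 → F} (h : MemL2L2 T (volume.restrict B) f) :
    MemLp (Function.uncurry f) 2 ((volume.restrict (Ioo 0 τ)).prod (volume.restrict B)) := by
  refine MemLp.mono_measure ?_ h
  rw [Measure.prod_restrict, Measure.prod_restrict]
  exact Measure.restrict_mono (prod_mono (Ioo_subset_Ioo le_rfl hτ) le_rfl) le_rfl

lemma lintegral_prod_slabMeasure_fst_le {μ : Measure ℝ} [SFinite μ] (a' b' : ℝ)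
    {F : ℝ × Plane → ℝ≥0∞} (hF : Measurable F) :
    ∫⁻ q, F (q.1, q.2.1) ∂(μ.prod (slabMeasure a' b')) ≤
      volume (Icc a' b') * ∫⁻ p, F p ∂(μ.prod torusMeasure) := by
  have hL : volume (Icc a' b') ≠ ⊤ := by rw [Real.volume_Icc]; exact ENNReal.ofReal_ne_top
  rw [lintegral_prod _ hF.aemeasurable, ← lintegral_const_mul' _ _ hL]
  refine (lintegral_prod_le _).trans (lintegral_mono fun t => ?_)
  rw [slabMeasure_eq_prod, ← lintegral_const_mul' _ _ hL]
  refine (lintegral_prod_le _).trans (lintegral_mono fun y => ?_)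
  change ∫⁻ _ in Icc a' b', F (t, y) ≤ _
  rw [lintegral_const, Measure.restrict_apply_univ, mul_comm]

/-- The space-time layer of width `h` above the moving boundary. -/
def movingLayer (η : ℝ × Plane → ℝ) (h : ℝ) : Set (ℝ × (Plane × ℝ)) :=
  {q | q.2 ∈ graphLayer (fun y => η (q.1, y)) h}

lemma measurableSet_movingLayer {η : ℝ × Plane → ℝ} (hη : Continuous η) (h : ℝ) :
    MeasurableSet (movingLayer η h) := by
  have : movingLayer η h = {q : ℝ × (Plane × ℝ) | η (q.1, q.2.1) ≤ q.2.2} ∩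
      {q | q.2.2 ≤ η (q.1, q.2.1) + h} := rfl
  rw [this]
  exact ((isClosed_le (by fun_prop) (by fun_prop)).inter
    (isClosed_le (by fun_prop) (by fun_prop))).measurableSet

lemma measure_movingLayer_le {μ : Measure ℝ} [SFinite μ] {η : ℝ × Plane → ℝ}
    (hη : Continuous η) (a' b' h : ℝ) :
    (μ.prod (slabMeasure a' b')) (movingLayer η h) ≤
      ENNReal.ofReal h * torusMeasure univ * μ univ := by
  rw [Measure.prod_apply (measurableSet_movingLayer hη h), ← lintegral_const]
  exact lintegral_mono fun t => slabMeasure_graphLayer_le (η := fun y => η (t, y))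
    (by fun_prop) a' b' h

/-- There are `C¹` functions that vanish inside the moving domain, equal `1` away from it, and are
almost transported by the velocity. -/
theorem exists_levelFunction (hΩ : IsReferenceDomain Ω φ n) (hab : IsTubularInterval φ n a b)
    {T τ : ℝ} (hT : 0 < T) (hτ : τ < T) {w wt : ℝ → Plane → ℝ} (hw : IsShellDisplacement T w wt)
    (hw_tube : ∀ t ∈ Icc 0 T, ∀ y : Plane, w t y ∈ Ioo a b) {r : ℝ}
    {u : ℝ → Space3 → Space3} {Du : ℝ → Space3 → Space3 →L[ℝ] Space3}
    (hu : MemL2H10 T (Metric.ball (0 : Space3) r) u Du)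
    (hcoupling : ∀ᵐ t ∂(volume.restrict (Ioo 0 T)),
      IsLagrangianTrace (Metric.ball (0 : Space3) r) (shellMap φ n (w t)) (u t) (Du t)
        (fun y => wt t y • n y)) {e : ℝ≥0∞} (he : 0 < e) {d : ℝ} (hd : 0 < d) :
    ∃ G : ℝ × Space3 → ℝ, ContDiff ℝ 1 G ∧ (∀ p, 0 ≤ G p ∧ G p ≤ 1) ∧
      (∀ t ∈ Icc 0 T, ∀ x ∈ fluidDomain Ω φ n a b (w t), G (t, x) = 0) ∧
      (∀ t, ∀ x ∉ tube φ n a b, x ∉ Ω → G (t, x) = 1) ∧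
      (∀ t ∈ Icc 0 T, ∀ p : Plane × ℝ, p.2 ∈ Ioo a b → w t p.1 + d ≤ p.2 →
        G (t, tubeMap φ n p) = 1) ∧
      ∫⁻ p in Ioo 0 τ ×ˢ Metric.ball (0 : Space3) r, ‖fderiv ℝ G p (1, u p.1 p.2)‖ₑ ≤ e := by
  obtain ⟨a', b', m, ha, hb', hm, hmargin⟩ :=
    exists_margin hT.le hw.periodic hw.continuousOn hw_tube
  obtain ⟨C, hCt, hC, hC'⟩ := hab.measure_comparison hΩ ha hb'
  obtain ⟨c, hc, hcp⟩ := hab.exists_lower_bound hΩ ha hb'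
  obtain ⟨cS, hcS, hS⟩ := exists_deriv_smoothTransition_le
  obtain ⟨C₁, hC₁, hmoll⟩ := hw.exists_mollification hT hτ
  have hη := continuous_clampExtend hT.le hw.periodic hw.continuousOn
  set η := clampExtend T w with hηdef
  set B := Metric.ball (0 : Space3) r with hB
  have hBm : MeasurableSet B := measurableSet_ball
  set μ := (volume : Measure ℝ).restrict (Ioo 0 τ) with hμ
  have hμf : IsFiniteMeasure μ := ⟨by
    rw [hμ, Measure.restrict_apply_univ]; exact measure_Ioo_lt_top⟩
  set ν := μ.prod (slabMeasure a' b') with hν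
  have hprod : μ.prod ((volume : Measure Space3).restrict B) =
      (μ.prod volume).restrict (univ ×ˢ B) := by
    rw [← Measure.prod_restrict, Measure.restrict_univ]
  have hDuLp := hu.memL2_grad.memLp_restrict hτ.le
  set F : ℝ × Space3 → ℝ≥0∞ := fun q => ‖B.indicator (Du q.1) q.2‖ₑ with hF
  have hFind : F = (univ ×ˢ B).indicator fun q => ‖Function.uncurry Du q‖ₑ := by
    funext q
    by_cases hq : q.2 ∈ B
    · rw [hF, indicator_of_mem (show q ∈ univ ×ˢ B from ⟨trivial, hq⟩)]
      simp only [indicator_of_mem hq]; rfl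
    · rw [hF, indicator_of_notMem (fun h : q ∈ univ ×ˢ B => hq h.2)]
      simp only [indicator_of_notMem hq]
      exact enorm_zero (E := Space3 →L[ℝ] Space3)
  have hFm : AEMeasurable F (μ.prod volume) := by
    rw [hFind, aemeasurable_indicator_iff (MeasurableSet.univ.prod hBm), ← hprod]
    exact hDuLp.1.enorm
  have hF2 : ∫⁻ q, F q ^ (2 : ℝ) ∂(μ.prod volume) < ⊤ := by
    have h1 : ∀ q, F q ^ (2 : ℝ) = (univ ×ˢ B).indicator
        (fun q => ‖Function.uncurry Du q‖ₑ ^ (2 : ℝ)) q := fun q => by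
      rw [hFind]
      by_cases hq : q ∈ univ ×ˢ B
      · rw [indicator_of_mem hq, indicator_of_mem hq]
      · rw [indicator_of_notMem hq, indicator_of_notMem hq]
        exact ENNReal.zero_rpow_of_pos two_pos
    simp_rw [h1]
    rw [lintegral_indicator (MeasurableSet.univ.prod hBm), ← hprod]
    have h2 := lintegral_rpow_enorm_lt_top_of_eLpNorm_lt_top (p := (2 : ℝ≥0∞)) (by norm_num)
      (by norm_num) hDuLp.2
    exact_mod_cast h2
  set D : ℝ × (Plane × ℝ) → ℝ≥0∞ := fun q => F (q.1, tubeMap φ n q.2) with hD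
  have hDm : AEMeasurable D ν := aemeasurable_prod_comp_tubeMap hΩ hC hFm
  have hD2 : ∫⁻ q, D q ^ (2 : ℝ) ∂ν ≠ ⊤ := by
    have := lintegral_prod_comp_tubeMap_le hΩ hCt hC (μ := μ) (hFm.pow_const (2 : ℝ))
    exact (this.trans_lt (ENNReal.mul_lt_top hCt.lt_top hF2)).ne
  set S : ℝ → Set (ℝ × (Plane × ℝ)) := fun ε => movingLayer η (3 * ε) with hSdef
  have hSm : ∀ ε, MeasurableSet (S ε) := fun ε => measurableSet_movingLayer hη _
  have hofReal : Tendsto (fun ε : ℝ => ENNReal.ofReal ε) (𝓝[>] 0) (𝓝 0) := by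
    have h1 := (ENNReal.continuous_ofReal.tendsto 0).mono_left
      (nhdsWithin_le_nhds (s := Ioi (0 : ℝ)))
    rwa [ENNReal.ofReal_zero] at h1
  have hSlim : Tendsto (ν ∘ S) (𝓝[>] 0) (𝓝 0) := by
    have h1 : Tendsto (fun ε : ℝ => ENNReal.ofReal (3 * ε) * (torusMeasure univ * μ univ))
        (𝓝[>] 0) (𝓝 (0 * (torusMeasure univ * μ univ))) := by
      refine ENNReal.Tendsto.mul_const ?_ (Or.inr (by finiteness))
      have h2 : Continuous fun ε : ℝ => ENNReal.ofReal (3 * ε) :=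
        ENNReal.continuous_ofReal.comp (by fun_prop)
      have h3 := (h2.tendsto 0).mono_left (nhdsWithin_le_nhds (s := Ioi (0 : ℝ)))
      rwa [mul_zero, ENNReal.ofReal_zero] at h3
    rw [zero_mul] at h1
    refine tendsto_of_tendsto_of_tendsto_of_le_of_le tendsto_const_nhds h1 (fun _ => zero_le)
      fun ε => ?_
    rw [← mul_assoc]
    exact measure_movingLayer_le hη a' b' _
  have hDlim := tendsto_setLIntegral_zero hD2 hSlim
  set M : ℝ≥0∞ := volume (Icc a' b') *
    (2 * ((μ.prod torusMeasure) univ + C₁)) with hM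
  have hMt : M ≠ ⊤ := by
    have : volume (Icc a' b') ≠ ⊤ := by rw [Real.volume_Icc]; exact ENNReal.ofReal_ne_top
    rw [hM]; finiteness
  have hlim : Tendsto (fun ε : ℝ => C * (ENNReal.ofReal (3 * cS) * (ENNReal.ofReal ε +
      ENNReal.ofReal c⁻¹ * (M ^ (1 / 2 : ℝ) *
        (∫⁻ q in S ε, D q ^ (2 : ℝ) ∂ν) ^ (1 / 2 : ℝ))))) (𝓝[>] 0) (𝓝 0) := by
    have hmul : ∀ {c : ℝ≥0∞} {x : ℝ → ℝ≥0∞}, c ≠ ⊤ → Tendsto x (𝓝[>] 0) (𝓝 0) →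
        Tendsto (fun k => c * x k) (𝓝[>] 0) (𝓝 0) := fun {c x} hc hx => by
      have := ENNReal.Tendsto.const_mul (a := c) hx (Or.inr hc)
      rwa [mul_zero] at this
    have h1 := (ENNReal.continuous_rpow_const (y := (1 / 2 : ℝ))).tendsto 0 |>.comp hDlim
    rw [ENNReal.zero_rpow_of_pos (by norm_num)] at h1
    have h2 := hofReal.add (hmul (c := ENNReal.ofReal c⁻¹) ENNReal.ofReal_ne_top
      (hmul (c := M ^ (1 / 2 : ℝ)) (by finiteness) h1))
    rw [add_zero] at h2
    exact hmul hCt (hmul ENNReal.ofReal_ne_top h2)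
  obtain ⟨ε, hεe, hε : 0 < ε, hεm⟩ : ∃ ε : ℝ, C * (ENNReal.ofReal (3 * cS) * (ENNReal.ofReal ε +
      ENNReal.ofReal c⁻¹ * (M ^ (1 / 2 : ℝ) *
        (∫⁻ q in S ε, D q ^ (2 : ℝ) ∂ν) ^ (1 / 2 : ℝ)))) < e ∧ ε ∈ Ioi 0 ∧ ε < min (m / 3) (d / 3) :=
    ((hlim.eventually (gt_mem_nhds he)).and (Filter.Eventually.and self_mem_nhdsWithin
      (nhdsWithin_le_nhds (gt_mem_nhds (show 0 < min (m / 3) (d / 3) by positivity))))).exists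
  obtain ⟨hεm1, hεm2⟩ := lt_min_iff.1 hεm
  obtain ⟨W, hW, hWper, hWη, hWt, hWD⟩ := hmoll ε hε
  have hWη' := fun p => abs_le.1 (hWη p)
  obtain ⟨G, hG, hGH, hGout⟩ := hab.exists_contDiff_extension hΩ ha hb'
    (contDiff_levelProfile hW ε)
    (fun t k y z => by simp only [levelProfile]; rw [show W (t, y + latticeVec k) = W (t, y) from
      hWper t k y])
    (fun t y z hz => levelProfile_eq_zero hε (by linarith [(hWη' (t, y)).1, (hmargin (t, y)).1]))
    (fun t y z hz => levelProfile_eq_one hε (by linarith [(hWη' (t, y)).2, (hmargin (t, y)).2]))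
  have htube : ∀ x ∈ tube φ n a b, ∃ p : Plane × ℝ, p.2 ∈ Ioo a b ∧ tubeMap φ n p = x := by
    intro x hx
    rw [tube_eq_image] at hx
    obtain ⟨p, hp, rfl⟩ := hx
    exact ⟨p, hp.2, rfl⟩
  have hGK : ∀ t, ∀ x ∉ tubeMap φ n '' (univ ×ˢ Icc a' b'), fderiv ℝ G (t, x) = 0 := by
    intro t x hx
    refine fderiv_eq_zero_of_zero_or_one (hG.differentiable (by norm_num) _) ?_
    have hopen : IsOpen {q : ℝ × Space3 | q.2 ∈ (tubeMap φ n '' (univ ×ˢ Icc a' b'))ᶜ} :=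
      (isCompact_tubeMap_image hΩ a' b').isClosed.isOpen_compl.preimage continuous_snd
    filter_upwards [hopen.mem_nhds hx] with q hq
    obtain ⟨s, x'⟩ := q
    by_cases hx' : x' ∈ tube φ n a b
    · obtain ⟨p, hp, rfl⟩ := htube x' hx'
      obtain ⟨y, z⟩ := p
      rw [hGH s _ hp]
      have hz : z < a' ∨ b' < z := by
        by_contra! hcon
        exact hq ⟨(y, z), ⟨trivial, hcon⟩, rfl⟩
      rcases hz with hz | hz
      · left
        exact levelProfile_eq_zero hε (by linarith [(hWη' (s, y)).1, (hmargin (s, y)).1])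
      · right
        exact levelProfile_eq_one hε (by linarith [(hWη' (s, y)).2, (hmargin (s, y)).2])
    · rw [hGout s x' hx']
      split_ifs <;> simp
  refine ⟨G, hG, ?_, ?_, ?_, ?_, ?_⟩
  · rintro ⟨t, x⟩
    by_cases hx : x ∈ tube φ n a b
    · obtain ⟨p, hp, rfl⟩ := htube x hx
      rw [hGH t p hp]
      exact ⟨Real.smoothTransition.nonneg _, Real.smoothTransition.le_one _⟩
    · rw [hGout t x hx]
      split_ifs <;> norm_num
  · rintro t ht x (hx | ⟨y, z, hz, hzw, rfl⟩)
    · rw [hGout t x hx.2, if_pos hx.1]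
    · have h1 := hGH t (y, z) hz
      refine h1.trans (levelProfile_eq_zero hε ?_)
      have h2 : η (t, y) = w t y := clampExtend_of_mem ht
      have := (hWη' (t, y)).1
      linarith
  · intro t x hx hxΩ
    rw [hGout t x hx, if_neg hxΩ]
  · rintro t ht ⟨y, z⟩ hz hzd
    rw [hGH t _ hz]
    refine levelProfile_eq_one hε ?_
    have h2 : η (t, y) = w t y := clampExtend_of_mem ht
    have := (hWη' (t, y)).2
    simp only at hzd
    linarith
  refine le_trans ?_ hεe.le
  set A : ℝ × Plane → (Plane →L[ℝ] ℝ) := fun p =>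
    (fderiv ℝ W p).comp (ContinuousLinearMap.inr ℝ ℝ Plane) with hA
  have hDW : Continuous (fderiv ℝ W) := hW.continuous_fderiv (by norm_num)
  have hAc : Continuous A := hDW.clm_comp continuous_const
  have hqm : Measurable fun p => 1 + ‖A p‖ₑ := measurable_const.add hAc.enorm.measurable
  set I₁ : ℝ → ℝ≥0∞ := fun t => ∫⁻ y, ‖fderiv ℝ W (t, y) (1, 0) - wt t y‖ₑ ∂torusMeasure with hI₁
  set I₂ : ℝ → ℝ≥0∞ := fun t => ∫⁻ p, (S ε).indicator
    (fun q => (1 + ‖A (q.1, q.2.1)‖ₑ) * D q) (t, p) ∂(slabMeasure a' b') with hI₂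
  have hsub : Ioo 0 τ ⊆ Ioo 0 T := Ioo_subset_Ioo le_rfl hτ.le
  have hwtm : AEStronglyMeasurable (Function.uncurry wt) (μ.prod torusMeasure) := by
    refine hw.memLinftyL2_wt.1.mono_measure ?_
    rw [hμ, prod_torusMeasure, prod_torusMeasure]
    exact Measure.restrict_mono (prod_mono hsub le_rfl) le_rfl
  have hum := (hu.memL2.memLp_restrict hτ.le).1
  have hslice : ∀ᵐ t ∂μ, ∫⁻ x in B, ‖fderiv ℝ G (t, x) (1, u t x)‖ₑ ≤
      C * (ENNReal.ofReal (3 * cS) * (I₁ t + ENNReal.ofReal c⁻¹ * I₂ t)) := by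
    filter_upwards [ae_restrict_of_ae_restrict_of_subset hsub hcoupling, hum.prodMk_left,
      hDuLp.1.prodMk_left, hwtm.prodMk_left, ae_restrict_mem measurableSet_Ioo]
      with t htr hut hDut hwtt ht
    have htT : t ∈ Icc 0 T := ⟨ht.1.le, ht.2.le.trans hτ.le⟩
    have hηt : (fun y => η (t, y)) = w t := funext fun y => clampExtend_of_mem htT
    rw [← hηt] at htr
    refine (htr.lintegral_fderiv_level_le hΩ hab ha hb' hCt hC hC' hS hc hcp hG hW hε hGH (hGK t)
      (hWper t) (by fun_prop) (fun y => (hmargin (t, y)).1)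
      (fun y => by linarith [(hmargin (t, y)).2]) (fun y => hWη (t, y)) hut hDut
      hwtt).trans (le_of_eq ?_)
    congr 4
    rw [hI₂, ← lintegral_indicator (measurableSet_graphLayer (by fun_prop) _)]
    rfl
  have hI₁m : AEMeasurable I₁ μ := by
    have h1 : AEMeasurable (fun p : ℝ × Plane => ‖fderiv ℝ W p (1, 0) - wt p.1 p.2‖ₑ)
        (μ.prod torusMeasure) :=
      ((hDW.clm_apply continuous_const).aestronglyMeasurable.sub hwtm).enorm
    exact h1.lintegral_prod_right'
  have hI₁le : ∫⁻ t, I₁ t ∂μ ≤ ENNReal.ofReal ε := by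
    have h1 : AEMeasurable (fun p : ℝ × Plane => ‖fderiv ℝ W p (1, 0) - wt p.1 p.2‖ₑ)
        (μ.prod torusMeasure) :=
      ((hDW.clm_apply continuous_const).aestronglyMeasurable.sub hwtm).enorm
    rw [hI₁, ← lintegral_prod (fun p : ℝ × Plane => ‖fderiv ℝ W p (1, 0) - wt p.1 p.2‖ₑ) h1,
      hμ, prod_torusMeasure]
    exact hWt
  have hq2 : ∫⁻ q, (1 + ‖A (q.1, q.2.1)‖ₑ) ^ (2 : ℝ) ∂ν ≤ M := by
    refine (lintegral_prod_slabMeasure_fst_le a' b' (hqm.pow_const (2 : ℝ))).trans ?_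
    refine mul_le_mul' le_rfl ?_
    calc ∫⁻ p, (1 + ‖A p‖ₑ) ^ (2 : ℝ) ∂(μ.prod torusMeasure)
        ≤ ∫⁻ p, 2 * (1 + ‖A p‖ₑ ^ (2 : ℝ)) ∂(μ.prod torusMeasure) := by
          refine lintegral_mono fun p => ?_
          have := ENNReal.rpow_add_le_mul_rpow_add_rpow 1 ‖A p‖ₑ (p := 2) (by norm_num)
          norm_num at this
          exact_mod_cast this
      _ = 2 * ((μ.prod torusMeasure) univ + ∫⁻ p, ‖A p‖ₑ ^ (2 : ℝ) ∂(μ.prod torusMeasure)) := by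
          rw [lintegral_const_mul' _ _ (by norm_num), lintegral_add_left measurable_const,
            lintegral_one]
      _ ≤ _ := by
          refine mul_le_mul' le_rfl (add_le_add le_rfl ?_)
          rw [hμ, prod_torusMeasure]
          exact hWD
  have hI₂le : ∫⁻ t, I₂ t ∂μ ≤
      M ^ (1 / 2 : ℝ) * (∫⁻ q in S ε, D q ^ (2 : ℝ) ∂ν) ^ (1 / 2 : ℝ) := by
    have hqm' : Measurable fun q : ℝ × (Plane × ℝ) => 1 + ‖A (q.1, q.2.1)‖ₑ :=
      hqm.comp (by fun_prop)
    rw [hI₂, ← lintegral_prod ((S ε).indicator fun q => (1 + ‖A (q.1, q.2.1)‖ₑ) * D q)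
      ((hqm'.aemeasurable.mul hDm).indicator (hSm ε)), lintegral_indicator (hSm ε)]
    refine (ENNReal.lintegral_mul_le_Lp_mul_Lq _ Real.HolderConjugate.two_two
      hqm'.aemeasurable.restrict hDm.restrict).trans ?_
    refine mul_le_mul' (ENNReal.rpow_le_rpow ?_ (by norm_num)) le_rfl
    exact (setLIntegral_le_lintegral _ _).trans hq2
  calc ∫⁻ p in Ioo 0 τ ×ˢ B, ‖fderiv ℝ G p (1, u p.1 p.2)‖ₑ
      ≤ ∫⁻ t, (∫⁻ x in B, ‖fderiv ℝ G (t, x) (1, u t x)‖ₑ) ∂μ := by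
        rw [Measure.volume_eq_prod, ← Measure.prod_restrict]
        exact lintegral_prod_le _
    _ ≤ ∫⁻ t, C * (ENNReal.ofReal (3 * cS) * (I₁ t + ENNReal.ofReal c⁻¹ * I₂ t)) ∂μ :=
        lintegral_mono_ae hslice
    _ = C * (ENNReal.ofReal (3 * cS) * (∫⁻ t, I₁ t ∂μ +
          ENNReal.ofReal c⁻¹ * ∫⁻ t, I₂ t ∂μ)) := by
        rw [lintegral_const_mul' _ _ hCt, lintegral_const_mul' _ _ ENNReal.ofReal_ne_top,
          lintegral_add_left' hI₁m, lintegral_const_mul' _ _ ENNReal.ofReal_ne_top]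
    _ ≤ _ := mul_le_mul' le_rfl (mul_le_mul' le_rfl (add_le_add hI₁le
        (mul_le_mul' le_rfl hI₂le)))

end LevelFunction

/-- The source term of the bounded renormalization `r ↦ r / (1 + κ r)`. -/
noncomputable def renormSource (κ z : ℝ) : ℝ := -(κ * z ^ 2) / (1 + κ * z) ^ 2

lemma mul_renormB_renormSource {κ r : ℝ} (hκ : 0 < κ) (hr : 0 ≤ r) :
    r * renormB (renormSource κ) (1 / (1 + κ)) r = r / (1 + κ * r) := by
  rcases hr.eq_or_lt with rfl | hr
  · simp
  have hpos : ∀ z ∈ uIcc 1 r, 0 < z := fun z hz => by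
    rw [mem_uIcc] at hz
    rcases hz with h | h
    · linarith [h.1]
    · exact hr.trans_le h.1
  have h1 : ∀ z ∈ uIcc 1 r, HasDerivAt (fun z : ℝ => 1 / (1 + κ * z))
      (renormSource κ z / z ^ 2) z := by
    intro z hz
    have hz0 := hpos z hz
    have h2 : HasDerivAt (fun z : ℝ => 1 + κ * z) κ z := by
      simpa using ((hasDerivAt_id z).const_mul κ).const_add 1
    have hne : 1 + κ * z ≠ 0 := by positivity
    have h3 := (hasDerivAt_const z (1 : ℝ)).div h2 hne
    have e : renormSource κ z / z ^ 2 = (0 * (1 + κ * z) - 1 * κ) / (1 + κ * z) ^ 2 := by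
      rw [renormSource]; field_simp; ring
    rw [e]; exact h3
  have hcont : ContinuousOn (fun z => renormSource κ z / z ^ 2) (uIcc 1 r) := by
    unfold renormSource
    refine ContinuousOn.div (ContinuousOn.div (by fun_prop) (by fun_prop) fun z hz => ?_)
      (by fun_prop) fun z hz => ?_
    · have := hpos z hz; positivity
    · have := hpos z hz; positivity
  rw [renormB, intervalIntegral.integral_eq_sub_of_hasDerivAt h1 hcont.intervalIntegrable]
  ring

lemma abs_renormSource {κ z : ℝ} (hκ : 0 < κ) : |renormSource κ z| =
    κ * z ^ 2 / (1 + κ * z) ^ 2 := by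
  rw [renormSource, neg_div, abs_neg, abs_of_nonneg (by positivity)]

lemma abs_renormSource_le {κ z : ℝ} (hκ : 0 < κ) (hz : 0 ≤ z) : |renormSource κ z| ≤ z := by
  have : 0 < 1 + κ * z := by positivity
  rw [abs_renormSource hκ, div_le_iff₀ (by positivity)]
  have h1 : 0 ≤ κ * z := by positivity
  nlinarith [mul_nonneg hz h1, mul_nonneg hz (mul_nonneg h1 h1)]

lemma abs_renormSource_le_mul_sq {κ z : ℝ} (hκ : 0 < κ) (hz : 0 ≤ z) :
    |renormSource κ z| ≤ κ * z ^ 2 := by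
  rw [abs_renormSource hκ]
  refine div_le_self (by positivity) ?_
  have : 1 ≤ 1 + κ * z := by linarith [mul_nonneg hκ.le hz]
  nlinarith

lemma abs_renormSource_le_inv {κ z : ℝ} (hκ : 0 < κ) (hz : 0 ≤ z) :
    |renormSource κ z| ≤ κ⁻¹ := by
  have : 0 < 1 + κ * z := by positivity
  rw [abs_renormSource hκ, div_le_iff₀ (by positivity), inv_mul_eq_div, le_div_iff₀ hκ]
  nlinarith [mul_nonneg hκ.le hz]

lemma measurable_renormSource (κ : ℝ) : Measurable (renormSource κ) := by
  unfold renormSource; fun_prop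

lemma continuousOn_renormSource {κ : ℝ} (hκ : 0 < κ) :
    ContinuousOn (renormSource κ) (Ici 0) := by
  unfold renormSource
  refine ContinuousOn.div (by fun_prop) (by fun_prop) fun z hz => ?_
  have : 0 ≤ z := hz
  positivity

lemma div_one_add_mul_le_inv {κ z : ℝ} (hκ : 0 < κ) (hz : 0 ≤ z) : z / (1 + κ * z) ≤ κ⁻¹ := by
  rw [div_le_iff₀ (by positivity), inv_mul_eq_div, le_div_iff₀ hκ]
  nlinarith

lemma continuous_divOf : Continuous divOf := by
  unfold divOf
  refine continuous_finsetSum _ fun i _ => ?_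
  exact (EuclideanSpace.proj i : Space3 →L[ℝ] ℝ).continuous.comp
    (continuous_id.clm_apply continuous_const)

lemma abs_divOf_le (A : Space3 →L[ℝ] Space3) : |divOf A| ≤ 3 * ‖A‖ := by
  have h1 : ∀ i : Fin 3, |(A (EuclideanSpace.single i 1)) i| ≤ ‖A‖ := fun i => by
    have h2 := PiLp.norm_apply_le (A (EuclideanSpace.single i 1)) i
    have h3 := A.le_opNorm (EuclideanSpace.single i 1)
    rw [PiLp.norm_single, norm_one, mul_one] at h3
    exact h2.trans h3
  calc |divOf A| ≤ ∑ i : Fin 3, |(A (EuclideanSpace.single i 1)) i| :=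
        Finset.abs_sum_le_sum_abs _ _
    _ ≤ ∑ _i : Fin 3, ‖A‖ := Finset.sum_le_sum fun i _ => h1 i
    _ = 3 * ‖A‖ := by simp

section Integrability

variable {T τ r : ℝ} {u : ℝ → Space3 → Space3} {Du : ℝ → Space3 → Space3 →L[ℝ] Space3}
  {ρ : ℝ → Space3 → ℝ}

lemma volume_restrict_prod (I : Set ℝ) (B : Set Space3) :
    (volume : Measure (ℝ × Space3)).restrict (I ×ˢ B) =
      (volume.restrict I).prod (volume.restrict B) := by
  rw [Measure.volume_eq_prod, Measure.prod_restrict]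

instance isFiniteMeasure_cylinder (τ r : ℝ) : IsFiniteMeasure
    ((volume : Measure (ℝ × Space3)).restrict (Ioo 0 τ ×ˢ Metric.ball 0 r)) := by
  have h1 : IsFiniteMeasure ((volume : Measure ℝ).restrict (Ioo 0 τ)) := ⟨by
    rw [Measure.restrict_apply_univ]; exact measure_Ioo_lt_top⟩
  have h2 : IsFiniteMeasure ((volume : Measure Space3).restrict (Metric.ball 0 r)) := ⟨by
    rw [Measure.restrict_apply_univ]; exact measure_ball_lt_top⟩
  rw [volume_restrict_prod]
  infer_instance

lemma MemLinftyLp.memLp_two (hρ : MemLinftyLp T 3 (volume.restrict (Metric.ball (0 : Space3) r)) ρ)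
    (hτ : τ ≤ T) :
    MemLp (Function.uncurry ρ) 2 (volume.restrict (Ioo 0 τ ×ˢ Metric.ball (0 : Space3) r)) := by
  set μ := (volume : Measure Space3).restrict (Metric.ball 0 r) with hμ
  have hfin : μ univ ≠ ⊤ := by
    rw [hμ, Measure.restrict_apply_univ]; exact measure_ball_lt_top.ne
  obtain ⟨hm, C, hC⟩ := hρ
  have h2 : MemLinftyLp T 2 μ ρ := by
    set A := ENNReal.ofReal C * μ univ ^ (1 / (2 : ℝ≥0∞).toReal - 1 / (3 : ℝ≥0∞).toReal) with hA
    have hAt : A ≠ ⊤ := by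
      refine ENNReal.mul_ne_top ENNReal.ofReal_ne_top ?_
      exact ENNReal.rpow_ne_top_of_nonneg (by norm_num) hfin
    refine ⟨hm, A.toReal, ?_⟩
    filter_upwards [hC, hm.prodMk_left] with t ht htm
    rw [ENNReal.ofReal_toReal hAt]
    exact (eLpNorm_le_eLpNorm_mul_rpow_measure_univ (by norm_num) htm).trans
      (mul_le_mul' ht le_rfl)
  have h3 := h2.lintegral_sq_lt_top
  have h4 : MemLp (Function.uncurry ρ) 2
      ((volume.restrict (Ioo 0 T)).prod (volume.restrict (Metric.ball (0 : Space3) r))) := by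
    refine ⟨hm, ?_⟩
    rw [eLpNorm_lt_top_iff_lintegral_rpow_enorm_lt_top (by norm_num) (by norm_num)]
    exact_mod_cast h3
  rw [← volume_restrict_prod] at h4
  exact h4.mono_measure (Measure.restrict_mono
    (prod_mono (Ioo_subset_Ioo le_rfl hτ) le_rfl) le_rfl)

lemma MemL2L2.memLp_cylinder {F : Type*} [NormedAddCommGroup F] {f : ℝ → Space3 → F}
    (h : MemL2L2 T (volume.restrict (Metric.ball (0 : Space3) r)) f) (hτ : τ ≤ T) :
    MemLp (Function.uncurry f) 2 (volume.restrict (Ioo 0 τ ×ˢ Metric.ball (0 : Space3) r)) := by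
  rw [volume_restrict_prod]
  exact h.memLp_restrict hτ

lemma MemL2H10.memLp_divOf (hu : MemL2H10 T (Metric.ball (0 : Space3) r) u Du) (hτ : τ ≤ T) :
    MemLp (fun p : ℝ × Space3 => divOf (Du p.1 p.2)) 2
      (volume.restrict (Ioo 0 τ ×ˢ Metric.ball (0 : Space3) r)) := by
  have h := hu.memL2_grad.memLp_cylinder hτ
  exact h.of_le_mul (c := 3) (continuous_divOf.comp_aestronglyMeasurable h.1)
    (Eventually.of_forall fun p => abs_divOf_le _)

lemma MemL2H10.lintegral_outerLayer_le (hr : 0 < r)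
    (hu : MemL2H10 T (Metric.ball (0 : Space3) r) u Du) (hτ : τ ≤ T) {l : ℝ} (hl : 1 < l) :
    ∫⁻ p in Ioo 0 τ ×ˢ (outerLayer (r / l) ∩ Metric.ball 0 r), ‖u p.1 p.2‖ₑ ≤
      ENNReal.ofReal (r * (l - 1)) *
        ∫⁻ p in Ioo 0 τ ×ˢ (outerLayer (r / l) ∩ Metric.ball 0 r), ‖Du p.1 p.2‖ₑ := by
  have hle : (volume : Measure (ℝ × Space3)).restrict
      (Ioo 0 τ ×ˢ (outerLayer (r / l) ∩ Metric.ball 0 r)) ≤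
      volume.restrict (Ioo 0 τ ×ˢ Metric.ball (0 : Space3) r) :=
    Measure.restrict_mono (prod_mono le_rfl inter_subset_right) le_rfl
  have hu1 := (hu.memL2.memLp_cylinder hτ).1
  have hD1 := (hu.memL2_grad.memLp_cylinder hτ).1
  have hu2 := hu1.mono_measure hle
  have hD2 := hD1.mono_measure hle
  rw [volume_restrict_prod] at hu1 hD1 hu2 hD2 ⊢
  rw [lintegral_prod (fun p : ℝ × Space3 => ‖u p.1 p.2‖ₑ) hu2.enorm,
    lintegral_prod (fun p : ℝ × Space3 => ‖Du p.1 p.2‖ₑ) hD2.enorm,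
    ← lintegral_const_mul' _ _ ENNReal.ofReal_ne_top]
  refine lintegral_mono_ae ?_
  filter_upwards [ae_restrict_of_ae_restrict_of_subset (Ioo_subset_Ioo le_rfl hτ) hu.memH10,
    hu1.prodMk_left, hD1.prodMk_left] with t ⟨v, hv⟩ h1 h2
  rw [← Measure.restrict_restrict (measurableSet_outerLayer _)]
  exact lintegral_outerLayer_le_of_testFields hr hv h1 h2 hl

/-- The transport equation for the bounded renormalization `ρ / (1 + κ ρ)`, with `C¹` test
functions that need not vanish on the boundary of the ball. -/
theorem RenormalizedContinuityEq.transportEq (hr : 0 < r) {τ' κ : ℝ} (hκ : 0 < κ) (hτ' : τ' < τ)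
    (hτ : τ ≤ T) {ρ₀ : Space3 → ℝ}
    (hρ : MemLinftyLp T 3 (volume.restrict (Metric.ball (0 : Space3) r)) ρ)
    (hρ_nonneg : ∀ᵐ p ∂(volume.restrict (Ioo 0 τ ×ˢ Metric.ball (0 : Space3) r)), 0 ≤ ρ p.1 p.2)
    (hu : MemL2H10 T (Metric.ball (0 : Space3) r) u Du)
    (hρ₀ : IntegrableOn ρ₀ (Metric.ball (0 : Space3) r) volume)
    (hρ₀_nonneg : ∀ᵐ x ∂(volume.restrict (Metric.ball (0 : Space3) r)), 0 ≤ ρ₀ x)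
    (hρu : RenormalizedContinuityEq τ (Metric.ball (0 : Space3) r) ρ₀ ρ u Du)
    {ψ : ℝ × Space3 → ℝ} (h : ContDiff ℝ 1 ψ) (hs : ∀ p : ℝ × Space3, τ' ≤ p.1 → ψ p = 0) :
    TransportEq τ (Metric.ball 0 r) (fun p => ρ p.1 p.2 / (1 + κ * ρ p.1 p.2))
      (fun p => u p.1 p.2) (fun p => renormSource κ (ρ p.1 p.2) * divOf (Du p.1 p.2))
      (fun x => ρ₀ x / (1 + κ * ρ₀ x)) ψ := by
  have hρm := (hρ.memLp_two hτ).1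
  have hrat : Measurable fun z : ℝ => z / (1 + κ * z) := by fun_prop
  have hβm : AEStronglyMeasurable (fun p : ℝ × Space3 => ρ p.1 p.2 / (1 + κ * ρ p.1 p.2))
      (volume.restrict (Ioo 0 τ ×ˢ Metric.ball 0 r)) :=
    (hrat.comp_aemeasurable hρm.aemeasurable).aestronglyMeasurable
  have hβ : ∀ᵐ p ∂(volume.restrict (Ioo 0 τ ×ˢ Metric.ball (0 : Space3) r)),
      |ρ p.1 p.2 / (1 + κ * ρ p.1 p.2)| ≤ κ⁻¹ := by
    filter_upwards [hρ_nonneg] with p hp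
    rw [abs_of_nonneg (by positivity)]
    exact div_one_add_mul_le_inv hκ hp
  have hui : IntegrableOn (fun p : ℝ × Space3 => u p.1 p.2)
      (Ioo 0 τ ×ˢ Metric.ball (0 : Space3) r) :=
    (hu.memL2.memLp_cylinder hτ).integrable (by norm_num)
  have hg : IntegrableOn (fun p : ℝ × Space3 => renormSource κ (ρ p.1 p.2) * divOf (Du p.1 p.2))
      (Ioo 0 τ ×ˢ Metric.ball (0 : Space3) r) := by
    refine Integrable.bdd_mul (c := κ⁻¹) ((hu.memLp_divOf hτ).integrable (by norm_num))
      ((measurable_renormSource κ).comp_aemeasurable hρm.aemeasurable).aestronglyMeasurable ?_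
    filter_upwards [hρ_nonneg] with p hp
    exact abs_renormSource_le_inv hκ hp
  have hβ₀ : IntegrableOn (fun x => ρ₀ x / (1 + κ * ρ₀ x)) (Metric.ball (0 : Space3) r) := by
    refine Integrable.mono hρ₀ (hrat.comp_aemeasurable hρ₀.1.aemeasurable).aestronglyMeasurable ?_
    filter_upwards [hρ₀_nonneg] with x hx
    rw [norm_div, Real.norm_of_nonneg (show 0 ≤ 1 + κ * ρ₀ x by positivity)]
    refine div_le_self (norm_nonneg _) ?_
    linarith [mul_nonneg hκ.le hx]
  have hsmooth : ∀ ψ : ℝ × Space3 → ℝ, ContDiff ℝ ∞ ψ → HasCompactSupport ψ →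
      tsupport ψ ⊆ Iio τ ×ˢ Metric.ball (0 : Space3) r →
      TransportEq τ (Metric.ball 0 r) (fun p => ρ p.1 p.2 / (1 + κ * ρ p.1 p.2))
      (fun p => u p.1 p.2) (fun p => renormSource κ (ρ p.1 p.2) * divOf (Du p.1 p.2))
      (fun x => ρ₀ x / (1 + κ * ρ₀ x)) ψ := by
    intro ψ h1 h2 h3
    have h4 := hρu (renormSource κ) (1 / (1 + κ)) (continuousOn_renormSource hκ)
      ⟨κ⁻¹, fun z hz => abs_renormSource_le_inv hκ hz⟩ (by simp [renormSource]) ψ h1 h2 h3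
    rw [TransportEq]
    have e1 : ∫ x in Metric.ball (0 : Space3) r, ρ₀ x / (1 + κ * ρ₀ x) * ψ (0, x) =
        ∫ x in Metric.ball (0 : Space3) r,
          ρ₀ x * renormB (renormSource κ) (1 / (1 + κ)) (ρ₀ x) * ψ (0, x) := by
      refine integral_congr_ae ?_
      filter_upwards [hρ₀_nonneg] with x hx
      rw [mul_renormB_renormSource hκ hx]
    rw [e1, ← h4]
    refine integral_congr_ae ?_
    filter_upwards [hρ_nonneg] with p hp
    rw [mul_renormB_renormSource hκ hp]
  have hDi := ((hu.memL2_grad.memLp_cylinder hτ).integrable (by norm_num)).2.ne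
  refine TransportEq.of_compactlySupported hτ' (fun ψ h1 h2 h3 => ?_) h hs
  refine TransportEq.of_boundary_layer hr hβm hβ hui hg hβ₀ (fun ψ h1 h2 h3 => ?_) (D := fun p =>
    ‖Du p.1 p.2‖ₑ) hDi (fun l hl => hu.lintegral_outerLayer_le hr hτ hl) h1 h2 h3
  exact TransportEq.of_contDiff_one Metric.isOpen_ball measure_ball_lt_top.ne hβm hβ hui hg hβ₀
    hsmooth h1 h2 h3

end Integrability

/-- A `C¹` cutoff in time: the primitive of `t ↦ -(τ - t)⁺` that vanishes for `t ≥ τ`. -/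
noncomputable def timeCutoff (τ t : ℝ) : ℝ := ∫ s in τ..t, -max (τ - s) 0

lemma hasDerivAt_timeCutoff (τ t : ℝ) : HasDerivAt (timeCutoff τ) (-max (τ - t) 0) t := by
  have hc : Continuous fun s : ℝ => -max (τ - s) 0 := by fun_prop
  exact intervalIntegral.integral_hasDerivAt_right (hc.intervalIntegrable _ _)
    (hc.stronglyMeasurableAtFilter _ _) hc.continuousAt

lemma contDiff_timeCutoff (τ : ℝ) : ContDiff ℝ 1 (timeCutoff τ) := by
  rw [contDiff_one_iff_deriv]
  refine ⟨fun t => (hasDerivAt_timeCutoff τ t).differentiableAt, ?_⟩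
  have : deriv (timeCutoff τ) = fun t => -max (τ - t) 0 :=
    funext fun t => (hasDerivAt_timeCutoff τ t).deriv
  rw [this]
  fun_prop

lemma timeCutoff_of_le {τ t : ℝ} (h : τ ≤ t) : timeCutoff τ t = 0 := by
  rw [timeCutoff, intervalIntegral.integral_congr (g := fun _ => (0 : ℝ))]
  · simp
  · intro s hs
    rw [uIcc_of_le h] at hs
    have : max (τ - s) 0 = 0 := max_eq_right (by linarith [hs.1])
    simp [this]

section Transport

variable {Ω : Set Space3} {φ n : Plane → Space3} {a b : ℝ}
  {T τ r : ℝ} {u : ℝ → Space3 → Space3} {Du : ℝ → Space3 → Space3 →L[ℝ] Space3}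
  {ρ : ℝ → Space3 → ℝ}

/-- The bounded renormalization of the density, tested with a level function. -/
lemma RenormalizedContinuityEq.lintegral_level_le (hr : 0 < r) {τ' κ M : ℝ} (hκ : 0 < κ)
    (hτ' : τ' < τ) (hτ : τ ≤ T) {ρ₀ : Space3 → ℝ}
    (hρ : MemLinftyLp T 3 (volume.restrict (Metric.ball (0 : Space3) r)) ρ)
    (hρ_nonneg : ∀ᵐ p ∂(volume.restrict (Ioo 0 τ ×ˢ Metric.ball (0 : Space3) r)), 0 ≤ ρ p.1 p.2)
    (hu : MemL2H10 T (Metric.ball (0 : Space3) r) u Du)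
    (hρ₀ : IntegrableOn ρ₀ (Metric.ball (0 : Space3) r) volume)
    (hρ₀_nonneg : ∀ᵐ x ∂(volume.restrict (Metric.ball (0 : Space3) r)), 0 ≤ ρ₀ x)
    (hρu : RenormalizedContinuityEq τ (Metric.ball (0 : Space3) r) ρ₀ ρ u Du)
    {G : ℝ × Space3 → ℝ} (hG : ContDiff ℝ 1 G) (hG01 : ∀ p, 0 ≤ G p ∧ G p ≤ 1)
    (hG0 : ∀ᵐ x ∂(volume.restrict (Metric.ball (0 : Space3) r)), ρ₀ x = 0 ∨ G (0, x) = 0)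
    {e : ℝ≥0∞} (he : e ≠ ⊤) (hGe : ∫⁻ p in Ioo 0 τ ×ˢ Metric.ball (0 : Space3) r,
      ‖fderiv ℝ G p (1, u p.1 p.2)‖ₑ ≤ e)
    (hM : ∀ t ∈ Icc 0 τ, |timeCutoff τ' t| ≤ M) :
    ∫⁻ p in Ioo 0 τ ×ˢ Metric.ball (0 : Space3) r,
        ENNReal.ofReal (ρ p.1 p.2 / (1 + κ * ρ p.1 p.2) * (max (τ' - p.1) 0 * G p)) ≤
      ENNReal.ofReal M * (ENNReal.ofReal κ⁻¹ * e +
        ∫⁻ p in Ioo 0 τ ×ˢ Metric.ball (0 : Space3) r,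
          ‖renormSource κ (ρ p.1 p.2) * divOf (Du p.1 p.2)‖ₑ) := by
  set μ := (volume : Measure (ℝ × Space3)).restrict (Ioo 0 τ ×ˢ Metric.ball 0 r) with hμ
  have hμm : ∀ᵐ p ∂μ, p ∈ Ioo 0 τ ×ˢ Metric.ball (0 : Space3) r :=
    ae_restrict_mem (measurableSet_Ioo.prod measurableSet_ball)
  set ψ : ℝ × Space3 → ℝ := fun p => timeCutoff τ' p.1 * G p with hψ
  have hψ1 : ContDiff ℝ 1 ψ := ((contDiff_timeCutoff τ').comp contDiff_fst).mul hG
  have htr := hρu.transportEq hr hκ hτ' hτ hρ hρ_nonneg hu hρ₀ hρ₀_nonneg hψ1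
    (fun p hp => by rw [hψ]; simp only [timeCutoff_of_le hp, zero_mul])
  rw [TransportEq] at htr
  have hinit : ∫ x in Metric.ball (0 : Space3) r, ρ₀ x / (1 + κ * ρ₀ x) * ψ (0, x) = 0 := by
    refine integral_eq_zero_of_ae ?_
    filter_upwards [hG0] with x hx
    rcases hx with hx | hx
    · simp [hx]
    · simp [hψ, hx]
  rw [hinit, sub_zero] at htr
  have hderiv : ∀ p : ℝ × Space3, fderiv ℝ ψ p (1, 0) + fderiv ℝ ψ p (0, u p.1 p.2) =
      -(max (τ' - p.1) 0 * G p) + timeCutoff τ' p.1 * fderiv ℝ G p (1, u p.1 p.2) := by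
    intro p
    have h1 : HasFDerivAt (fun p : ℝ × Space3 => timeCutoff τ' p.1)
        ((-max (τ' - p.1) 0) • ContinuousLinearMap.fst ℝ ℝ Space3) p :=
      (hasDerivAt_timeCutoff τ' p.1).comp_hasFDerivAt p hasFDerivAt_fst
    have h2 := h1.mul (hG.differentiable (by norm_num) p).hasFDerivAt
    have h3 : fderiv ℝ ψ p = _ := h2.fderiv
    rw [← map_add, h3]
    simp only [Prod.mk_add_mk, add_zero, zero_add, add_apply,
      smul_apply, ContinuousLinearMap.coe_fst', smul_eq_mul]
    ring
  simp only [hderiv] at htr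
  have hρm := (hρ.memLp_two hτ).1.aemeasurable
  have hrat : Measurable fun z : ℝ => z / (1 + κ * z) := by fun_prop
  have hβm : AEMeasurable (fun p : ℝ × Space3 => ρ p.1 p.2 / (1 + κ * ρ p.1 p.2)) μ :=
    hrat.comp_aemeasurable hρm
  have hβ : ∀ᵐ p ∂μ, ‖ρ p.1 p.2 / (1 + κ * ρ p.1 p.2)‖ ≤ κ⁻¹ := by
    filter_upwards [hρ_nonneg] with p hp
    rw [Real.norm_of_nonneg (by positivity)]
    exact div_one_add_mul_le_inv hκ hp
  have hum : AEStronglyMeasurable (fun p : ℝ × Space3 => u p.1 p.2) μ :=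
    (hu.memL2.memLp_cylinder hτ).1
  have hcut : Continuous fun p : ℝ × Space3 => timeCutoff τ' p.1 :=
    (contDiff_timeCutoff τ').continuous.comp continuous_fst
  have hDGm : AEStronglyMeasurable (fun p => fderiv ℝ G p (1, u p.1 p.2)) μ := by
    have h1 : Continuous fun q : (ℝ × Space3) × Space3 => fderiv ℝ G q.1 (1, q.2) :=
      ((hG.continuous_fderiv (by norm_num)).comp continuous_fst).clm_apply (by fun_prop)
    exact h1.comp_aestronglyMeasurable (aestronglyMeasurable_id.prodMk hum)
  have hDGi : Integrable (fun p => fderiv ℝ G p (1, u p.1 p.2)) μ :=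
    ⟨hDGm, hGe.trans_lt he.lt_top⟩
  have hcutM : ∀ᵐ p ∂μ, ‖timeCutoff τ' p.1‖ ≤ M := by
    filter_upwards [hμm] with p hp
    exact hM _ (Ioo_subset_Icc_self hp.1)
  have hmaxM : ∀ᵐ p ∂μ, ‖max (τ' - p.1) 0 * G p‖ ≤ |τ'| := by
    filter_upwards [hμm] with p hp
    rw [norm_mul, Real.norm_of_nonneg (le_max_right _ _), Real.norm_of_nonneg (hG01 p).1]
    refine (mul_le_of_le_one_right (le_max_right _ _) (hG01 p).2).trans ?_
    exact max_le (by linarith [hp.1.1, le_abs_self τ']) (abs_nonneg _)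
  have hmaxc : Continuous fun p : ℝ × Space3 => max (τ' - p.1) 0 * G p := by
    have := hG.continuous
    fun_prop
  have i1 : Integrable (fun p : ℝ × Space3 => ρ p.1 p.2 / (1 + κ * ρ p.1 p.2) *
      (max (τ' - p.1) 0 * G p)) μ := by
    refine Integrable.bdd_mul (c := κ⁻¹) ?_ hβm.aestronglyMeasurable hβ
    exact Integrable.of_bound hmaxc.aestronglyMeasurable _ hmaxM
  have i2 : Integrable (fun p : ℝ × Space3 => ρ p.1 p.2 / (1 + κ * ρ p.1 p.2) *
      (timeCutoff τ' p.1 * fderiv ℝ G p (1, u p.1 p.2))) μ :=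
    Integrable.bdd_mul (c := κ⁻¹) (Integrable.bdd_mul (c := M) hDGi hcut.aestronglyMeasurable
      hcutM) hβm.aestronglyMeasurable hβ
  have key : ∫ p, ρ p.1 p.2 / (1 + κ * ρ p.1 p.2) * (max (τ' - p.1) 0 * G p) ∂μ =
      ∫ p, ρ p.1 p.2 / (1 + κ * ρ p.1 p.2) *
        (timeCutoff τ' p.1 * fderiv ℝ G p (1, u p.1 p.2)) ∂μ -
      ∫ p, renormSource κ (ρ p.1 p.2) * divOf (Du p.1 p.2) * ψ p ∂μ := by
    rw [← htr, ← integral_sub i2]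
    · refine integral_congr_ae (Eventually.of_forall fun p => ?_)
      simp only
      ring
    · refine (i2.sub i1).congr (Eventually.of_forall fun p => ?_)
      simp only [Pi.sub_apply]
      ring
  have hnn : 0 ≤ᵐ[μ] fun p => ρ p.1 p.2 / (1 + κ * ρ p.1 p.2) * (max (τ' - p.1) 0 * G p) := by
    filter_upwards [hρ_nonneg] with p hp
    have := (hG01 p).1
    have h2 : 0 ≤ max (τ' - p.1) 0 := le_max_right _ _
    simp only [Pi.zero_apply]
    positivity
  rw [← ofReal_integral_eq_lintegral_ofReal i1 hnn, key]
  refine (ENNReal.ofReal_le_ofReal (le_abs_self _)).trans ?_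
  rw [← Real.norm_eq_abs, ofReal_norm]
  refine (enorm_sub_le).trans ?_
  have hM0 : ∀ᵐ p ∂μ, ‖timeCutoff τ' p.1‖ₑ ≤ ENNReal.ofReal M := by
    filter_upwards [hcutM] with p hp
    rw [← ofReal_norm]; exact ENNReal.ofReal_le_ofReal hp
  rw [mul_add]
  refine add_le_add ?_ ?_
  · refine (enorm_integral_le_lintegral_enorm _).trans ?_
    calc _ ≤ ∫⁻ p, ENNReal.ofReal M * (ENNReal.ofReal κ⁻¹ *
          ‖fderiv ℝ G p (1, u p.1 p.2)‖ₑ) ∂μ := by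
          refine lintegral_mono_ae ?_
          filter_upwards [hM0, hβ] with p h1 h2
          rw [enorm_mul, enorm_mul]
          have h3 : ‖ρ p.1 p.2 / (1 + κ * ρ p.1 p.2)‖ₑ ≤ ENNReal.ofReal κ⁻¹ := by
            rw [← ofReal_norm]; exact ENNReal.ofReal_le_ofReal h2
          calc _ ≤ ENNReal.ofReal κ⁻¹ * (ENNReal.ofReal M * ‖fderiv ℝ G p (1, u p.1 p.2)‖ₑ) :=
                mul_le_mul' h3 (mul_le_mul' h1 le_rfl)
            _ = _ := by ring
      _ ≤ _ := by
          rw [lintegral_const_mul' _ _ ENNReal.ofReal_ne_top,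
            lintegral_const_mul' _ _ ENNReal.ofReal_ne_top]
          exact mul_le_mul' le_rfl (mul_le_mul' le_rfl hGe)
  · refine (enorm_integral_le_lintegral_enorm _).trans ?_
    rw [← lintegral_const_mul' _ _ ENNReal.ofReal_ne_top]
    refine lintegral_mono_ae ?_
    filter_upwards [hM0] with p h1
    rw [enorm_mul, mul_comm]
    refine mul_le_mul' ?_ le_rfl
    rw [hψ, enorm_mul]
    refine (mul_le_mul' h1 ?_).trans (le_of_eq (mul_one _))
    rw [← ofReal_norm, Real.norm_of_nonneg (hG01 p).1]
    exact (ENNReal.ofReal_le_ofReal (hG01 p).2).trans (le_of_eq ENNReal.ofReal_one)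

/-- The deformed boundary is a null set. -/
lemma volume_range_shellMap (hΩ : IsReferenceDomain Ω φ n) (hab : IsTubularInterval φ n a b)
    {η : Plane → ℝ} (hη : Continuous η) (hper : TorusPeriodic η) {a' b' : ℝ} (ha : a < a')
    (hb' : b' < b) (hηI : ∀ y, η y ∈ Icc a' b') : volume (range (shellMap φ n η)) = 0 := by
  obtain ⟨C, hCt, hC, hC'⟩ := hab.measure_comparison hΩ ha hb'
  have hΦ : Continuous (shellMap φ n η) :=
    hΩ.continuous_tubeMap.comp (by fun_prop : Continuous fun y => (y, η y))
  have hrange : range (shellMap φ n η) = shellMap φ n η '' closedCell := by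
    refine Subset.antisymm ?_ (image_subset_range _ _)
    rintro _ ⟨y, rfl⟩
    obtain ⟨k, y₀, hy₀, rfl⟩ := exists_mem_halfOpenCell y
    refine ⟨y₀, halfOpenCell_subset hy₀, ?_⟩
    have h1 := hΩ.tubeMap_add k y₀ (η y₀)
    simp only [shellMap]
    rw [hper k y₀]
    exact h1.symm
  have hmeas : MeasurableSet (range (shellMap φ n η)) := by
    rw [hrange]
    exact (isCompact_closedCell.image hΦ).isClosed.measurableSet
  have hsub : range (shellMap φ n η) ⊆ tubeMap φ n '' (univ ×ˢ Icc a' b') := by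
    rintro _ ⟨y, rfl⟩
    exact ⟨(y, η y), ⟨trivial, hηI y⟩, rfl⟩
  have h1 : volume (range (shellMap φ n η)) =
      volume.restrict (tubeMap φ n '' (univ ×ˢ Icc a' b')) (range (shellMap φ n η)) := by
    rw [Measure.restrict_apply hmeas, inter_eq_left.2 hsub]
  have h2 : slabMeasure a' b' (tubeMap φ n ⁻¹' range (shellMap φ n η)) = 0 := by
    have h3 : slabMeasure a' b' (graphLayer η 0) = 0 := by
      have := slabMeasure_graphLayer_le hη a' b' 0
      rwa [ENNReal.ofReal_zero, zero_mul, nonpos_iff_eq_zero] at this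
    refine measure_mono_null_ae ?_ h3
    rw [slabMeasure]
    filter_upwards [ae_restrict_mem (measurableSet_halfOpenCell.prod measurableSet_Icc)] with p hp
    rintro ⟨y, hy⟩
    have hηy := hηI y
    obtain ⟨h4, k, h5⟩ := hab.injective p.1 y p.2 ⟨ha.trans_le hp.2.1, hp.2.2.trans_lt hb'⟩ (η y)
      ⟨ha.trans_le hηy.1, hηy.2.trans_lt hb'⟩ hy.symm
    have h6 : p.2 = η p.1 := by rw [h4, h5, hper k p.1]
    change p.2 ∈ Icc (η p.1) (η p.1 + 0)
    rw [h6, add_zero]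
    exact ⟨le_rfl, le_rfl⟩
  rw [h1]
  refine le_antisymm ((hC' _).trans ?_) zero_le
  rw [Measure.smul_apply, Measure.map_apply hΩ.continuous_tubeMap.measurable hmeas, h2, smul_zero]

end Transport

/-- The molecular pressure vanishes with the density. -/
lemma IsMolecularPressure.apply_zero {pM : ℝ → ℝ → ℝ} (h : IsMolecularPressure pM) {θ : ℝ}
    (hθ : 0 < θ) : pM 0 θ = 0 := by
  obtain ⟨P, Z₁, Z₂, hP, hP0, -, hZ₁, -, hstate⟩ := h.state
  have hθ' : 0 < θ ^ (3 / 2 : ℝ) := Real.rpow_pos_of_pos hθ _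
  have t1 : Tendsto (fun s => pM s θ) (𝓝[>] 0) (𝓝 (pM 0 θ)) := by
    have h1 : ContinuousWithinAt (Function.uncurry pM) (Ici 0 ×ˢ Ioi 0) (0, θ) :=
      h.continuousOn (0, θ) ⟨mem_Ici.2 le_rfl, hθ⟩
    have h2 : Tendsto (fun s : ℝ => (s, θ)) (𝓝[>] 0) (𝓝[Ici 0 ×ˢ Ioi 0] (0, θ)) := by
      refine tendsto_nhdsWithin_iff.2 ⟨?_, ?_⟩
      · exact ((by fun_prop : Continuous fun s : ℝ => (s, θ)).tendsto 0).mono_left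
          nhdsWithin_le_nhds
      · filter_upwards [self_mem_nhdsWithin] with s hs
        exact ⟨mem_Ici.2 (mem_Ioi.1 hs).le, hθ⟩
    exact h1.tendsto.comp h2
  have t2 : Tendsto (fun s => θ ^ (5 / 2 : ℝ) * P (s / θ ^ (3 / 2 : ℝ))) (𝓝[>] 0)
      (𝓝 (θ ^ (5 / 2 : ℝ) * P 0)) := by
    refine Tendsto.const_mul _ ?_
    have h1 : ContinuousWithinAt P (Ici 0) 0 := hP.continuousOn 0 (mem_Ici.2 le_rfl)
    refine h1.tendsto.comp (tendsto_nhdsWithin_iff.2 ⟨?_, ?_⟩)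
    · have h2 : Tendsto (fun s : ℝ => s / θ ^ (3 / 2 : ℝ)) (𝓝 0) (𝓝 (0 / θ ^ (3 / 2 : ℝ))) :=
        (continuous_id.div_const _).tendsto 0
      rw [zero_div] at h2
      exact h2.mono_left nhdsWithin_le_nhds
    · filter_upwards [self_mem_nhdsWithin] with s hs
      have : 0 < s := hs
      exact (div_pos this hθ').le
  have hev : (fun s => pM s θ) =ᶠ[𝓝[>] 0] fun s => θ ^ (5 / 2 : ℝ) * P (s / θ ^ (3 / 2 : ℝ)) := by
    filter_upwards [Ioo_mem_nhdsGT (show (0 : ℝ) < Z₁ * θ ^ (3 / 2 : ℝ) by positivity)] with s hs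
    exact hstate s hs.1 θ hθ (Or.inl hs.2.le)
  have := tendsto_nhds_unique (t1.congr' hev) t2
  rw [this, hP0, mul_zero]

/-- The density vanishes outside the moving domain, up to a time `τ' < T`. -/
theorem ae_density_eq_zero {Ω : Set Space3} {φ n : Plane → Space3} {a b : ℝ}
    (hΩ : IsReferenceDomain Ω φ n) (hab : IsTubularInterval φ n a b)
    {T : ℝ} {w wt : ℝ → Plane → ℝ} (hw : IsShellDisplacement T w wt)
    (hw_tube : ∀ t ∈ Icc 0 T, ∀ y : Plane, w t y ∈ Ioo a b) {r : ℝ} (hr : 0 < r)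
    {ρ : ℝ → Space3 → ℝ} {u : ℝ → Space3 → Space3} {Du : ℝ → Space3 → Space3 →L[ℝ] Space3}
    {ρ₀ : Space3 → ℝ}
    (hρ : MemLinftyLp T 3 (volume.restrict (Metric.ball (0 : Space3) r)) ρ)
    (hρ_nonneg : ∀ᵐ p ∂((volume.restrict (Ioo 0 T)).prod
      (volume.restrict (Metric.ball (0 : Space3) r))), 0 ≤ ρ p.1 p.2)
    (hu : MemL2H10 T (Metric.ball (0 : Space3) r) u Du)
    (hρ₀ : IntegrableOn ρ₀ (Metric.ball (0 : Space3) r) volume)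
    (hρ₀_nonneg : ∀ᵐ x ∂(volume.restrict (Metric.ball (0 : Space3) r)), 0 ≤ ρ₀ x)
    (hρu : ∀ τ ∈ Ioo 0 T,
      RenormalizedContinuityEq τ (Metric.ball (0 : Space3) r) ρ₀ ρ u Du)
    (hcoupling : ∀ᵐ t ∂(volume.restrict (Ioo 0 T)),
      IsLagrangianTrace (Metric.ball (0 : Space3) r) (shellMap φ n (w t)) (u t) (Du t)
        (fun y => wt t y • n y))
    (hinit : ∀ᵐ x ∂(volume.restrict (Metric.ball (0 : Space3) r)),
      x ∉ fluidDomain Ω φ n a b (w 0) → ρ₀ x = 0) {τ' : ℝ} (hτ'0 : 0 < τ') (hτ'T : τ' < T) :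
    ∀ᵐ t ∂(volume.restrict (Ioo 0 τ')), ∀ᵐ x ∂(volume.restrict (Metric.ball (0 : Space3) r)),
      x ∉ fluidDomain Ω φ n a b (w t) → ρ t x = 0 := by
  have hT : 0 < T := hτ'0.trans hτ'T
  obtain ⟨τ, hτ1, hτ2⟩ := exists_between hτ'T
  have hτ0 : 0 < τ := hτ'0.trans hτ1
  set B := Metric.ball (0 : Space3) r with hB
  set μ := (volume : Measure (ℝ × Space3)).restrict (Ioo 0 τ ×ˢ B) with hμ
  have hμm : ∀ᵐ p ∂μ, p ∈ Ioo 0 τ ×ˢ B :=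
    ae_restrict_mem (measurableSet_Ioo.prod measurableSet_ball)
  have hnn : ∀ᵐ p ∂μ, 0 ≤ ρ p.1 p.2 := by
    rw [← volume_restrict_prod] at hρ_nonneg
    exact ae_restrict_of_ae_restrict_of_subset
      (prod_mono (Ioo_subset_Ioo le_rfl hτ2.le) le_rfl) hρ_nonneg
  have hη := continuous_clampExtend hT.le hw.periodic hw.continuousOn
  have hwt : ∀ t ∈ Icc 0 T, (fun y => clampExtend T w (t, y)) = w t := fun t ht =>
    funext fun y => clampExtend_of_mem ht
  have hwc : ∀ t ∈ Icc 0 T, Continuous (w t) := fun t ht => by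
    rw [← hwt t ht]; fun_prop
  obtain ⟨M, hM⟩ := (isCompact_Icc (a := (0 : ℝ)) (b := τ)).exists_bound_of_continuousOn
    (contDiff_timeCutoff τ').continuous.continuousOn
  set κ : ℕ → ℝ := fun k => 1 / ((k : ℝ) + 1) with hκ
  have hκ0 : ∀ k, 0 < κ k := fun k => by simp only [hκ]; positivity
  have hκ1 : ∀ k, κ k ≤ 1 := fun k => by
    simp only [hκ]
    rw [div_le_one (by positivity)]; linarith [(Nat.cast_nonneg k : (0:ℝ) ≤ k)]
  have hκlim : Tendsto κ atTop (𝓝 0) := tendsto_one_div_add_atTop_nhds_zero_nat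
  choose G hG hG01 hGin hGout hGtube hGe using fun k : ℕ =>
    exists_levelFunction hΩ hab hT hτ2 hw hw_tube hu hcoupling
      (e := ENNReal.ofReal (κ k ^ 2)) (ENNReal.ofReal_pos.2 (pow_pos (hκ0 k) 2)) (hκ0 k)
  have hG0 : ∀ k, ∀ᵐ x ∂(volume.restrict B), ρ₀ x = 0 ∨ G k (0, x) = 0 := fun k => by
    filter_upwards [hinit] with x hx
    by_cases hxf : x ∈ fluidDomain Ω φ n a b (w 0)
    · exact Or.inr (hGin k 0 ⟨le_rfl, hT.le⟩ x hxf)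
    · exact Or.inl (hx hxf)
  have hρm : AEMeasurable (fun p : ℝ × Space3 => ρ p.1 p.2) μ :=
    (hρ.memLp_two hτ2.le).1.aemeasurable
  set s : ℕ → ℝ≥0∞ := fun k => ∫⁻ p, ‖renormSource (κ k) (ρ p.1 p.2) * divOf (Du p.1 p.2)‖ₑ ∂μ
    with hs
  have hslim : Tendsto s atTop (𝓝 0) := by
    have hdivm := (hu.memLp_divOf hτ2.le).1.aemeasurable
    have hprod : Integrable (fun p : ℝ × Space3 => ρ p.1 p.2 * divOf (Du p.1 p.2)) μ :=
      MemLp.integrable_mul (hρ.memLp_two hτ2.le) (hu.memLp_divOf hτ2.le)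
    have h1 := tendsto_lintegral_of_dominated_convergence' (μ := μ)
      (F := fun k (p : ℝ × Space3) => ‖renormSource (κ k) (ρ p.1 p.2) * divOf (Du p.1 p.2)‖ₑ)
      (f := fun _ => 0) (fun p => ‖ρ p.1 p.2 * divOf (Du p.1 p.2)‖ₑ)
      (fun k => (((measurable_renormSource (κ k)).comp_aemeasurable hρm).mul hdivm).enorm)
      (fun k => by
        filter_upwards [hnn] with p hp
        rw [enorm_mul, enorm_mul]
        refine mul_le_mul' ?_ le_rfl
        rw [← ofReal_norm, ← ofReal_norm]
        refine ENNReal.ofReal_le_ofReal ?_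
        rw [Real.norm_of_nonneg hp]
        exact abs_renormSource_le (hκ0 k) hp)
      hprod.2.ne ?_
    · rwa [lintegral_zero] at h1
    · filter_upwards [hnn] with p hp
      have h2 : Tendsto (fun k => renormSource (κ k) (ρ p.1 p.2)) atTop (𝓝 0) := by
        refine squeeze_zero_norm (a := fun k => κ k * ρ p.1 p.2 ^ 2)
          (fun k => abs_renormSource_le_mul_sq (hκ0 k) hp) ?_
        simpa using hκlim.mul_const (ρ p.1 p.2 ^ 2)
      have h3 := (h2.mul_const (divOf (Du p.1 p.2))).enorm
      rwa [zero_mul, enorm_zero] at h3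
  set f : ℕ → ℝ × Space3 → ℝ≥0∞ := fun k p =>
    ENNReal.ofReal (ρ p.1 p.2 / (1 + ρ p.1 p.2) * (max (τ' - p.1) 0 * G k p)) with hf
  have hfle : ∀ k, ∫⁻ p, f k p ∂μ ≤ ENNReal.ofReal M * (ENNReal.ofReal (κ k) + s k) := by
    intro k
    have h1 := (hρu τ ⟨hτ0, hτ2⟩).lintegral_level_le hr (hκ0 k) hτ1 hτ2.le hρ hnn hu hρ₀
      hρ₀_nonneg (hG k) (hG01 k) (hG0 k) ENNReal.ofReal_ne_top (hGe k) hM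
    have h2 : ENNReal.ofReal (κ k)⁻¹ * ENNReal.ofReal (κ k ^ 2) = ENNReal.ofReal (κ k) := by
      rw [← ENNReal.ofReal_mul (inv_pos.2 (hκ0 k)).le]
      congr 1
      have := (hκ0 k).ne'
      field_simp
    rw [h2] at h1
    refine le_trans (lintegral_mono_ae ?_) h1
    filter_upwards [hnn] with p hp
    refine ENNReal.ofReal_le_ofReal (mul_le_mul_of_nonneg_right ?_
      (mul_nonneg (le_max_right _ _) (hG01 k p).1))
    refine div_le_div_of_nonneg_left hp (by have := hκ0 k; positivity) ?_
    have := mul_le_mul_of_nonneg_right (hκ1 k) hp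
    linarith
  have hflim : Tendsto (fun k => ∫⁻ p, f k p ∂μ) atTop (𝓝 0) := by
    have h1 : Tendsto (fun k => ENNReal.ofReal (κ k)) atTop (𝓝 0) := by
      have := (ENNReal.continuous_ofReal.tendsto 0).comp hκlim
      rwa [ENNReal.ofReal_zero] at this
    have h2 := ENNReal.Tendsto.const_mul (a := ENNReal.ofReal M) (h1.add hslim)
      (Or.inr ENNReal.ofReal_ne_top)
    rw [add_zero, mul_zero] at h2
    exact tendsto_of_tendsto_of_tendsto_of_le_of_le tendsto_const_nhds h2 (fun _ => zero_le) hfle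
  have hfm : ∀ k, AEMeasurable (f k) μ := fun k => by
    have h1 : Measurable fun z : ℝ => z / (1 + z) := by fun_prop
    have h2 : Measurable fun p : ℝ × Space3 => max (τ' - p.1) 0 * G k p := by
      have := (hG k).continuous
      fun_prop
    exact ((h1.comp_aemeasurable hρm).mul h2.aemeasurable).ennreal_ofReal
  have hliminf : ∀ᵐ p ∂μ, liminf (fun k => f k p) atTop = 0 := by
    have h1 := lintegral_liminf_le' (u := atTop) hfm
    have h2 : (fun p => liminf (fun k => f k p) atTop) =ᵐ[μ]
        fun p => liminf (fun k => (hfm k).mk (f k) p) atTop := by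
      filter_upwards [ae_all_iff.2 fun k => (hfm k).ae_eq_mk] with p hp
      simp only [hp]
    have h3 : Measurable fun p => liminf (fun k => (hfm k).mk (f k) p) atTop :=
      Measurable.liminf fun k => (hfm k).measurable_mk
    rw [hflim.liminf_eq, nonpos_iff_eq_zero, lintegral_eq_zero_iff' ⟨_, h3, h2⟩] at h1
    exact h1
  have hmain : ∀ᵐ p ∂μ, p.1 < τ' → p.2 ∉ fluidDomain Ω φ n a b (w p.1) →
      p.2 ∉ range (shellMap φ n (w p.1)) → ρ p.1 p.2 = 0 := by
    filter_upwards [hliminf, hnn, hμm] with p hp1 hp2 hp3 hpt hpf hpg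
    obtain ⟨t, x⟩ := p
    simp only at hp2 hpt hpf hpg ⊢
    have htT : t ∈ Icc 0 T := ⟨hp3.1.1.le, hp3.1.2.le.trans hτ2.le⟩
    have hev : ∀ᶠ k in atTop, G k (t, x) = 1 := by
      by_cases hx : x ∈ tube φ n a b
      · obtain ⟨y, z, hz, rfl⟩ := hx
        have h1 : w t y < z := by
          rcases lt_trichotomy z (w t y) with h | h | h
          · exact (hpf (Or.inr ⟨y, z, hz, h, rfl⟩)).elim
          · exact (hpg ⟨y, by rw [shellMap, h]⟩).elim
          · exact h
        filter_upwards [hκlim.eventually (gt_mem_nhds (sub_pos.2 h1))] with k hk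
        exact hGtube k t htT (y, z) hz (by simp only; linarith)
      · refine Eventually.of_forall fun k => hGout k t x hx fun hxΩ => ?_
        exact hpf (Or.inl ⟨hxΩ, hx⟩)
    have h2 : (fun k => f k (t, x)) =ᶠ[atTop] fun _ =>
        ENNReal.ofReal (ρ t x / (1 + ρ t x) * max (τ' - t) 0) := by
      filter_upwards [hev] with k hk
      simp only [hf, hk, mul_one]
    rw [liminf_congr h2, liminf_const, ENNReal.ofReal_eq_zero,
      max_eq_left (sub_pos.2 hpt).le] at hp1
    by_contra hne
    have h3 : 0 < ρ t x := lt_of_le_of_ne hp2 (Ne.symm hne)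
    have h4 : 0 < τ' - t := sub_pos.2 hpt
    have : 0 < ρ t x / (1 + ρ t x) * (τ' - t) := by positivity
    linarith
  rw [hμ, volume_restrict_prod] at hmain
  have hslices := ae_restrict_of_ae_restrict_of_subset (Ioo_subset_Ioo le_rfl hτ1.le)
    (Measure.ae_ae_of_ae_prod hmain)
  obtain ⟨a', b', m, ha, hb', hm, hmargin⟩ :=
    exists_margin hT.le hw.periodic hw.continuousOn hw_tube
  filter_upwards [hslices, ae_restrict_mem measurableSet_Ioo] with t ht htm
  have htT : t ∈ Icc 0 T := ⟨htm.1.le, htm.2.le.trans hτ'T.le⟩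
  have hgraph : volume (range (shellMap φ n (w t))) = 0 := by
    refine volume_range_shellMap hΩ hab (hwc t htT) (hw.periodic t) ha hb' fun y => ?_
    have h1 := hmargin (t, y)
    rw [clampExtend_of_mem htT] at h1
    exact ⟨h1.1, by linarith [h1.2]⟩
  have hgraph' : ∀ᵐ x ∂(volume.restrict B), x ∉ range (shellMap φ n (w t)) :=
    ae_restrict_of_ae (measure_eq_zero_iff_ae_notMem.1 hgraph)
  filter_upwards [ht, hgraph'] with x hx hxg hxf
  exact hx htm.2 hxf hxg

theorem lemma3p1
    -- the reference domain, its boundary parametrization, outer normal and tubular neighbourhood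
    (Ω : Set Space3) (φ n : Plane → Space3) (a b : ℝ)
    (hΩ : IsReferenceDomain Ω φ n) (hab : IsTubularInterval φ n a b)
    -- the displacement `w`, with time derivative `wt`
    (T : ℝ) (hT : 0 < T) (w wt : ℝ → Plane → ℝ) (hw : IsShellDisplacement T w wt)
    (hw_tube : ∀ t ∈ Icc 0 T, ∀ y : Plane, w t y ∈ Ioo a b)
    -- the ball `B` that contains all fluid domains
    (R : ℝ) (hR : 0 < R)
    (hB : ∀ t ∈ Icc 0 T, fluidDomain Ω φ n a b (w t) ⊆ Metric.ball (0 : Space3) (2 * R))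
    -- the density `ρ`, the velocity `u` with gradient `Du`, and the initial density `ρ₀`
    (ρ : ℝ → Space3 → ℝ) (u : ℝ → Space3 → Space3) (Du : ℝ → Space3 → Space3 →L[ℝ] Space3)
    (ρ₀ : Space3 → ℝ)
    (hρ : MemLinftyLp T 3 (volume.restrict (Metric.ball (0 : Space3) (2 * R))) ρ)
    (hρ_nonneg : ∀ᵐ p ∂((volume.restrict (Ioo 0 T)).prod
      (volume.restrict (Metric.ball (0 : Space3) (2 * R)))), 0 ≤ ρ p.1 p.2)
    (hu : MemL2H10 T (Metric.ball (0 : Space3) (2 * R)) u Du)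
    (hρ₀ : IntegrableOn ρ₀ (Metric.ball (0 : Space3) (2 * R)) volume)
    (hρ₀_nonneg : ∀ᵐ x ∂(volume.restrict (Metric.ball (0 : Space3) (2 * R))), 0 ≤ ρ₀ x)
    (hρu : ∀ τ ∈ Ioo 0 T,
      RenormalizedContinuityEq τ (Metric.ball (0 : Space3) (2 * R)) ρ₀ ρ u Du)
    -- the kinematic coupling condition `∂ₜ w n = u ∘ Φ_w` on `Γ`
    (hcoupling : ∀ᵐ t ∂(volume.restrict (Ioo 0 T)),
      IsLagrangianTrace (Metric.ball (0 : Space3) (2 * R)) (shellMap φ n (w t)) (u t) (Du t)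
        (fun y => wt t y • n y))
    -- the initial density vanishes outside the initial fluid domain
    (hinit : ∀ᵐ x ∂(volume.restrict (Metric.ball (0 : Space3) (2 * R))),
      x ∉ fluidDomain Ω φ n a b (w 0) → ρ₀ x = 0) :
    (∀ᵐ t ∂(volume.restrict (Ioo 0 T)),
      ∀ᵐ x ∂(volume.restrict (Metric.ball (0 : Space3) (2 * R))),
        x ∉ fluidDomain Ω φ n a b (w t) → ρ t x = 0) ∧
    (∀ (pM : ℝ → ℝ → ℝ) (θ : ℝ → Space3 → ℝ), IsMolecularPressure pM →
      (∀ᵐ p ∂((volume.restrict (Ioo 0 T)).prod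
        (volume.restrict (Metric.ball (0 : Space3) (2 * R)))), 0 < θ p.1 p.2) →
      ∀ᵐ t ∂(volume.restrict (Ioo 0 T)),
        ∀ᵐ x ∂(volume.restrict (Metric.ball (0 : Space3) (2 * R))),
          x ∉ fluidDomain Ω φ n a b (w t) → pM (ρ t x) (θ t x) = 0) := by
  have hr : 0 < 2 * R := by positivity
  have hdens : ∀ᵐ t ∂(volume.restrict (Ioo 0 T)),
      ∀ᵐ x ∂(volume.restrict (Metric.ball (0 : Space3) (2 * R))),
        x ∉ fluidDomain Ω φ n a b (w t) → ρ t x = 0 := by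
    have hk0 : ∀ k : ℕ, (0 : ℝ) < k + 2 := fun k => by positivity
    have h1 : ∀ k : ℕ, ∀ᵐ t ∂(volume : Measure ℝ), t ∈ Ioo 0 (T - T / (k + 2)) →
        ∀ᵐ x ∂(volume.restrict (Metric.ball (0 : Space3) (2 * R))),
          x ∉ fluidDomain Ω φ n a b (w t) → ρ t x = 0 := fun k => by
      rw [← ae_restrict_iff' measurableSet_Ioo]
      refine ae_density_eq_zero hΩ hab hw hw_tube hr hρ hρ_nonneg hu hρ₀ hρ₀_nonneg hρu hcoupling
        hinit ?_ (by have := div_pos hT (hk0 k); linarith)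
      rw [sub_pos, div_lt_iff₀ (hk0 k)]
      nlinarith [(Nat.cast_nonneg k : (0 : ℝ) ≤ k)]
    rw [ae_restrict_iff' measurableSet_Ioo]
    filter_upwards [ae_all_iff.2 h1] with t ht htT
    have hlim : Tendsto (fun k : ℕ => T - T / ((k : ℝ) + 2)) atTop (𝓝 (T - 0)) := by
      refine Tendsto.sub tendsto_const_nhds (Tendsto.div_atTop tendsto_const_nhds ?_)
      exact tendsto_atTop_add_const_right _ _ tendsto_natCast_atTop_atTop
    rw [sub_zero] at hlim
    obtain ⟨k, hk⟩ := (hlim.eventually (lt_mem_nhds htT.2)).exists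
    exact ht k ⟨htT.1, hk⟩
  refine ⟨hdens, fun pM θ hpM hθ => ?_⟩
  filter_upwards [hdens, Measure.ae_ae_of_ae_prod hθ] with t ht hθt
  filter_upwards [ht, hθt] with x hx hθx hxf
  rw [hx hxf]
  exact hpM.apply_zero hθx
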